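/- Let $L>0$ and let $\mathcal G_L$ be the tadpole graph: a loop $c\cong[-L,L]$ and a half-line $h\cong[0,\infty)$ glued at one vertex, namely $-L\sim L\sim 0_h$. A function on $\mathcal G_L$ is a pair $v=(v_c,v_h)$, $v_c:[-L,L]\to\mathbb C$, $v_h:[0,\infty)\to\mathbb C$, and $\|v\|_{L^p(\mathcal G_L)}^p=\|v_c\|_{L^p(-L,L)}^p+\|v_h\|_{L^p(0,\infty)}^p$. Let $H^1_D(\mathcal G_L)$ be the set of $v$ with $v_c\in H^1(-L,L)$, $v_h\in H^1(0,\infty)$ and $v_c(L)=v_c(-L)=v_h(0)=:v(\mathrm v)$. For $\omega,\gamma>0$ and $v\in H^1_D(\mathcal G_L)$ put $$S_{\omega,\gamma,L}(v)=\tfrac12\|v'\|_{L^2}^2+\tfrac\gamma2|v(\mathrm v)|^2+\tfrac\omega2\|v\|_{L^2}^2-\tfrac14\|v\|_{L^4}^4,\qquad I_{\omega,\gamma,L}(v)=\|v'\|_{L^2}^2+\gamma|v(\mathrm v)|^2+\omega\|v\|_{L^2}^2-\|v\|_{L^4}^4 .$$ An *action ground state* is a minimizer of $S_{\omega,\gamma,L}$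 on the Nehari manifold $\{v\in H^1_D(\mathcal G_L): v\not\equiv0,\ I_{\omega,\gamma,L}(v)=0\}$. **Notation for the shapes.** For $k\in[0,1)$ let $K(k)=\int_0^{\pi/2}(1-k^2\sin^2\theta)^{-1/2}d\theta$, and let $\operatorname{cn}(\cdot;k),\operatorname{dn}(\cdot;k)$ be the Jacobi elliptic functions of modulus $k$. Put $$\phi_{\mathrm{dn},k,a}(x)=\sqrt{\tfrac{2\omega}{2-k^2}}\operatorname{dn}\Big(\sqrt{\tfrac{\omega}{2-k^2}}\,x+a;k\Big),\quad \phi_{\mathrm{cn},k}(x)=\sqrt{\tfrac{2\omega k^2}{2k^2-1}}\operatorname{cn}\Big(\sqrt{\tfrac{\omega}{2k^2-1}}\,x;k\Big),\quad \phi_{\mathrm{sech},b}(x)=\sqrt{2\omega}\operatorname{sech}(\sqrt\omega x+b).$$ On the loop, say that $u_c$ is of type **D** if $u_c=\phi_{\mathrm{dn},k,a}$ for some $k\in[0,1)$ and $a\in\{0,K(k)\}$; of type **S** if $u_c=\phi_{\mathrm{sech},0}$; of type **C** if $u_c=\phi_{\mathrm{cn},k}$ for some $k\in(1/\sqrt2,1)$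 with $L<\sqrt{(2k^2-1)/\omega}\,K(k)$. On the half-line, $u_h=\phi_{\mathrm{sech},b}$ is a *tail* if $b>0$, a *half soliton* if $b=0$, a *bump* if $b<0$. Finally let $p=u_c(-L)$, $q=u_c'(-L)$ and $q_\pm(p)=\frac p2\big(\gamma\pm\sqrt{\omega-p^2/2}\big)$. **Theorem.** Let $\omega>0$ and $\gamma>0$. (i) If $\gamma<(1-\sqrt3/2)^{1/3}\sqrt\omega$, then $L^*:=\dfrac{(2-\sqrt3)\,\omega^{3/2}-2\gamma^3}{6\omega^2}>0$, and an action ground state exists for every $0<L<L^*$. (ii) If $\gamma<\sqrt\omega$, then $L^{**}:=\omega^{-1/2}\operatorname{artanh}(\gamma/\sqrt\omega)>0$, and an action ground state exists for every $L\ge L^{**}$. (iii) If $\gamma<\sqrt\omega$ and $L>0$, then every action ground state is of the form $e^{i\theta}u$ with $\theta\in\mathbb R$ constant and $u=(u_c,u_h)\ge0$, where one of the following holds. * $u_c$ is even, and one of the following holds: 1. $0<p<\sqrt{2\omega}$, $q=q_+(p)$, $u_h$ is a tail, and $u_c$ is of type D if $p<\sqrt{2(\omega-\gamma^2)}$, of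 type S if $p=\sqrt{2(\omega-\gamma^2)}$, of type C if $p>\sqrt{2(\omega-\gamma^2)}$; 2. $p=\sqrt{2\omega}$, $q=q_+(p)$, $u_h$ is the half soliton, $u_c$ is of type C; 3. $\sqrt{2(\omega-\gamma^2)}<p<\sqrt{2\omega}$, $q=q_-(p)$, $u_h$ is a bump, and $u_c$ is of type C if $p>\sqrt{2(\omega-\gamma^2/9)}$, of type S if $p=\sqrt{2(\omega-\gamma^2/9)}$, of type D if $p<\sqrt{2(\omega-\gamma^2/9)}$; 4. $p=\sqrt{2(\omega-\gamma^2)}$, $q=0$, $u_h=\phi_{\mathrm{sech},b}$ with $b=-\operatorname{artanh}(\gamma/\sqrt\omega)$, and either $\gamma=\sqrt{\omega/2}$ and $u_c\equiv\sqrt\omega$, or $\gamma\ne\sqrt{\omega/2}$ and $u_c=\phi_{\mathrm{dn},k,a}$ with $k\in(0,1)$, $a\in\{0,K(k)\}$ and $L=n\sqrt{(2-k^2)/\omega}\,K(k)$ for an integer $n\ge1$; 5. $0<p<\sqrt{2(\omega-\gamma^2)}$, $q=q_-(p)$, $u_h$ is a bump, $u_c$ is of type D. * $u_c$ is not even, $p=u_c(L)=u_h(0)=\sqrt{2(\omega-\gamma^2)}$,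 $q\neq0$, $q^2<p^2(\omega-p^2/2)$, $u_h=\phi_{\mathrm{sech},b}$ with $b=-\operatorname{artanh}(\gamma/\sqrt\omega)$, and $u_c=\phi_{\mathrm{dn},k,a}$ with $a\in\mathbb R$, $k\in(0,1)$ and $L=n\sqrt{(2-k^2)/\omega}\,K(k)$ for an integer $n\ge1$. -/

import Mathlib

open Real Set

noncomputable section

namespace Tadpole

/-! ### Functions on the tadpole graph -/

/-- A complex function on the tadpole graph with loop `[-L, L]` and half-line `[0, ∞)`, as the pair
of its restrictions to the two edges.  Only the values of `c` on `[-L, L]` and of `h` on `[0, ∞)`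
are meaningful, and every notion below depends on those values only. -/
structure GraphFun where
  c : ℝ → ℂ
  h : ℝ → ℂ

/-- `f` is (the continuous representative of) an element of the Sobolev space `H¹` of the interior
of the closed interval `I`: `f` is locally absolutely continuous on `I`, and `f` and its almost
everywhere defined derivative are square integrable on `I`. -/
def IsH1On (I : Set ℝ) (f : ℝ → ℂ) : Prop :=
  MeasureTheory.MemLp f 2 (MeasureTheory.volume.restrict I) ∧
  MeasureTheory.MemLp (deriv f) 2 (MeasureTheory.volume.restrict I) ∧
  ∀ x ∈ I, ∀ y ∈ I, f y - f x = ∫ t in x..y, deriv f t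

/-- The form domain `H¹_D`: functions that are `H¹` on both edges and continuous at the vertex. -/
def formDomain (L : ℝ) : Set GraphFun :=
  {v | IsH1On (Icc (-L) L) v.c ∧ IsH1On (Ici 0) v.h ∧ v.c L = v.c (-L) ∧ v.c (-L) = v.h 0}

/-- The squared `L²` norm on the graph. -/
def normL2Sq (L : ℝ) (v : GraphFun) : ℝ :=
  (∫ x in Ioo (-L) L, ‖v.c x‖ ^ 2) + ∫ x in Ioi (0 : ℝ), ‖v.h x‖ ^ 2

/-- The squared `L²` norm of the derivative on the graph. -/
def normDerivL2Sq (L : ℝ) (v : GraphFun) : ℝ :=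
  (∫ x in Ioo (-L) L, ‖deriv v.c x‖ ^ 2) + ∫ x in Ioi (0 : ℝ), ‖deriv v.h x‖ ^ 2

/-- The fourth power of the `L⁴` norm on the graph. -/
def normL4Pow (L : ℝ) (v : GraphFun) : ℝ :=
  (∫ x in Ioo (-L) L, ‖v.c x‖ ^ 4) + ∫ x in Ioi (0 : ℝ), ‖v.h x‖ ^ 4

/-! ### The variational problem -/

/-- The quadratic form of the Laplacian with a δ-condition of strength `γ` at the vertex. -/
def quadForm (γ L : ℝ) (v : GraphFun) : ℝ :=
  normDerivL2Sq L v + γ * ‖v.h 0‖ ^ 2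

/-- The action functional. -/
def action (ω γ L : ℝ) (v : GraphFun) : ℝ :=
  1 / 2 * quadForm γ L v + ω / 2 * normL2Sq L v - 1 / 4 * normL4Pow L v

/-- The Nehari functional. -/
def nehariFunctional (ω γ L : ℝ) (v : GraphFun) : ℝ :=
  quadForm γ L v + ω * normL2Sq L v - normL4Pow L v

/-- The Nehari manifold. -/
def nehariManifold (ω γ L : ℝ) : Set GraphFun :=
  {v | v ∈ formDomain L ∧ ((∃ x ∈ Icc (-L) L, v.c x ≠ 0) ∨ ∃ x ∈ Ici (0 : ℝ), v.h x ≠ 0) ∧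
    nehariFunctional ω γ L v = 0}

/-- An action ground state: a minimizer of the action on the Nehari manifold. -/
def IsActionGroundState (ω γ L : ℝ) (u : GraphFun) : Prop :=
  u ∈ nehariManifold ω γ L ∧ IsMinOn (action ω γ L) (nehariManifold ω γ L) u

/-- The threshold for short loops. -/
def LStar (ω γ : ℝ) : ℝ :=
  ((2 - √3) * ω ^ (3 / 2 : ℝ) - 2 * γ ^ 3) / (6 * ω ^ 2)

/-- The threshold for long loops. -/
def LStarStar (ω γ : ℝ) : ℝ :=
  1 / √ω * artanh (γ / √ω)

/-! ### Jacobi elliptic functions of modulus `k ∈ [0, 1)` -/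

/-- The incomplete elliptic integral of the first kind. -/
def ellipticF (k φ : ℝ) : ℝ :=
  ∫ θ in (0 : ℝ)..φ, 1 / √(1 - k ^ 2 * sin θ ^ 2)

/-- The complete elliptic integral of the first kind. -/
def ellipticK (k : ℝ) : ℝ :=
  ∫ θ in (0 : ℝ)..(π / 2), 1 / √(1 - k ^ 2 * sin θ ^ 2)

/-- The Jacobi amplitude, the inverse function of `ellipticF k`, which is a bijection of `ℝ` for
`0 ≤ k < 1` (see `ellipticF_bijective`). -/
def jacobiAm (k x : ℝ) : ℝ := Function.invFun (ellipticF k) x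

/-- The Jacobi elliptic function `cn`. -/
def jacobiCn (x k : ℝ) : ℝ := cos (jacobiAm k x)

/-- The Jacobi elliptic function `dn`. -/
def jacobiDn (x k : ℝ) : ℝ := √(1 - k ^ 2 * sin (jacobiAm k x) ^ 2)

theorem ellipticF_bijective {k : ℝ} (hk : 0 ≤ k) (hk1 : k < 1) :
    Function.Bijective (ellipticF k) := by
  have hle : ∀ θ : ℝ, k ^ 2 * sin θ ^ 2 < 1 := fun θ => by
    have := sin_sq_le_one θ
    have h2 : k ^ 2 < 1 := by nlinarith
    nlinarith [sq_nonneg k, sq_nonneg (sin θ)]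
  have hcont : Continuous fun θ : ℝ => 1 / √(1 - k ^ 2 * sin θ ^ 2) := by
    refine continuous_const.div (by fun_prop) fun θ => ?_
    exact (sqrt_pos.2 (by linarith [hle θ])).ne'
  have hge : ∀ θ : ℝ, 1 ≤ 1 / √(1 - k ^ 2 * sin θ ^ 2) := fun θ => by
    rw [le_div_iff₀ (sqrt_pos.2 (by linarith [hle θ])), one_mul]
    exact sqrt_le_one.2 (by nlinarith [mul_nonneg (sq_nonneg k) (sq_nonneg (sin θ))])
  have hdiff : ∀ x y : ℝ, x ≤ y → y - x ≤ ellipticF k y - ellipticF k x := fun x y hxy => by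
    have h1 : ellipticF k y - ellipticF k x = ∫ θ in x..y, 1 / √(1 - k ^ 2 * sin θ ^ 2) :=
      intervalIntegral.integral_interval_sub_left (hcont.intervalIntegrable _ _)
        (hcont.intervalIntegrable _ _)
    rw [h1]
    calc y - x = ∫ _θ in x..y, (1 : ℝ) := by simp
      _ ≤ _ := intervalIntegral.integral_mono_on hxy (by simp) (hcont.intervalIntegrable _ _)
        fun θ _ => hge θ
  have hzero : ellipticF k 0 = 0 := by simp [ellipticF]
  have hFc : Continuous (ellipticF k) :=
    intervalIntegral.continuous_primitive (fun a b => hcont.intervalIntegrable a b) 0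
  constructor
  · have : StrictMono (ellipticF k) := fun x y hxy => by linarith [hdiff x y hxy.le]
    exact this.injective
  · refine hFc.surjective ?_ ?_
    · refine Filter.tendsto_atTop_mono' _ ?_ Filter.tendsto_id
      filter_upwards [Filter.eventually_ge_atTop 0] with x hx
      simpa [hzero] using hdiff 0 x hx
    · refine Filter.tendsto_atBot_mono' _ ?_ Filter.tendsto_id
      filter_upwards [Filter.eventually_le_atBot 0] with x hx
      simpa [hzero] using hdiff x 0 hx

/-! ### The profiles -/

/-- The dnoidal profile. -/
def profileDn (ω k a x : ℝ) : ℝ :=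
  √(2 * ω / (2 - k ^ 2)) * jacobiDn (√(ω / (2 - k ^ 2)) * x + a) k

/-- The cnoidal profile. -/
def profileCn (ω k a x : ℝ) : ℝ :=
  √(2 * ω * k ^ 2 / (2 * k ^ 2 - 1)) * jacobiCn (√(ω / (2 * k ^ 2 - 1)) * x + a) k

/-- The hyperbolic secant profile. -/
def profileSech (ω b x : ℝ) : ℝ :=
  √(2 * ω) * (1 / cosh (√ω * x + b))

/-- Tail-type functions on the half-line. -/
def IsTail (ω : ℝ) (ψ : ℝ → ℝ) : Prop :=
  ∃ b : ℝ, 0 < b ∧ EqOn ψ (profileSech ω b) (Ici 0)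

/-- The half soliton on the half-line. -/
def IsHalfSoliton (ω : ℝ) (ψ : ℝ → ℝ) : Prop :=
  EqOn ψ (profileSech ω 0) (Ici 0)

/-- Bump-type functions on the half-line. -/
def IsBump (ω : ℝ) (ψ : ℝ → ℝ) : Prop :=
  ∃ b : ℝ, b < 0 ∧ EqOn ψ (profileSech ω b) (Ici 0)

/-- On the loop, `φ` is dnoidal with translation parameter `0` or half a period. -/
def IsEvenDnoidal (ω L : ℝ) (φ : ℝ → ℝ) : Prop :=
  ∃ k a : ℝ, 0 ≤ k ∧ k < 1 ∧ (a = 0 ∨ a = ellipticK k) ∧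
    EqOn φ (profileDn ω k a) (Icc (-L) L)

/-- On the loop, `φ` is a centered hyperbolic secant. -/
def IsCenteredSech (ω L : ℝ) (φ : ℝ → ℝ) : Prop :=
  EqOn φ (profileSech ω 0) (Icc (-L) L)

/-- On the loop, `φ` is cnoidal with translation parameter `0`, and the loop is shorter than the
distance between the two zeros of the profile that surround the origin. -/
def IsCenteredCnoidal (ω L : ℝ) (φ : ℝ → ℝ) : Prop :=
  ∃ k : ℝ, 1 / √2 < k ∧ k < 1 ∧ L < √((2 * k ^ 2 - 1) / ω) * ellipticK k ∧
    EqOn φ (profileCn ω k 0) (Icc (-L) L)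

/-! ### The phase plane -/

/-- The integral of motion of `-φ'' + ω φ - φ³ = 0`. -/
def motionIntegral (ω p q : ℝ) : ℝ := q ^ 2 - p ^ 2 * (ω - p ^ 2 / 2)

def qPlus (ω γ p : ℝ) : ℝ := p / 2 * (γ + √(ω - p ^ 2 / 2))

def qMinus (ω γ p : ℝ) : ℝ := p / 2 * (γ - √(ω - p ^ 2 / 2))

def Gamma1 (ω γ : ℝ) : Set (ℝ × ℝ) :=
  (fun p => (p, qPlus ω γ p)) '' Ioc 0 √(2 * ω)

def Gamma2 (ω γ : ℝ) : Set (ℝ × ℝ) :=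
  (fun p => (p, qMinus ω γ p)) '' Icc √(2 * (ω - γ ^ 2)) √(2 * ω)

def Gamma3 (ω γ : ℝ) : Set (ℝ × ℝ) :=
  (fun p => (p, qMinus ω γ p)) '' Ioc 0 √(2 * (ω - γ ^ 2))

def Gamma4 (ω γ : ℝ) : Set (ℝ × ℝ) :=
  {z | z.1 = √(2 * (ω - γ ^ 2)) ∧ z.2 ≠ 0 ∧ motionIntegral ω z.1 z.2 < 0}

/-- The value and the (one-sided) derivative at the end `-L` of the loop. -/
def vertexData (L : ℝ) (φ : ℝ → ℝ) : ℝ × ℝ :=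
  (φ (-L), derivWithin φ (Icc (-L) L) (-L))

/-! ### The list of shapes

Here `φ` is the restriction to the loop and `ψ` the restriction to the half-line. -/

/-- First family: a tail on the half-line. -/
def ShapeTail (ω γ L : ℝ) (φ ψ : ℝ → ℝ) : Prop :=
  vertexData L φ ∈ Gamma1 ω γ ∧ φ (-L) < √(2 * ω) ∧ IsTail ω ψ ∧
    ((φ (-L) < √(2 * (ω - γ ^ 2)) ∧ IsEvenDnoidal ω L φ) ∨
     (φ (-L) = √(2 * (ω - γ ^ 2)) ∧ IsCenteredSech ω L φ) ∨
     (√(2 * (ω - γ ^ 2)) < φ (-L) ∧ IsCenteredCnoidal ω L φ))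

/-- Second family: a half soliton on the half-line. -/
def ShapeHalfSoliton (ω γ L : ℝ) (φ ψ : ℝ → ℝ) : Prop :=
  vertexData L φ = (√(2 * ω), qPlus ω γ √(2 * ω)) ∧ IsHalfSoliton ω ψ ∧ IsCenteredCnoidal ω L φ

/-- Third family: a bump on the half-line, with `φ` increasing at the vertex. -/
def ShapeBump (ω γ L : ℝ) (φ ψ : ℝ → ℝ) : Prop :=
  vertexData L φ ∈ Gamma2 ω γ ∧ φ (-L) < √(2 * ω) ∧ IsBump ω ψ ∧
    ((√(2 * (ω - γ ^ 2 / 9)) < φ (-L) ∧ IsCenteredCnoidal ω L φ) ∨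
     (φ (-L) = √(2 * (ω - γ ^ 2 / 9)) ∧ IsCenteredSech ω L φ) ∨
     (√(2 * (ω - γ ^ 2)) < φ (-L) ∧ φ (-L) < √(2 * (ω - γ ^ 2 / 9)) ∧ IsEvenDnoidal ω L φ))

/-- Fourth family: a bump on the half-line, with `φ` stationary at the vertex.  Either `φ` is
constant, which happens for `γ = √(ω / 2)`, or the length of the loop is an integer number of
periods of the dnoidal profile. -/
def ShapeStationary (ω γ L : ℝ) (φ ψ : ℝ → ℝ) : Prop :=
  vertexData L φ = (√(2 * (ω - γ ^ 2)), 0) ∧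
    EqOn ψ (profileSech ω (-artanh (γ / √ω))) (Ici 0) ∧
    ((γ = √(ω / 2) ∧ ∀ x ∈ Icc (-L) L, φ x = √ω) ∨
     (γ ≠ √(ω / 2) ∧ ∃ (k a : ℝ) (n : ℕ), 0 < k ∧ k < 1 ∧ (a = 0 ∨ a = ellipticK k) ∧ 1 ≤ n ∧
        L = n * √((2 - k ^ 2) / ω) * ellipticK k ∧ EqOn φ (profileDn ω k a) (Icc (-L) L)))

/-- Fifth family: a bump on the half-line, with `φ` decreasing at the vertex. -/
def ShapeDecreasing (ω γ L : ℝ) (φ ψ : ℝ → ℝ) : Prop :=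
  vertexData L φ ∈ Gamma3 ω γ ∧ φ (-L) < √(2 * (ω - γ ^ 2)) ∧ IsBump ω ψ ∧ IsEvenDnoidal ω L φ

/-- The possible shapes when `φ` is even. -/
def EvenShape (ω γ L : ℝ) (φ ψ : ℝ → ℝ) : Prop :=
  (∀ x ∈ Icc (-L) L, φ (-x) = φ x) ∧
    (ShapeTail ω γ L φ ψ ∨ ShapeHalfSoliton ω γ L φ ψ ∨ ShapeBump ω γ L φ ψ ∨
      ShapeStationary ω γ L φ ψ ∨ ShapeDecreasing ω γ L φ ψ)

/-- The possible shape when `φ` is not even. -/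
def NonEvenShape (ω γ L : ℝ) (φ ψ : ℝ → ℝ) : Prop :=
  (¬ ∀ x ∈ Icc (-L) L, φ (-x) = φ x) ∧
    vertexData L φ ∈ Gamma4 ω γ ∧
    φ (-L) = φ L ∧ φ L = ψ 0 ∧
    EqOn ψ (profileSech ω (-artanh (γ / √ω))) (Ici 0) ∧
    ∃ (k a : ℝ) (n : ℕ), 0 < k ∧ k < 1 ∧ 1 ≤ n ∧
      L = n * √((2 - k ^ 2) / ω) * ellipticK k ∧ EqOn φ (profileDn ω k a) (Icc (-L) L)

/-- Up to a constant phase factor, `u` is a non-negative function `(φ, ψ)` with one of the listed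
shapes. -/
def HasListedShape (ω γ L : ℝ) (u : GraphFun) : Prop :=
  ∃ (θ : ℝ) (φ ψ : ℝ → ℝ),
    (∀ x ∈ Icc (-L) L, 0 ≤ φ x ∧ u.c x = Complex.exp (θ * Complex.I) * φ x) ∧
    (∀ x ∈ Ici (0 : ℝ), 0 ≤ ψ x ∧ u.h x = Complex.exp (θ * Complex.I) * ψ x) ∧
    (EvenShape ω γ L φ ψ ∨ NonEvenShape ω γ L φ ψ)

end Tadpole

end

noncomputable section
namespace Tadpole
open MeasureTheory Filter Topology

/-! ### Calculus of one-dimensional `H¹` functions -/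

/-! On the Nehari manifold the action is a quarter of the quartic part `fullN`, so a ground state
minimises `fullN` there. Equivalently, it minimises the scale-invariant quotient `fullQ ^ 2 / fullN`
over all nonzero functions.

Existence can fail only if mass escapes along the half-line, and escaping mass costs at least the
quartic energy `16 / 3 * (ω * √ω)` of the soliton on the line. The sharp constant comes from a
calibration: with `μ` the maximum of `‖f‖`, the integrand `‖f'‖² + ω‖f‖² - ω‖f‖⁴ / μ²` dominates the
derivative of a function of `‖f‖` alone (`IsH1On.calibration_sub_le`). This gives the
Gagliardo–Nirenberg inequality with a boundary term (`IsH1On.gagliardo_nirenberg`). Applied beyond a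
cut-off `R`, the inequality shows that a weak limit of a minimising sequence is nonzero and
satisfies `fullQ ≤ fullN`; rescaling it yields a minimiser (`exists_isActionGroundState`). It
remains to exhibit a function with `fullQ ≤ fullN` below the soliton level. For long loops this is
the soliton centred on the loop and continued by a tail. For short loops it is the constant `√ω` on
the loop, continued by a bump.

For the shapes, varying the quotient in all directions gives the stationary equation on each edge
and the δ-condition at the vertex (`IsNormalizedMinimizer.euler_lagrange`). The modulus of a
minimiser is again a minimiser, with the same Dirichlet energy on each edge. Hence a ground state is
a constant phase times a positive solution (`IsActionGroundState.exists_positive`). The energy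
`motionIntegral` is conserved on each edge. On the half-line it vanishes by decay, which leaves a
translated sech. On the loop the two end slopes agree up to sign. If they are opposite, the profile
is even, and the sign of its energy decides between cn, sech and dn (`SolvesNLS.evenShape`). If they
are equal and nonzero, the profile closes up periodically and must be dnoidal
(`SolvesNLS.nonEvenShape`). -/

theorem IsH1On.mono {I J : Set ℝ} {f : ℝ → ℂ} (hf : IsH1On I f) (h : J ⊆ I) : IsH1On J f :=
  ⟨hf.1.mono_measure (Measure.restrict_mono h le_rfl),
    hf.2.1.mono_measure (Measure.restrict_mono h le_rfl),
    fun x hx y hy => hf.2.2 x (h hx) y (h hy)⟩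

theorem intervalIntegrable_of_memLp_two {I : Set ℝ} (hI : I.OrdConnected) {E : Type*}
    [NormedAddCommGroup E] {g : ℝ → E} (hg : MemLp g 2 (volume.restrict I)) {x y : ℝ} (hx : x ∈ I)
    (hy : y ∈ I) : IntervalIntegrable g volume x y := by
  rw [intervalIntegrable_iff]
  have : IsFiniteMeasure (volume.restrict (uIoc x y)) := ⟨by simp [uIoc]⟩
  have h1 : MemLp g 2 (volume.restrict (uIoc x y)) :=
    hg.mono_measure (Measure.restrict_mono (uIoc_subset_uIcc.trans (hI.uIcc_subset hx hy)) le_rfl)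
  exact h1.integrable (by norm_num)

theorem integrableOn_sq_norm {I : Set ℝ} {g : ℝ → ℂ} (hg : MemLp g 2 (volume.restrict I)) :
    IntegrableOn (fun x => ‖g x‖ ^ 2) I :=
  (memLp_two_iff_integrable_sq_norm hg.1).1 hg

/-- The Cauchy–Schwarz inequality, read off from the nonnegative integral of the squared deviation
of `‖g‖` from its mean `A / (y - x)`. -/
theorem sq_integral_norm_le {g : ℝ → ℂ} {x y : ℝ} (hxy : x ≤ y)
    (hg : MemLp g 2 (volume.restrict (Icc x y))) :
    (∫ t in x..y, ‖g t‖) ^ 2 ≤ (y - x) * ∫ t in Icc x y, ‖g t‖ ^ 2 := by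
  have h2 : IntegrableOn (fun x => ‖g x‖ ^ 2) (Icc x y) := integrableOn_sq_norm hg
  have h1 : IntegrableOn (fun x => ‖g x‖) (Icc x y) := (hg.integrable (by norm_num)).norm
  set A := ∫ t in x..y, ‖g t‖ with hA
  rcases hxy.eq_or_lt with rfl | hlt
  · simp [hA]
  have hAI : A = ∫ t in Icc x y, ‖g t‖ := by
    rw [hA, intervalIntegral.integral_of_le hxy, integral_Icc_eq_integral_Ioc]
  have hd : 0 < y - x := sub_pos.2 hlt
  have h0 : 0 ≤ ∫ t in Icc x y, (‖g t‖ - A / (y - x)) ^ 2 := integral_nonneg fun _ => sq_nonneg _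
  have h3 : ∫ t in Icc x y, (‖g t‖ - A / (y - x)) ^ 2 =
      (∫ t in Icc x y, ‖g t‖ ^ 2) - 2 * (A / (y - x)) * A + (y - x) * (A / (y - x)) ^ 2 := by
    have hc : IntegrableOn (fun _ : ℝ => (A / (y - x)) ^ 2) (Icc x y) :=
      integrableOn_const (by simp)
    calc _ = ∫ t in Icc x y, ((‖g t‖ ^ 2 - 2 * (A / (y - x)) * ‖g t‖) + (A / (y - x)) ^ 2) := by
          congr 1; ext t; ring
      _ = _ := by
          have e1 := integral_add (h2.sub (h1.const_mul (2 * (A / (y - x))))) hc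
          have e2 := integral_sub h2 (h1.const_mul (2 * (A / (y - x))))
          simp only [Pi.sub_apply] at e1
          rw [e1, e2, integral_const_mul, ← hAI]
          simp [hlt.le]
  rw [h3] at h0
  field_simp at h0
  nlinarith

theorem IsH1On.norm_sub_sq_le {I : Set ℝ} (hI : I.OrdConnected) {f : ℝ → ℂ} (hf : IsH1On I f)
    {x y : ℝ} (hx : x ∈ I) (hy : y ∈ I) :
    ‖f y - f x‖ ^ 2 ≤ |y - x| * ∫ t in I, ‖deriv f t‖ ^ 2 := by
  wlog hxy : x ≤ y generalizing x y
  · have := this hy hx (le_of_not_ge hxy)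
    rwa [norm_sub_rev, abs_sub_comm]
  have hsub : Icc x y ⊆ I := hI.out hx hy
  have h2 := sq_integral_norm_le hxy (hf.mono hsub).2.1
  rw [hf.2.2 x hx y hy, abs_of_nonneg (sub_nonneg.2 hxy)]
  calc _ ≤ (∫ t in x..y, ‖deriv f t‖) ^ 2 :=
        pow_le_pow_left₀ (norm_nonneg _) (intervalIntegral.norm_integral_le_integral_norm hxy) 2
    _ ≤ _ := h2.trans (mul_le_mul_of_nonneg_left
        (setIntegral_mono_set (integrableOn_sq_norm hf.2.1)
          (Eventually.of_forall fun _ => sq_nonneg _) hsub.eventuallyLE) (sub_nonneg.2 hxy))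

theorem IsH1On.continuousOn {I : Set ℝ} (hI : I.OrdConnected) {f : ℝ → ℂ} (hf : IsH1On I f) :
    ContinuousOn f I := by
  intro x hx
  rw [ContinuousWithinAt, tendsto_iff_norm_sub_tendsto_zero]
  set D := ∫ t in I, ‖deriv f t‖ ^ 2
  have h1 : Tendsto (fun y => √(|y - x| * D)) (𝓝[I] x) (𝓝 0) := by
    have : Continuous fun y => √(|y - x| * D) := by fun_prop
    simpa using (this.tendsto x).mono_left nhdsWithin_le_nhds
  refine squeeze_zero' (Eventually.of_forall fun _ => norm_nonneg _) ?_ h1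
  filter_upwards [self_mem_nhdsWithin] with y hy
  exact Real.le_sqrt_of_sq_le (hf.norm_sub_sq_le hI hx hy)

/-- An absolutely continuous function is differentiable almost everywhere, with the expected
derivative. -/
theorem ae_hasDerivAt_of_integral {I : Set ℝ} (hI : I.OrdConnected) {f g : ℝ → ℂ}
    (hg : MemLp g 2 (volume.restrict I))
    (hfg : ∀ x ∈ I, ∀ y ∈ I, f y - f x = ∫ t in x..y, g t) :
    ∀ᵐ x ∂volume.restrict I, HasDerivAt f (g x) x := by
  have hIm : MeasurableSet I := hI.measurableSet
  rw [ae_restrict_iff' hIm]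
  -- Rational end points leave only countably many null sets to discard, and every interior point of
  -- `I` lies between two rationals of `I`.
  have key : ∀ r s : ℚ, (r : ℝ) ∈ I → (s : ℝ) ∈ I → ∀ᵐ x : ℝ, x ∈ Ioo (r : ℝ) s →
      HasDerivAt f (g x) x := by
    intro r s hr hs
    have h1 := (intervalIntegrable_of_memLp_two hI hg hr hs).ae_hasDerivAt_integral
    filter_upwards [h1] with x hx hxrs
    have hx' := hx (Icc_subset_uIcc (Ioo_subset_Icc_self hxrs)) r left_mem_uIcc
    have : HasDerivAt (fun y => f r + ∫ t in (r : ℝ)..y, g t) (g x) x := hx'.const_add _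
    refine this.congr_of_eventuallyEq ?_
    filter_upwards [isOpen_Ioo.mem_nhds hxrs] with y hy
    rw [← hfg r hr y (hI.out hr hs (Ioo_subset_Icc_self hy))]
    ring
  have key2 : ∀ᵐ x : ℝ, ∀ r s : ℚ, (r : ℝ) ∈ I → (s : ℝ) ∈ I → x ∈ Ioo (r : ℝ) s →
      HasDerivAt f (g x) x := by
    rw [ae_all_iff]; intro r; rw [ae_all_iff]; intro s
    by_cases hr : (r : ℝ) ∈ I
    · by_cases hs : (s : ℝ) ∈ I
      · filter_upwards [key r s hr hs] with x hx _ _ h using hx h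
      · simp [hs]
    · simp [hr]
  -- An order-connected set of reals is convex, so its frontier is null.
  have hint : ∀ᵐ x : ℝ, x ∈ I → x ∈ interior I := by
    have h0 : volume (I \ interior I) = 0 :=
      measure_mono_null (t := frontier I) (fun x hx => ⟨subset_closure hx.1, hx.2⟩)
        (hI.convex.addHaar_frontier volume)
    have : ∀ᵐ x : ℝ, x ∉ I \ interior I := measure_eq_zero_iff_ae_notMem.1 h0
    filter_upwards [this] with x hx hxI
    by_contra h
    exact hx ⟨hxI, h⟩
  filter_upwards [key2, hint] with x hx hxi hxI
  obtain ⟨ε, hε, hball⟩ := Metric.mem_nhds_iff.1 (mem_interior_iff_mem_nhds.1 (hxi hxI))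
  rw [Real.ball_eq_Ioo] at hball
  obtain ⟨r, hr1, hr2⟩ := exists_rat_btwn (show x - ε < x by linarith)
  obtain ⟨s, hs1, hs2⟩ := exists_rat_btwn (show x < x + ε by linarith)
  exact hx r s (hball ⟨hr1, by linarith⟩) (hball ⟨by linarith, hs2⟩) ⟨hr2, hs1⟩

/-- `IsH1On` speaks of `deriv f` itself, so a weak derivative `g` must first be identified with
`deriv f` almost everywhere. Sums, multiples, ramps and weak limits all pass through here. -/
theorem IsH1On.of_integral {I : Set ℝ} (hI : I.OrdConnected) {f g : ℝ → ℂ}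
    (hf : MemLp f 2 (volume.restrict I)) (hg : MemLp g 2 (volume.restrict I))
    (hfg : ∀ x ∈ I, ∀ y ∈ I, f y - f x = ∫ t in x..y, g t) :
    IsH1On I f ∧ deriv f =ᵐ[volume.restrict I] g := by
  have h1 : deriv f =ᵐ[volume.restrict I] g := by
    filter_upwards [ae_hasDerivAt_of_integral hI hg hfg] with x hx using hx.deriv
  refine ⟨⟨hf, hg.ae_eq h1.symm, fun x hx y hy => ?_⟩, h1⟩
  rw [hfg x hx y hy]
  refine intervalIntegral.integral_congr_ae_restrict ?_
  exact ae_restrict_of_ae_restrict_of_subset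
    (uIoc_subset_uIcc.trans (hI.uIcc_subset hx hy)) h1.symm

theorem IsH1On.ae_hasDerivAt {I : Set ℝ} (hI : I.OrdConnected) {f : ℝ → ℂ} (hf : IsH1On I f) :
    ∀ᵐ x ∂volume.restrict I, HasDerivAt f (deriv f x) x :=
  ae_hasDerivAt_of_integral hI hf.2.1 hf.2.2

theorem IsH1On.add {I : Set ℝ} (hI : I.OrdConnected) {f g : ℝ → ℂ} (hf : IsH1On I f)
    (hg : IsH1On I g) : IsH1On I (fun x => f x + g x) ∧
      deriv (fun x => f x + g x) =ᵐ[volume.restrict I] fun x => deriv f x + deriv g x := by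
  refine IsH1On.of_integral hI (hf.1.add hg.1) (hf.2.1.add hg.2.1) fun x hx y hy => ?_
  rw [intervalIntegral.integral_add (intervalIntegrable_of_memLp_two hI hf.2.1 hx hy)
    (intervalIntegrable_of_memLp_two hI hg.2.1 hx hy), ← hf.2.2 x hx y hy, ← hg.2.2 x hx y hy]
  ring

theorem IsH1On.const_mul {I : Set ℝ} (hI : I.OrdConnected) {f : ℝ → ℂ} (hf : IsH1On I f) (c : ℂ) :
    IsH1On I (fun x => c * f x) ∧
      deriv (fun x => c * f x) =ᵐ[volume.restrict I] fun x => c * deriv f x := by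
  refine IsH1On.of_integral hI (hf.1.const_mul c) (hf.2.1.const_mul c) fun x hx y hy => ?_
  rw [intervalIntegral.integral_const_mul, ← hf.2.2 x hx y hy]
  ring

/-- A continuous function that is differentiable off a countable set is `H¹` as soon as it and its
derivative are square integrable. -/
theorem IsH1On.of_hasDerivAt {I : Set ℝ} (hI : I.OrdConnected) {f g : ℝ → ℂ} {s : Set ℝ}
    (hs : s.Countable) (hc : ContinuousOn f I) (hd : ∀ x ∈ interior I \ s, HasDerivAt f (g x) x)
    (hf : MemLp f 2 (volume.restrict I)) (hg : MemLp g 2 (volume.restrict I)) :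
    IsH1On I f ∧ deriv f =ᵐ[volume.restrict I] g := by
  have key : ∀ x ∈ I, ∀ y ∈ I, x ≤ y → f y - f x = ∫ t in x..y, g t := fun x hx y hy hxy => by
    refine (integral_eq_of_hasDerivAt_off_countable_of_le f g hxy hs
      (hc.mono (hI.out hx hy)) (fun t ht => hd t ⟨?_, ht.2⟩)
      (intervalIntegrable_of_memLp_two hI hg hx hy)).symm
    exact interior_mono (hI.out hx hy) (by rw [interior_Icc]; exact ht.1)
  refine IsH1On.of_integral hI hf hg fun x hx y hy => ?_
  rcases le_total x y with h | h
  · exact key x hx y hy h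
  · rw [intervalIntegral.integral_symm, ← key y hy x hx h, neg_sub]

theorem absolutelyContinuous_comp {X Y : Type*} [PseudoMetricSpace X] [PseudoMetricSpace Y]
    {f : ℝ → X} {a b : ℝ} (hf : AbsolutelyContinuousOnInterval f a b) {Φ : X → Y} {K : NNReal}
    {s : Set X} (hΦ : LipschitzOnWith K Φ s) (hfs : ∀ x ∈ uIcc a b, f x ∈ s) :
    AbsolutelyContinuousOnInterval (fun x => Φ (f x)) a b := by
  rw [absolutelyContinuousOnInterval_iff] at hf ⊢
  intro ε hε
  -- The extra 1 keeps the divisor positive when `K = 0`.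
  obtain ⟨δ, hδ, h⟩ := hf (ε / (K + 1)) (by positivity)
  refine ⟨δ, hδ, fun E hE hlt => ?_⟩
  have h1 := h E hE hlt
  calc ∑ i ∈ Finset.range E.1, dist (Φ (f (E.2 i).1)) (Φ (f (E.2 i).2))
      ≤ ∑ i ∈ Finset.range E.1, (K + 1) * dist (f (E.2 i).1) (f (E.2 i).2) := by
        refine Finset.sum_le_sum fun i hi => ?_
        have hm := hE.1 i hi
        refine (hΦ.dist_le_mul _ (hfs _ hm.1) _ (hfs _ hm.2)).trans ?_
        exact mul_le_mul_of_nonneg_right (by simp) dist_nonneg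
    _ = (K + 1) * ∑ i ∈ Finset.range E.1, dist (f (E.2 i).1) (f (E.2 i).2) := by
        rw [Finset.mul_sum]
    _ < (K + 1) * (ε / (K + 1)) := by gcongr
    _ = ε := by field_simp

/-- The increments of `f` are dominated by those of the primitive of `‖deriv f‖`, which is
absolutely continuous. -/
theorem IsH1On.absolutelyContinuous {I : Set ℝ} (hI : I.OrdConnected) {f : ℝ → ℂ}
    (hf : IsH1On I f) {a b : ℝ} (ha : a ∈ I) (hb : b ∈ I) :
    AbsolutelyContinuousOnInterval f a b := by
  have hint : IntervalIntegrable (deriv f) volume a b :=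
    intervalIntegrable_of_memLp_two hI hf.2.1 ha hb
  have h1 : AbsolutelyContinuousOnInterval (fun x => ∫ t in a..x, ‖deriv f t‖) a b :=
    hint.norm.absolutelyContinuousOnInterval_intervalIntegral left_mem_uIcc
  rw [absolutelyContinuousOnInterval_iff] at h1 ⊢
  intro ε hε
  obtain ⟨δ, hδ, h⟩ := h1 ε hε
  refine ⟨δ, hδ, fun E hE hlt => lt_of_le_of_lt (Finset.sum_le_sum fun i hi => ?_) (h E hE hlt)⟩
  have hm := hE.1 i hi
  set x := (E.2 i).1
  set y := (E.2 i).2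
  have hx : x ∈ I := hI.uIcc_subset ha hb hm.1
  have hy : y ∈ I := hI.uIcc_subset ha hb hm.2
  have hn : ∀ z ∈ I, IntervalIntegrable (fun t => ‖deriv f t‖) volume a z := fun z hz =>
    (intervalIntegrable_of_memLp_two hI hf.2.1 ha hz).norm
  rw [dist_eq_norm, dist_eq_norm, intervalIntegral.integral_interval_sub_left (hn x hx) (hn y hy),
    hf.2.2 y hy x hx]
  exact intervalIntegral.norm_integral_le_abs_integral_norm

/-- The reverse triangle inequality for difference quotients. Differentiability of `‖f‖` is not
needed, since `deriv` is 0 where it fails. -/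
theorem norm_deriv_norm_le (f : ℝ → ℂ) {x : ℝ} {f' : ℂ} (hf : HasDerivAt f f' x) :
    |deriv (fun t => ‖f t‖) x| ≤ ‖f'‖ := by
  by_cases h : DifferentiableAt ℝ (fun t => ‖f t‖) x
  · have h1 := (hasDerivAt_iff_tendsto_slope.1 h.hasDerivAt).abs
    have h2 := (hasDerivAt_iff_tendsto_slope.1 hf).norm
    refine le_of_tendsto_of_tendsto' h1 h2 fun t => ?_
    simp only [slope, vsub_eq_sub, smul_eq_mul, abs_mul, norm_smul, Real.norm_eq_abs]
    exact mul_le_mul_of_nonneg_left (abs_norm_sub_norm_le _ _) (abs_nonneg _)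
  · simp [deriv_zero_of_not_differentiableAt h]

theorem IsH1On.absolutelyContinuous_norm {I : Set ℝ} (hI : I.OrdConnected) {f : ℝ → ℂ}
    (hf : IsH1On I f) {a b : ℝ} (ha : a ∈ I) (hb : b ∈ I) :
    AbsolutelyContinuousOnInterval (fun x => ‖f x‖) a b :=
  absolutelyContinuous_comp (hf.absolutelyContinuous hI ha hb)
    (lipschitzWith_one_norm.lipschitzOnWith (s := univ)) fun _ _ => mem_univ _

/-- Valid at every point: `g` and its complexification are differentiable at the same points, and
elsewhere both derivatives are 0 by convention. -/
theorem deriv_ofReal_comp (g : ℝ → ℝ) (x : ℝ) :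
    deriv (fun t => (g t : ℂ)) x = ((deriv g x : ℝ) : ℂ) := by
  by_cases h : DifferentiableAt ℝ g x
  · exact h.hasDerivAt.ofReal_comp.deriv
  · rw [deriv_zero_of_not_differentiableAt h, Complex.ofReal_zero]
    refine deriv_zero_of_not_differentiableAt fun h' => h ?_
    have := Complex.reCLM.differentiableAt.comp x h'
    simpa [Function.comp_def] using this

theorem IsH1On.norm {I : Set ℝ} (hI : I.OrdConnected) {f : ℝ → ℂ} (hf : IsH1On I f) :
    IsH1On I (fun x => (‖f x‖ : ℂ)) ∧
      ∀ᵐ x ∂volume.restrict I, ‖deriv (fun x => (‖f x‖ : ℂ)) x‖ ≤ ‖deriv f x‖ := by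
  have hle : ∀ᵐ x ∂volume.restrict I, ‖deriv (fun x => (‖f x‖ : ℂ)) x‖ ≤ ‖deriv f x‖ := by
    filter_upwards [hf.ae_hasDerivAt hI] with x hx
    rw [deriv_ofReal_comp (fun t => ‖f t‖), Complex.norm_real]
    exact norm_deriv_norm_le f hx
  have hfun : deriv (fun x => (‖f x‖ : ℂ)) = fun x => ((deriv (fun t => ‖f t‖) x : ℝ) : ℂ) :=
    funext fun x => deriv_ofReal_comp (fun t => ‖f t‖) x
  refine ⟨⟨?_, ?_, fun x hx y hy => ?_⟩, hle⟩
  · refine MemLp.of_le hf.1 (Complex.continuous_ofReal.comp_aestronglyMeasurable hf.1.1.norm)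
      (Eventually.of_forall fun x => by simp)
  · refine MemLp.of_le hf.2.1 ?_ hle
    rw [hfun]
    exact (Complex.measurable_ofReal.comp (measurable_deriv _)).aestronglyMeasurable
  · have := (hf.absolutelyContinuous_norm hI hx hy).integral_deriv_eq_sub
    rw [hfun, intervalIntegral.integral_ofReal, this]
    push_cast; ring

/-! ### Decay on the half-line -/

/-- A value of size `ε` far out would, by Hölder continuity of exponent 1/2, keep `‖f‖ ≥ ε / 2` on
an interval of length `δ` independent of the point, and the tail of the mass could not tend to 0. -/
theorem IsH1On.tendsto_zero {a : ℝ} {f : ℝ → ℂ} (hf : IsH1On (Ici a) f) :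
    Tendsto f atTop (𝓝 0) := by
  rw [Metric.tendsto_atTop]
  intro ε hε
  set D := ∫ t in Ici a, ‖deriv f t‖ ^ 2
  have hD : 0 ≤ D := integral_nonneg fun _ => sq_nonneg _
  -- Chosen so that the oscillation over length `δ` is at most `ε / 2`; the added 1 covers `D = 0`.
  set δ := (ε / 2) ^ 2 / (D + 1)
  have hδ : 0 < δ := by positivity
  have hδD : δ * D ≤ (ε / 2) ^ 2 := by
    simp only [δ]; rw [div_mul_eq_mul_div, div_le_iff₀ (by positivity)]
    nlinarith [sq_nonneg (ε / 2)]
  have hsq := integrableOn_sq_norm hf.1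
  have htail := tendsto_setIntegral_of_antitone (μ := volume) (f := fun x => ‖f x‖ ^ 2)
    (s := fun R : ℝ => Ici R) (fun _ => measurableSet_Ici)
    (fun r s h => Ici_subset_Ici.2 h) ⟨a, hsq⟩
  have hempty : ⋂ n : ℝ, Ici n = ∅ := by
    ext x; simp only [mem_iInter, mem_Ici, mem_empty_iff_false, iff_false, not_forall, not_le]
    exact ⟨x + 1, by linarith⟩
  rw [hempty, Measure.restrict_empty, integral_zero_measure] at htail
  have hev := (htail.eventually_lt_const (show 0 < δ * (ε / 2) ^ 2 by positivity)).and
    (eventually_ge_atTop a)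
  obtain ⟨X, hX⟩ := eventually_atTop.1 hev
  refine ⟨X, fun x hx => ?_⟩
  obtain ⟨h1, h2⟩ := hX x hx
  rw [dist_zero_right]
  by_contra! hcon
  have hsub : Icc x (x + δ) ⊆ Ici a := fun t ht => h2.trans ht.1
  have h3 : ∀ t ∈ Icc x (x + δ), (ε / 2) ^ 2 ≤ ‖f t‖ ^ 2 := fun t ht => by
    have := hf.norm_sub_sq_le ordConnected_Ici (show x ∈ Ici a from h2) (hsub ht)
    rw [abs_of_nonneg (sub_nonneg.2 ht.1)] at this
    have h5 : ‖f t - f x‖ ^ 2 ≤ (ε / 2) ^ 2 :=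
      this.trans ((mul_le_mul_of_nonneg_right (by linarith [ht.2]) hD).trans hδD)
    have h6 := (pow_le_pow_iff_left₀ (norm_nonneg _) (by positivity) two_ne_zero).1 h5
    have h7 : ‖f x‖ - ‖f t‖ ≤ ‖f t - f x‖ := by
      rw [norm_sub_rev]; exact norm_sub_norm_le _ _
    exact pow_le_pow_left₀ (by positivity) (by linarith) 2
  have h4 : δ * (ε / 2) ^ 2 ≤ ∫ t in Icc x (x + δ), ‖f t‖ ^ 2 := by
    calc δ * (ε / 2) ^ 2 = ∫ t in Icc x (x + δ), (ε / 2) ^ 2 := by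
          simp [hδ.le]
      _ ≤ _ := setIntegral_mono_on (integrableOn_const (by simp)) (hsq.mono_set hsub)
          measurableSet_Icc h3
  have h5 : ∫ t in Icc x (x + δ), ‖f t‖ ^ 2 ≤ ∫ t in Ici x, ‖f t‖ ^ 2 :=
    setIntegral_mono_set (hsq.mono_set (Ici_subset_Ici.2 h2))
      (Eventually.of_forall fun _ => sq_nonneg _) (Icc_subset_Ici_self).eventuallyLE
  linarith

theorem IsH1On.exists_isMaxOn_norm {a : ℝ} {f : ℝ → ℂ} (hf : IsH1On (Ici a) f) :
    ∃ x ∈ Ici a, ∀ y ∈ Ici a, ‖f y‖ ≤ ‖f x‖ := by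
  have hc := (hf.continuousOn ordConnected_Ici).norm
  by_cases h0 : ∀ y ∈ Ici a, ‖f y‖ = 0
  · exact ⟨a, self_mem_Ici, fun y hy => by rw [h0 y hy]; exact norm_nonneg _⟩
  push Not at h0
  obtain ⟨y0, hy0, hne⟩ := h0
  have hpos : 0 < ‖f y0‖ := lt_of_le_of_ne (norm_nonneg _) (Ne.symm hne)
  obtain ⟨X, hX⟩ := eventually_atTop.1 ((hf.tendsto_zero.norm).eventually_lt_const
    (show ‖(0 : ℂ)‖ < ‖f y0‖ by simpa using hpos))
  obtain ⟨x, hx, hmax⟩ := isCompact_Icc.exists_isMaxOn (s := Icc a (max X y0))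
    ⟨y0, hy0, le_max_right _ _⟩ (hc.mono Icc_subset_Ici_self)
  refine ⟨x, hx.1, fun y hy => ?_⟩
  by_cases hy' : y ≤ max X y0
  · exact hmax ⟨hy, hy'⟩
  · exact (hX y ((le_max_left _ _).trans (not_le.1 hy').le)).le.trans
      (hmax ⟨hy0, le_max_right _ _⟩)

theorem integrableOn_norm_pow_four {I : Set ℝ} (hIm : MeasurableSet I) {f : ℝ → ℂ}
    (hf : MemLp f 2 (volume.restrict I)) {C : ℝ} (hC : ∀ x ∈ I, ‖f x‖ ≤ C) :
    IntegrableOn (fun x => ‖f x‖ ^ 4) I := by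
  refine Integrable.mono' ((integrableOn_sq_norm hf).const_mul (C ^ 2)) (hf.1.norm.pow 4) ?_
  filter_upwards [ae_restrict_mem hIm] with x hx
  rw [Real.norm_eq_abs, abs_of_nonneg (by positivity)]
  have := pow_le_pow_left₀ (norm_nonneg _) (hC x hx) 2
  nlinarith [sq_nonneg ‖f x‖]

theorem IsH1On.integrableOn_pow_four_Ici {a : ℝ} {f : ℝ → ℂ} (hf : IsH1On (Ici a) f) :
    IntegrableOn (fun x => ‖f x‖ ^ 4) (Ici a) := by
  obtain ⟨x, _, hx⟩ := hf.exists_isMaxOn_norm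
  exact integrableOn_norm_pow_four measurableSet_Ici hf.1 hx

theorem IsH1On.integrableOn_pow_four_Icc {a b : ℝ} {f : ℝ → ℂ} (hf : IsH1On (Icc a b) f) :
    IntegrableOn (fun x => ‖f x‖ ^ 4) (Icc a b) :=
  ((hf.continuousOn ordConnected_Icc).norm.pow 4).integrableOn_Icc

/-! ### A calibration and the sharp Gagliardo–Nirenberg inequality -/

/-- The kinetic and mass part of the quadratic form on an edge. -/
def edgeQ (ω : ℝ) (I : Set ℝ) (f : ℝ → ℂ) : ℝ :=
  (∫ x in I, ‖deriv f x‖ ^ 2) + ω * ∫ x in I, ‖f x‖ ^ 2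

/-- The quartic part of the action on an edge. -/
def edgeN (I : Set ℝ) (f : ℝ → ℂ) : ℝ := ∫ x in I, ‖f x‖ ^ 4

theorem edgeQ_nonneg {ω : ℝ} (hω : 0 ≤ ω) (I : Set ℝ) (f : ℝ → ℂ) : 0 ≤ edgeQ ω I f :=
  add_nonneg (integral_nonneg fun _ => sq_nonneg _)
    (mul_nonneg hω (integral_nonneg fun _ => sq_nonneg _))

theorem edgeN_nonneg (I : Set ℝ) (f : ℝ → ℂ) : 0 ≤ edgeN I f :=
  integral_nonneg fun _ => by positivity

/-- The primitive of `s ↦ 2 √ω s √(1 - s² / μ²)` that vanishes at `0`. -/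
def calibration (ω μ s : ℝ) : ℝ := 2 * √ω * μ ^ 2 / 3 * (1 - (1 - s ^ 2 / μ ^ 2) ^ (3 / 2 : ℝ))

theorem hasDerivAt_calibration {ω μ : ℝ} (hμ : 0 < μ) (s : ℝ) :
    HasDerivAt (calibration ω μ) (2 * √ω * s * √(1 - s ^ 2 / μ ^ 2)) s := by
  have h1 : HasDerivAt (fun s : ℝ => 1 - s ^ 2 / μ ^ 2) (-(2 * s / μ ^ 2)) s := by
    have := ((hasDerivAt_pow 2 s).div_const (μ ^ 2)).const_sub 1
    simpa using this
  have h2 := h1.rpow_const (p := 3 / 2) (Or.inr (by norm_num))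
  have h3 := (h2.const_sub 1).const_mul (2 * √ω * μ ^ 2 / 3)
  convert! h3 using 1
  rw [show (3 / 2 - 1 : ℝ) = 1 / 2 by norm_num, ← Real.sqrt_eq_rpow]
  field_simp

/-- Bernoulli's inequality with exponent `3 / 2`. It turns a boundary value of the calibration into
the correction `√ω * ‖f R‖ ^ 2`. -/
theorem calibration_le {ω μ : ℝ} (hμ : 0 < μ) {s : ℝ} (hs : 0 ≤ s) (hsμ : s ≤ μ) :
    calibration ω μ s ≤ √ω * s ^ 2 := by
  have h1 : s ^ 2 / μ ^ 2 ≤ 1 := by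
    rw [div_le_one (by positivity)]; exact pow_le_pow_left₀ hs hsμ 2
  have h2 := one_add_mul_self_le_rpow_one_add (s := -(s ^ 2 / μ ^ 2)) (by linarith)
    (p := 3 / 2) (by norm_num)
  rw [← sub_eq_add_neg] at h2
  rw [calibration]
  calc _ ≤ 2 * √ω * μ ^ 2 / 3 * (3 / 2 * (s ^ 2 / μ ^ 2)) := by
        gcongr; linarith
    _ = _ := by field_simp

theorem calibration_self {ω μ : ℝ} (hμ : 0 < μ) : calibration ω μ μ = 2 * √ω * μ ^ 2 / 3 := by
  rw [calibration, div_self (by positivity), sub_self, Real.zero_rpow (by norm_num)]; ring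

/-- The integrand that the calibration bounds from below. -/
def calibrated (ω μ : ℝ) (f : ℝ → ℂ) (x : ℝ) : ℝ :=
  ‖deriv f x‖ ^ 2 + ω * ‖f x‖ ^ 2 - ω / μ ^ 2 * ‖f x‖ ^ 4

theorem calibrated_nonneg {ω μ : ℝ} (hω : 0 ≤ ω) (hμ : 0 < μ) {f : ℝ → ℂ} {x : ℝ}
    (hx : ‖f x‖ ≤ μ) : 0 ≤ calibrated ω μ f x := by
  have h1 : ‖f x‖ ^ 2 / μ ^ 2 ≤ 1 := by
    rw [div_le_one (by positivity)]; exact pow_le_pow_left₀ (norm_nonneg _) hx 2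
  have h2 : 0 ≤ ω * ‖f x‖ ^ 2 * (1 - ‖f x‖ ^ 2 / μ ^ 2) :=
    mul_nonneg (by positivity) (by linarith)
  have h3 : calibrated ω μ f x
      = ‖deriv f x‖ ^ 2 + ω * ‖f x‖ ^ 2 * (1 - ‖f x‖ ^ 2 / μ ^ 2) := by
    rw [calibrated]; field_simp; ring
  rw [h3]; positivity

/-- By the chain rule the derivative of the calibration along `‖f‖` is at most `2ab` with `a = ‖f'‖`
and `b = √ω ‖f‖ √(1 - ‖f‖² / μ²)`, and `a² + b²` is the calibrated integrand. -/
theorem IsH1On.calibration_sub_le {I : Set ℝ} (hI : I.OrdConnected) {f : ℝ → ℂ} (hf : IsH1On I f)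
    {ω μ : ℝ} (hω : 0 ≤ ω) (hμ : 0 < μ) (hbd : ∀ x ∈ I, ‖f x‖ ≤ μ) {x y : ℝ} (hx : x ∈ I)
    (hy : y ∈ I) (hxy : x ≤ y) :
    |calibration ω μ ‖f y‖ - calibration ω μ ‖f x‖| ≤ ∫ t in Icc x y, calibrated ω μ f t := by
  have hsub : Icc x y ⊆ I := hI.out hx hy
  have hfJ := hf.mono hsub
  -- The Lipschitz bound keeps the composite absolutely continuous, so that it is the integral of
  -- its derivative.
  have hlip : LipschitzOnWith (Real.toNNReal (2 * √ω * μ)) (calibration ω μ)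
      (Icc 0 μ) := by
    refine (convex_Icc 0 μ).lipschitzOnWith_of_nnnorm_hasDerivWithin_le
      (fun s _ => (hasDerivAt_calibration hμ s).hasDerivWithinAt) fun s hs => ?_
    rw [← NNReal.coe_le_coe, coe_nnnorm,
      Real.coe_toNNReal _ (by positivity), Real.norm_eq_abs, abs_of_nonneg
      (mul_nonneg (mul_nonneg (by positivity) hs.1) (Real.sqrt_nonneg _))]
    have h1 : √(1 - s ^ 2 / μ ^ 2) ≤ 1 :=
      Real.sqrt_le_one.2 (by linarith [show 0 ≤ s ^ 2 / μ ^ 2 by positivity])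
    calc _ ≤ 2 * √ω * s * 1 := by
          have := hs.1
          gcongr
      _ ≤ _ := by have := hs.2; rw [mul_one]; gcongr
  have hρ := hf.absolutelyContinuous_norm hI hx hy
  have hac := absolutelyContinuous_comp hρ hlip fun t ht =>
    ⟨norm_nonneg _, hbd t (hI.uIcc_subset hx hy ht)⟩
  rw [← hac.integral_deriv_eq_sub]
  have hint : IntegrableOn (calibrated ω μ f) (Icc x y) :=
    ((integrableOn_sq_norm hfJ.2.1).add ((integrableOn_sq_norm hfJ.1).const_mul ω)).sub
      (hfJ.integrableOn_pow_four_Icc.const_mul _)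
  refine (intervalIntegral.abs_integral_le_integral_abs hxy).trans ?_
  rw [intervalIntegral.integral_of_le hxy, ← integral_Icc_eq_integral_Ioc]
  have hdi := (intervalIntegrable_iff_integrableOn_Icc_of_le hxy).1 hac.intervalIntegrable_deriv
  refine integral_mono_ae hdi.abs hint ?_
  have h1 := hρ.ae_differentiableAt
  rw [uIcc_of_le hxy, ← ae_restrict_iff' measurableSet_Icc] at h1
  filter_upwards [h1, hfJ.ae_hasDerivAt ordConnected_Icc, ae_restrict_mem measurableSet_Icc]
    with t ht1 ht2 ht3
  have hd := ((hasDerivAt_calibration (ω := ω) hμ ‖f t‖).comp t ht1.hasDerivAt).deriv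
  simp only [Function.comp_def] at hd
  rw [hd, abs_mul, abs_of_nonneg (by positivity)]
  have hle := norm_deriv_norm_le f ht2
  have hb := hbd t (hsub ht3)
  have h4 : ‖f t‖ ^ 2 / μ ^ 2 ≤ 1 := by
    rw [div_le_one (by positivity)]; exact pow_le_pow_left₀ (norm_nonneg _) hb 2
  have h5 : √ω ^ 2 = ω := Real.sq_sqrt hω
  have h6 : √(1 - ‖f t‖ ^ 2 / μ ^ 2) ^ 2 = 1 - ‖f t‖ ^ 2 / μ ^ 2 := Real.sq_sqrt (by linarith)
  calc _ ≤ 2 * √ω * ‖f t‖ * √(1 - ‖f t‖ ^ 2 / μ ^ 2) * ‖deriv f t‖ := by gcongr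
    _ ≤ ‖deriv f t‖ ^ 2 + (√ω * ‖f t‖ * √(1 - ‖f t‖ ^ 2 / μ ^ 2)) ^ 2 := by
        nlinarith [sq_nonneg (‖deriv f t‖ - √ω * ‖f t‖ * √(1 - ‖f t‖ ^ 2 / μ ^ 2))]
    _ = calibrated ω μ f t := by
        rw [mul_pow, mul_pow, h5, h6, calibrated]; field_simp; ring

/-- The calibration is spent twice: on the climb from `‖f R‖` to the maximum and on the descent from
there to 0 at infinity. Each passage through the maximum contributes `2 / 3 * √ω * ‖f x₀‖ ^ 2`. -/
theorem IsH1On.edge_lower_bound {R : ℝ} {f : ℝ → ℂ} (hf : IsH1On (Ici R) f) {ω : ℝ} (hω : 0 ≤ ω)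
    {x₀ : ℝ} (hx₀ : x₀ ∈ Ici R) (hmax : ∀ y ∈ Ici R, ‖f y‖ ≤ ‖f x₀‖) (hpos : 0 < ‖f x₀‖) :
    4 / 3 * √ω * ‖f x₀‖ ^ 2 + ω / ‖f x₀‖ ^ 2 * edgeN (Ici R) f ≤
      edgeQ ω (Ici R) f + √ω * ‖f R‖ ^ 2 := by
  set μ := ‖f x₀‖
  have hint : IntegrableOn (calibrated ω μ f) (Ici R) :=
    ((integrableOn_sq_norm hf.2.1).add ((integrableOn_sq_norm hf.1).const_mul ω)).sub
      (hf.integrableOn_pow_four_Ici.const_mul _)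
  have hQN : ∫ t in Ici R, calibrated ω μ f t =
      edgeQ ω (Ici R) f - ω / μ ^ 2 * edgeN (Ici R) f := by
    have e1 := integral_sub ((integrableOn_sq_norm hf.2.1).add
      ((integrableOn_sq_norm hf.1).const_mul ω))
          (hf.integrableOn_pow_four_Ici.const_mul (ω / μ ^ 2))
    have e2 := integral_add (integrableOn_sq_norm hf.2.1)
      ((integrableOn_sq_norm hf.1).const_mul ω)
    simp only [Pi.add_apply] at e1
    rw [edgeQ, edgeN, ← integral_const_mul, ← integral_const_mul, ← e2, ← e1]
    rfl
  have hnn : ∀ t ∈ Ici R, 0 ≤ calibrated ω μ f t := fun t ht =>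
    calibrated_nonneg hω hpos (hmax t ht)
  have key : ∀ y, x₀ ≤ y → 4 / 3 * √ω * μ ^ 2 - √ω * ‖f R‖ ^ 2 - √ω * ‖f y‖ ^ 2 ≤
      ∫ t in Ici R, calibrated ω μ f t := by
    intro y hy
    have hyR : y ∈ Ici R := le_trans hx₀ hy
    have h1 := hf.calibration_sub_le ordConnected_Ici hω hpos hmax self_mem_Ici hx₀ hx₀
    have h2 := hf.calibration_sub_le ordConnected_Ici hω hpos hmax hx₀ hyR hy
    have h3 := calibration_le (ω := ω) hpos (norm_nonneg (f R)) (hmax R self_mem_Ici)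
    have h4 := calibration_le (ω := ω) hpos (norm_nonneg (f y)) (hmax y hyR)
    have h5 : calibration ω μ ‖f x₀‖ = 2 * √ω * μ ^ 2 / 3 := calibration_self hpos
    rw [h5] at h1 h2
    have h6 : (∫ t in Icc R x₀, calibrated ω μ f t) + ∫ t in Icc x₀ y, calibrated ω μ f t ≤
        ∫ t in Ici R, calibrated ω μ f t := by
      rw [integral_Icc_eq_integral_Ioc, integral_Icc_eq_integral_Ioc,
        ← setIntegral_union (by
          rw [Set.disjoint_left]; intro t ht ht'; exact absurd ht.2 (not_le.2 ht'.1))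
          measurableSet_Ioc
          (hint.mono_set fun t ht => ht.1.le)
          (hint.mono_set fun t ht => le_trans hx₀ ht.1.le), Ioc_union_Ioc_eq_Ioc hx₀ hy]
      exact setIntegral_mono_set hint ((ae_restrict_iff' measurableSet_Ici).2
        (Eventually.of_forall hnn)) (LE.le.eventuallyLE fun t ht => le_of_lt ht.1)
    have h7 := (le_abs_self _).trans h1
    have h9 := abs_le.1 h2
    linarith [h9.1]
  have hlim : Tendsto (fun y => 4 / 3 * √ω * μ ^ 2 - √ω * ‖f R‖ ^ 2 - √ω * ‖f y‖ ^ 2) atTop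
      (𝓝 (4 / 3 * √ω * μ ^ 2 - √ω * ‖f R‖ ^ 2 - √ω * ‖(0 : ℂ)‖ ^ 2)) :=
    ((hf.tendsto_zero.norm.pow 2).const_mul (√ω)).const_sub _
  have := le_of_tendsto hlim (eventually_atTop.2 ⟨x₀, key⟩)
  rw [hQN] at this
  simp only [norm_zero] at this
  linarith

/-- The sharp Gagliardo–Nirenberg inequality on a half-line, with a boundary correction. -/
theorem IsH1On.gagliardo_nirenberg {R : ℝ} {f : ℝ → ℂ} (hf : IsH1On (Ici R) f) {ω : ℝ}
    (hω : 0 ≤ ω) :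
    16 / 3 * (ω * √ω) * edgeN (Ici R) f ≤ (edgeQ ω (Ici R) f + √ω * ‖f R‖ ^ 2) ^ 2 := by
  obtain ⟨x₀, hx₀, hmax⟩ := hf.exists_isMaxOn_norm
  rcases (norm_nonneg (f x₀)).eq_or_lt with h0 | hpos
  · have : edgeN (Ici R) f = 0 := by
      rw [edgeN, setIntegral_eq_zero_of_forall_eq_zero]
      intro x hx
      have := hmax x hx
      rw [← h0] at this
      simp [le_antisymm this (norm_nonneg _)]
    rw [this, mul_zero]; positivity
  have h := hf.edge_lower_bound hω hx₀ hmax hpos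
  have hN := edgeN_nonneg (Ici R) f
  set μ := ‖f x₀‖
  set N := edgeN (Ici R) f
  have hA : 0 ≤ 4 / 3 * √ω * μ ^ 2 := by positivity
  have hB : 0 ≤ ω / μ ^ 2 * N := by positivity
  -- The maximum `μ` cancels in the product of the two terms, so `4ab ≤ (a + b)²` gives a bound free
  -- of `μ`; this is the origin of `16 / 3`.
  calc 16 / 3 * (ω * √ω) * N = 4 * (4 / 3 * √ω * μ ^ 2) * (ω / μ ^ 2 * N) := by field_simp; ring
    _ ≤ (4 / 3 * √ω * μ ^ 2 + ω / μ ^ 2 * N) ^ 2 := by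
        nlinarith [sq_nonneg (4 / 3 * √ω * μ ^ 2 - ω / μ ^ 2 * N)]
    _ ≤ _ := pow_le_pow_left₀ (by positivity) h 2

/-- Beyond the maximum point the boundary value is the maximum itself, and `4 / 3 - 1 = 1 / 3` of
`√ω * ‖f x₀‖ ^ 2` survives the correction. -/
theorem IsH1On.sup_sq_le {R : ℝ} {f : ℝ → ℂ} (hf : IsH1On (Ici R) f) {ω : ℝ} (hω : 0 ≤ ω)
    {y : ℝ} (hy : y ∈ Ici R) : √ω * ‖f y‖ ^ 2 ≤ 3 * edgeQ ω (Ici R) f := by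
  obtain ⟨x₀, hx₀, hmax⟩ := hf.exists_isMaxOn_norm
  have hQ := edgeQ_nonneg hω (Ici R) f
  have hle : √ω * ‖f y‖ ^ 2 ≤ √ω * ‖f x₀‖ ^ 2 := by
    have := hmax y hy
    gcongr
  refine hle.trans ?_
  rcases (norm_nonneg (f x₀)).eq_or_lt with h0 | hpos
  · rw [← h0]; simpa using hQ
  have hsub : Ici x₀ ⊆ Ici R := Ici_subset_Ici.2 hx₀
  have h := (hf.mono hsub).edge_lower_bound hω self_mem_Ici (fun y hy => hmax y (hsub hy)) hpos
  have h2 : edgeQ ω (Ici x₀) f ≤ edgeQ ω (Ici R) f := by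
    refine add_le_add ?_ (mul_le_mul_of_nonneg_left ?_ hω)
    · exact setIntegral_mono_set (integrableOn_sq_norm hf.2.1)
        (Eventually.of_forall fun _ => sq_nonneg _) hsub.eventuallyLE
    · exact setIntegral_mono_set (integrableOn_sq_norm hf.1)
        (Eventually.of_forall fun _ => sq_nonneg _) hsub.eventuallyLE
  have h3 : 0 ≤ ω / ‖f x₀‖ ^ 2 * edgeN (Ici x₀) f :=
    mul_nonneg (by positivity) (edgeN_nonneg _ _)
  linarith

/-! ### The functionals on the graph -/

/-- The quadratic part of the Nehari functional. -/
def fullQ (ω γ L : ℝ) (v : GraphFun) : ℝ :=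
  edgeQ ω (Icc (-L) L) v.c + edgeQ ω (Ici 0) v.h + γ * ‖v.h 0‖ ^ 2

/-- The quartic part of the Nehari functional. -/
def fullN (L : ℝ) (v : GraphFun) : ℝ := edgeN (Icc (-L) L) v.c + edgeN (Ici 0) v.h

theorem quadForm_add_normL2Sq (ω γ L : ℝ) (v : GraphFun) :
    quadForm γ L v + ω * normL2Sq L v = fullQ ω γ L v := by
  simp only [quadForm, normDerivL2Sq, normL2Sq, fullQ, edgeQ, integral_Icc_eq_integral_Ioo,
    integral_Ici_eq_integral_Ioi]
  ring

theorem normL4Pow_eq (L : ℝ) (v : GraphFun) : normL4Pow L v = fullN L v := by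
  simp only [normL4Pow, fullN, edgeN, integral_Icc_eq_integral_Ioo, integral_Ici_eq_integral_Ioi]

theorem nehariFunctional_eq (ω γ L : ℝ) (v : GraphFun) :
    nehariFunctional ω γ L v = fullQ ω γ L v - fullN L v := by
  rw [nehariFunctional, quadForm_add_normL2Sq, normL4Pow_eq]

theorem action_eq (ω γ L : ℝ) (v : GraphFun) :
    action ω γ L v = 1 / 2 * fullQ ω γ L v - 1 / 4 * fullN L v := by
  rw [action, ← quadForm_add_normL2Sq, normL4Pow_eq]; ring

theorem action_eq_of_mem {ω γ L : ℝ} {v : GraphFun} (hv : v ∈ nehariManifold ω γ L) :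
    action ω γ L v = fullN L v / 4 := by
  have := hv.2.2
  rw [nehariFunctional_eq] at this
  rw [action_eq]; linarith

/-- The multiple of a function on the graph by a scalar. -/
def GraphFun.scale (t : ℂ) (v : GraphFun) : GraphFun := ⟨fun x => t * v.c x, fun x => t * v.h x⟩

theorem edgeQ_const_mul (ω : ℝ) (I : Set ℝ) (t : ℂ) (f : ℝ → ℂ) :
    edgeQ ω I (fun x => t * f x) = ‖t‖ ^ 2 * edgeQ ω I f := by
  simp only [edgeQ, deriv_const_mul_field, norm_mul, mul_pow, integral_const_mul]
  ring

theorem edgeN_const_mul (I : Set ℝ) (t : ℂ) (f : ℝ → ℂ) :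
    edgeN I (fun x => t * f x) = ‖t‖ ^ 4 * edgeN I f := by
  simp only [edgeN, norm_mul, mul_pow, integral_const_mul]

theorem fullQ_scale (ω γ L : ℝ) (t : ℂ) (v : GraphFun) :
    fullQ ω γ L (v.scale t) = ‖t‖ ^ 2 * fullQ ω γ L v := by
  simp only [fullQ, GraphFun.scale, edgeQ_const_mul, norm_mul, mul_pow]; ring

theorem fullN_scale (L : ℝ) (t : ℂ) (v : GraphFun) :
    fullN L (v.scale t) = ‖t‖ ^ 4 * fullN L v := by
  simp only [fullN, GraphFun.scale, edgeN_const_mul]; ring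

theorem scale_mem_formDomain {L : ℝ} {v : GraphFun} (hv : v ∈ formDomain L) (t : ℂ) :
    v.scale t ∈ formDomain L :=
  ⟨(hv.1.const_mul ordConnected_Icc t).1, (hv.2.1.const_mul ordConnected_Ici t).1,
    by simp [GraphFun.scale, hv.2.2.1], by simp [GraphFun.scale, hv.2.2.2]⟩

theorem fullQ_nonneg {ω γ : ℝ} (hω : 0 ≤ ω) (hγ : 0 ≤ γ) (L : ℝ) (v : GraphFun) :
    0 ≤ fullQ ω γ L v := by
  have h1 := edgeQ_nonneg hω (Icc (-L) L) v.c
  have h2 := edgeQ_nonneg hω (Ici 0) v.h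
  have h3 : 0 ≤ γ * ‖v.h 0‖ ^ 2 := by positivity
  unfold fullQ; linarith

theorem fullN_nonneg (L : ℝ) (v : GraphFun) : 0 ≤ fullN L v :=
  add_nonneg (edgeN_nonneg _ _) (edgeN_nonneg _ _)

/-- The function does not vanish identically on the graph. -/
def GraphFun.Nonzero (L : ℝ) (v : GraphFun) : Prop :=
  (∃ x ∈ Icc (-L) L, v.c x ≠ 0) ∨ ∃ x ∈ Ici (0 : ℝ), v.h x ≠ 0

theorem eqOn_zero_of_edgeN_eq_zero {I : Set ℝ}
    (hI : I ⊆ closure (interior I)) {f : ℝ → ℂ} (hc : ContinuousOn f I)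
    (hint : IntegrableOn (fun x => ‖f x‖ ^ 4) I) (h0 : edgeN I f = 0) : ∀ x ∈ I, f x = 0 := by
  have h1 : (fun x => ‖f x‖ ^ 4) =ᵐ[volume.restrict I] 0 :=
    (integral_eq_zero_iff_of_nonneg (fun x => by positivity) hint).1 h0
  have h2 : f =ᵐ[volume.restrict I] fun _ => 0 := by
    filter_upwards [h1] with x hx
    simpa using hx
  exact Measure.eqOn_of_ae_eq h2 hc continuousOn_const hI

theorem Icc_subset_closure_interior {L : ℝ} (hL : 0 < L) :
    Icc (-L) L ⊆ closure (interior (Icc (-L) L)) := by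
  rw [interior_Icc, closure_Ioo (by linarith)]

theorem Ici_subset_closure_interior (a : ℝ) : Ici a ⊆ closure (interior (Ici a)) := by
  rw [interior_Ici, closure_Ioi]

theorem fullN_pos_iff {L : ℝ} (hL : 0 < L) {v : GraphFun} (hv : v ∈ formDomain L) :
    0 < fullN L v ↔ v.Nonzero L := by
  have h1 := edgeN_nonneg (Icc (-L) L) v.c
  have h2 := edgeN_nonneg (Ici 0) v.h
  constructor
  · intro h
    by_contra hcon
    simp only [GraphFun.Nonzero, not_or, not_exists, not_and, not_not] at hcon
    have e1 : edgeN (Icc (-L) L) v.c = 0 :=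
      setIntegral_eq_zero_of_forall_eq_zero fun x hx => by simp [hcon.1 x hx]
    have e2 : edgeN (Ici 0) v.h = 0 :=
      setIntegral_eq_zero_of_forall_eq_zero fun x hx => by simp [hcon.2 x hx]
    rw [fullN, e1, e2] at h
    simp at h
  · intro h
    by_contra hcon
    have e1 : edgeN (Icc (-L) L) v.c = 0 := by unfold fullN at hcon; linarith
    have e2 : edgeN (Ici 0) v.h = 0 := by unfold fullN at hcon; linarith
    rcases h with ⟨x, hx, hne⟩ | ⟨x, hx, hne⟩
    · exact hne (eqOn_zero_of_edgeN_eq_zero (Icc_subset_closure_interior hL)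
        (hv.1.continuousOn ordConnected_Icc) hv.1.integrableOn_pow_four_Icc e1 x hx)
    · exact hne (eqOn_zero_of_edgeN_eq_zero (Ici_subset_closure_interior 0)
        (hv.2.1.continuousOn ordConnected_Ici) hv.2.1.integrableOn_pow_four_Ici e2 x hx)

theorem mem_nehariManifold_iff {ω γ L : ℝ} (hL : 0 < L) {v : GraphFun} :
    v ∈ nehariManifold ω γ L ↔
      v ∈ formDomain L ∧ 0 < fullN L v ∧ fullQ ω γ L v = fullN L v := by
  have : v ∈ nehariManifold ω γ L ↔
      v ∈ formDomain L ∧ v.Nonzero L ∧ nehariFunctional ω γ L v = 0 := Iff.rfl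
  rw [this, nehariFunctional_eq, sub_eq_zero]
  exact ⟨fun h => ⟨h.1, (fullN_pos_iff hL h.1).2 h.2.1, h.2.2⟩,
    fun h => ⟨h.1, (fullN_pos_iff hL h.1).1 h.2.1, h.2.2⟩⟩

theorem sup_sq_le_fullQ {ω γ L : ℝ} (hω : 0 < ω) (hγ : 0 ≤ γ) (hL : 0 < L) {v : GraphFun}
    (hv : v ∈ formDomain L) :
    (∀ x ∈ Icc (-L) L, ‖v.c x‖ ^ 2 ≤ (6 / √ω + 4 * L) * fullQ ω γ L v) ∧
      ∀ x ∈ Ici (0 : ℝ), ‖v.h x‖ ^ 2 ≤ (6 / √ω + 4 * L) * fullQ ω γ L v := by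
  have h1 := edgeQ_nonneg hω.le (Icc (-L) L) v.c
  have h2 := edgeQ_nonneg hω.le (Ici 0) v.h
  have h3 : 0 ≤ γ * ‖v.h 0‖ ^ 2 := by positivity
  have hs : 0 < √ω := Real.sqrt_pos.2 hω
  have hq1 : edgeQ ω (Ici 0) v.h ≤ fullQ ω γ L v := by unfold fullQ; linarith
  have hq2 : edgeQ ω (Icc (-L) L) v.c ≤ fullQ ω γ L v := by unfold fullQ; linarith
  have hQ := h2.trans hq1
  have hh : ∀ x ∈ Ici (0 : ℝ), ‖v.h x‖ ^ 2 ≤ 3 / √ω * fullQ ω γ L v := fun x hx => by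
    have := hv.2.1.sup_sq_le hω.le hx
    rw [div_mul_eq_mul_div, le_div_iff₀ hs]
    nlinarith
  constructor
  · intro x hx
    have ha := hv.1.norm_sub_sq_le ordConnected_Icc (left_mem_Icc.2 (by linarith)) hx
    have hb := hh 0 self_mem_Ici
    rw [← hv.2.2.2] at hb
    have hc : ∫ t in Icc (-L) L, ‖deriv v.c t‖ ^ 2 ≤ fullQ ω γ L v := by
      refine le_trans ?_ hq2
      exact le_add_of_nonneg_right (mul_nonneg hω.le (integral_nonneg fun _ => sq_nonneg _))
    have hd : |x - -L| ≤ 2 * L := by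
      rw [abs_of_nonneg (by linarith [hx.1])]; linarith [hx.2]
    have he : ‖v.c x - v.c (-L)‖ ^ 2 ≤ 2 * L * fullQ ω γ L v :=
      ha.trans (mul_le_mul hd hc (integral_nonneg fun _ => sq_nonneg _) (by linarith))
    have hf : ‖v.c x‖ ≤ ‖v.c x - v.c (-L)‖ + ‖v.c (-L)‖ := by
      simpa using norm_add_le (v.c x - v.c (-L)) (v.c (-L))
    have hg : ‖v.c x‖ ^ 2 ≤ (‖v.c x - v.c (-L)‖ + ‖v.c (-L)‖) ^ 2 :=
      pow_le_pow_left₀ (norm_nonneg _) hf 2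
    -- The constant is `2 * (3 / √ω) + 2 * (2 * L)`, from `(a + b)² ≤ 2a² + 2b²`: the half-line
    -- controls the vertex value, and the length `2 * L` the increment along the loop.
    have hi : 6 / √ω = 2 * (3 / √ω) := by ring
    rw [hi]
    nlinarith [sq_nonneg (‖v.c x - v.c (-L)‖ - ‖v.c (-L)‖)]
  · intro x hx
    refine (hh x hx).trans (mul_le_mul_of_nonneg_right ?_ hQ)
    have : 3 / √ω ≤ 6 / √ω := by gcongr; norm_num
    linarith

theorem edgeN_le {I : Set ℝ} (hIm : MeasurableSet I) {f : ℝ → ℂ}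
    (hf : MemLp f 2 (volume.restrict I)) {C : ℝ} (hC : ∀ x ∈ I, ‖f x‖ ^ 2 ≤ C) :
    edgeN I f ≤ C * ∫ x in I, ‖f x‖ ^ 2 := by
  have h0 : ∀ x ∈ I, ‖f x‖ ≤ √C := fun x hx => Real.le_sqrt_of_sq_le (hC x hx)
  rw [edgeN, ← integral_const_mul]
  refine setIntegral_mono_on (integrableOn_norm_pow_four hIm hf h0)
    ((integrableOn_sq_norm hf).const_mul _) hIm fun x hx => ?_
  have := hC x hx
  nlinarith [sq_nonneg ‖f x‖]

/-- One factor `fullQ` bounds the supremum and the other the mass. On the Nehari manifold, where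
both parts agree, this keeps `fullN` away from 0. -/
theorem fullN_le {ω γ L : ℝ} (hω : 0 < ω) (hγ : 0 ≤ γ) (hL : 0 < L) {v : GraphFun}
    (hv : v ∈ formDomain L) :
    fullN L v ≤ (6 / √ω + 4 * L) / ω * fullQ ω γ L v ^ 2 := by
  obtain ⟨h1, h2⟩ := sup_sq_le_fullQ hω hγ hL hv
  have e1 := edgeN_le measurableSet_Icc hv.1.1 h1
  have e2 := edgeN_le measurableSet_Ici hv.2.1.1 h2
  set Q := fullQ ω γ L v with hQdef
  have hQ : 0 ≤ Q := fullQ_nonneg hω.le hγ L v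
  have hs : 0 < √ω := Real.sqrt_pos.2 hω
  set A := ∫ x in Icc (-L) L, ‖v.c x‖ ^ 2 with hA
  set B := ∫ x in Ici 0, ‖v.h x‖ ^ 2 with hB
  have h3 : ω * (A + B) ≤ Q := by
    have k1 : 0 ≤ ∫ x in Icc (-L) L, ‖deriv v.c x‖ ^ 2 := integral_nonneg fun _ => sq_nonneg _
    have k2 : 0 ≤ ∫ x in Ici 0, ‖deriv v.h x‖ ^ 2 := integral_nonneg fun _ => sq_nonneg _
    have k3 : 0 ≤ γ * ‖v.h 0‖ ^ 2 := by positivity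
    rw [hQdef, fullQ, edgeQ, edgeQ]; linarith
  have h4 : A + B ≤ Q / ω := by rw [le_div_iff₀ hω]; linarith
  have hK : 0 ≤ (6 / √ω + 4 * L) * Q := by positivity
  calc fullN L v ≤ (6 / √ω + 4 * L) * Q * (A + B) := by unfold fullN; linarith
    _ ≤ (6 / √ω + 4 * L) * Q * (Q / ω) := by gcongr
    _ = _ := by ring

/-- Every nonzero function has a multiple on the Nehari manifold. -/
theorem exists_scale_mem_nehari {ω γ L : ℝ} (hω : 0 < ω) (hγ : 0 ≤ γ) (hL : 0 < L)
    {v : GraphFun} (hv : v ∈ formDomain L) (hN : 0 < fullN L v) :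
    ∃ t : ℂ, v.scale t ∈ nehariManifold ω γ L ∧
      fullN L (v.scale t) = fullQ ω γ L v ^ 2 / fullN L v := by
  have hQ := fullQ_nonneg hω.le hγ L v
  have hQpos : 0 < fullQ ω γ L v := by
    rcases hQ.eq_or_lt with h | h
    · have := fullN_le hω hγ hL hv
      rw [← h] at this
      simp at this
      linarith
    · exact h
  set Q := fullQ ω γ L v
  set N := fullN L v
  -- The Nehari condition for `t * v` reads `‖t‖ ^ 2 * Q = ‖t‖ ^ 4 * N`, hence `‖t‖ ^ 2 = Q / N`.
  have hn : ‖((√(Q / N) : ℝ) : ℂ)‖ ^ 2 = Q / N := by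
    rw [Complex.norm_real, Real.norm_eq_abs, sq_abs, Real.sq_sqrt (by positivity)]
  have hn4 : ‖((√(Q / N) : ℝ) : ℂ)‖ ^ 4 = (Q / N) ^ 2 := by
    rw [show 4 = 2 * 2 from rfl, pow_mul, hn]
  have e1 : fullN L (v.scale (√(Q / N) : ℝ)) = Q ^ 2 / N := by
    rw [fullN_scale, hn4]; change (Q / N) ^ 2 * N = _; field_simp
  refine ⟨(√(Q / N) : ℝ), (mem_nehariManifold_iff hL).2 ⟨scale_mem_formDomain hv _, ?_, ?_⟩, e1⟩
  · rw [e1]; positivity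
  · rw [e1, fullQ_scale, hn]; change Q / N * Q = _; ring

/-! ### Weak compactness in `H¹` -/

theorem norm_sq_toLp {I : Set ℝ} {g : ℝ → ℂ} (hg : MemLp g 2 (volume.restrict I)) :
    ‖hg.toLp g‖ ^ 2 = ∫ x in I, ‖g x‖ ^ 2 := by
  rw [← inner_self_eq_norm_sq (𝕜 := ℂ), L2.inner_def]
  have : ∫ a in I, inner ℂ (hg.toLp g a) (hg.toLp g a) = ∫ a in I, ((‖g a‖ ^ 2 : ℝ) : ℂ) := by
    refine integral_congr_ae ?_
    filter_upwards [hg.coeFn_toLp] with x hx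
    rw [hx, inner_self_eq_norm_sq_to_K]
    simp
  rw [this, integral_complex_ofReal]
  simp

theorem inner_toLp {I : Set ℝ} {f g : ℝ → ℂ} (hf : MemLp f 2 (volume.restrict I))
    (hg : MemLp g 2 (volume.restrict I)) :
    inner ℂ (hf.toLp f) (hg.toLp g) = ∫ x in I, g x * (starRingEnd ℂ) (f x) := by
  rw [L2.inner_def]
  refine integral_congr_ae ?_
  filter_upwards [hf.coeFn_toLp, hg.coeFn_toLp] with x hx hy
  rw [hx, hy, RCLike.inner_apply]

/-- Every bounded sequence in `L²` has a weakly convergent subsequence. -/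
theorem exists_weak_limit (I : Set ℝ) {G : ℕ → ℝ → ℂ}
    (hG : ∀ n, MemLp (G n) 2 (volume.restrict I)) {C : ℝ} (hC : ∀ n, ∫ x in I, ‖G n x‖ ^ 2 ≤ C) :
    ∃ (φ : ℕ → ℕ) (g : ℝ → ℂ), StrictMono φ ∧ MemLp g 2 (volume.restrict I) ∧
      ∀ f, MemLp f 2 (volume.restrict I) →
        Tendsto (fun n => ∫ x in I, f x * (starRingEnd ℂ) (G (φ n) x)) atTop
          (𝓝 (∫ x in I, f x * (starRingEnd ℂ) (g x))) := by
  have i1 : Fact ((1 : ENNReal) ≤ 2) := ⟨by norm_num⟩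
  have i2 : Fact ((2 : ENNReal) ≠ ⊤) := ⟨by norm_num⟩
  have i3 : SecondCountableTopology (Lp ℂ 2 (volume.restrict I)) := Lp.SecondCountableTopology
  -- The Riesz map moves the sequence into the dual of a separable space, where closed balls are
  -- weak-* sequentially compact.
  set D : ℕ → WeakDual ℂ (Lp ℂ 2 (volume.restrict I)) := fun n =>
    StrongDual.toWeakDual (InnerProductSpace.toDual ℂ _ ((hG n).toLp (G n)))
  have hD : ∀ n, D n ∈ WeakDual.toStrongDual ⁻¹'
      Metric.closedBall (0 : StrongDual ℂ (Lp ℂ 2 (volume.restrict I))) √C := by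
    intro n
    rw [mem_preimage, mem_closedBall_zero_iff]
    change ‖InnerProductSpace.toDual ℂ _ ((hG n).toLp (G n))‖ ≤ _
    rw [LinearIsometryEquiv.norm_map]
    exact Real.le_sqrt_of_sq_le ((norm_sq_toLp (hG n)).trans_le (hC n))
  obtain ⟨ℓ, -, φ, hφ, hlim⟩ := WeakDual.isSeqCompact_closedBall ℂ
    (Lp ℂ 2 (volume.restrict I)) 0 √C hD
  set u := (InnerProductSpace.toDual ℂ (Lp ℂ 2 (volume.restrict I))).symm
    (WeakDual.toStrongDual ℓ)
  refine ⟨φ, u, hφ, Lp.memLp u, fun f hf => ?_⟩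
  have h1 : Tendsto (fun n => D (φ n) (hf.toLp f)) atTop (𝓝 (ℓ (hf.toLp f))) :=
    ((WeakDual.eval_continuous (hf.toLp f)).tendsto ℓ).comp hlim
  have h2 : ∀ n, D (φ n) (hf.toLp f) = ∫ x in I, f x * (starRingEnd ℂ) (G (φ n) x) := fun n =>
    inner_toLp (hG (φ n)) hf
  have h3 : ℓ (hf.toLp f) = ∫ x in I, f x * (starRingEnd ℂ) (u x) := by
    rw [← inner_toLp (Lp.memLp u) hf, Lp.toLp_coeFn]
    exact (InnerProductSpace.toDual_symm_apply).symm
  simpa only [h2, h3] using h1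

/-- Pointwise convergence together with weak convergence of the derivatives. -/
def WeaklyTendsto (I : Set ℝ) (F : ℕ → ℝ → ℂ) (f : ℝ → ℂ) : Prop :=
  (∀ x ∈ I, Tendsto (fun n => F n x) atTop (𝓝 (f x))) ∧
    ∀ g, MemLp g 2 (volume.restrict I) →
      Tendsto (fun n => ∫ x in I, g x * (starRingEnd ℂ) (deriv (F n) x)) atTop
        (𝓝 (∫ x in I, g x * (starRingEnd ℂ) (deriv f x)))

theorem WeaklyTendsto.comp {I : Set ℝ} {F : ℕ → ℝ → ℂ} {f : ℝ → ℂ} (h : WeaklyTendsto I F f)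
    {φ : ℕ → ℕ} (hφ : StrictMono φ) : WeaklyTendsto I (fun n => F (φ n)) f :=
  ⟨fun x hx => (h.1 x hx).comp hφ.tendsto_atTop, fun g hg => (h.2 g hg).comp hφ.tendsto_atTop⟩

/-- The derivatives converge weakly to some `g` and the values at `x₀` converge, both along a
subsequence; the limit is the primitive of `g` with the limiting value at `x₀`. -/
theorem exists_weaklyTendsto {I : Set ℝ} (hI : I.OrdConnected) {x₀ : ℝ} (hx₀ : x₀ ∈ I)
    {F : ℕ → ℝ → ℂ} (hF : ∀ n, IsH1On I (F n)) {C : ℝ} (hC : ∀ n, ∫ x in I, ‖F n x‖ ^ 2 ≤ C)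
    (hC' : ∀ n, ∫ x in I, ‖deriv (F n) x‖ ^ 2 ≤ C) (hx₀C : ∀ n, ‖F n x₀‖ ≤ C) :
    ∃ (φ : ℕ → ℕ) (f : ℝ → ℂ), StrictMono φ ∧ IsH1On I f ∧
      WeaklyTendsto I (fun n => F (φ n)) f := by
  obtain ⟨φ, g, hφ, hg, hlim⟩ := exists_weak_limit I (fun n => (hF n).2.1) hC'
  obtain ⟨p, -, ψ, hψ, hp⟩ := tendsto_subseq_of_bounded (Metric.isBounded_closedBall (x := (0 : ℂ))
    (r := C)) (x := fun n => F (φ n) x₀) (fun n => mem_closedBall_zero_iff.2 (hx₀C _))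
  set f : ℝ → ℂ := fun x => p + ∫ t in x₀..x, g t
  have hIm : MeasurableSet I := hI.measurableSet
  have hgi : ∀ x ∈ I, ∀ y ∈ I, IntervalIntegrable g volume x y := fun x hx y hy =>
    intervalIntegrable_of_memLp_two hI hg hx hy
  have hfg : ∀ x ∈ I, ∀ y ∈ I, f y - f x = ∫ t in x..y, g t := fun x hx y hy => by
    have := intervalIntegral.integral_interval_sub_left (hgi x₀ hx₀ y hy) (hgi x₀ hx₀ x hx)
    simp only [f]; rw [← this]; ring
  have hle : ∀ a ∈ I, ∀ b ∈ I, a ≤ b →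
      Tendsto (fun n => ∫ t in a..b, deriv (F (φ n)) t) atTop (𝓝 (∫ t in a..b, g t)) := by
    intro a ha b hb hab
    have hsub : Ioc a b ⊆ I := fun t ht => hI.out ha hb ⟨ht.1.le, ht.2⟩
    -- Pairing with indicators of bounded intervals turns weak convergence of the derivatives into
    -- convergence of increments.
    have hind : MemLp ((Ioc a b).indicator fun _ => (1 : ℂ)) 2 (volume.restrict I) :=
      memLp_indicator_const 2 measurableSet_Ioc 1 (Or.inr (by
        rw [Measure.restrict_apply measurableSet_Ioc]
        exact (measure_mono inter_subset_left).trans_lt measure_Ioc_lt_top |>.ne))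
    have h1 := hlim _ hind
    have h2 : ∀ k : ℝ → ℂ, ∫ x in I, (Ioc a b).indicator (fun _ => (1 : ℂ)) x *
        (starRingEnd ℂ) (k x) = (starRingEnd ℂ) (∫ t in a..b, k t) := by
      intro k
      have : (fun x => (Ioc a b).indicator (fun _ => (1 : ℂ)) x * (starRingEnd ℂ) (k x)) =
          (Ioc a b).indicator fun x => (starRingEnd ℂ) (k x) := by
        ext x; by_cases hx : x ∈ Ioc a b <;> simp [hx]
      rw [this, setIntegral_indicator measurableSet_Ioc, inter_eq_right.2 hsub,
        intervalIntegral.integral_of_le hab, ← integral_conj]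
    simp only [h2] at h1
    have h3 := (Complex.continuous_conj.tendsto _).comp h1
    simpa [Function.comp_def] using h3
  have hany : ∀ a ∈ I, ∀ b ∈ I,
      Tendsto (fun n => ∫ t in a..b, deriv (F (φ n)) t) atTop (𝓝 (∫ t in a..b, g t)) := by
    intro a ha b hb
    rcases le_total a b with h | h
    · exact hle a ha b hb h
    · have := (hle b hb a ha h).neg
      simpa only [← intervalIntegral.integral_symm] using this
  have hpt : ∀ x ∈ I, Tendsto (fun n => F (φ (ψ n)) x) atTop (𝓝 (f x)) := by
    intro x hx
    have h1 := hp.add ((hany x₀ hx₀ x hx).comp hψ.tendsto_atTop)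
    refine h1.congr fun n => ?_
    simp only [Function.comp_def, ← (hF (φ (ψ n))).2.2 x₀ hx₀ x hx]
    ring
  have hfm : AEStronglyMeasurable f (volume.restrict I) :=
    aestronglyMeasurable_of_tendsto_ae atTop (fun n => (hF (φ (ψ n))).1.1)
      ((ae_restrict_iff' hIm).2 (Eventually.of_forall hpt))
  -- The `L²` bound survives the pointwise limit by Fatou's lemma.
  have hfL : MemLp f 2 (volume.restrict I) := by
    have h1 := Lp.eLpNorm_lim_le_liminf_eLpNorm (p := 2) (fun n => (hF (φ (ψ n))).1.1) f
      ((ae_restrict_iff' hIm).2 (Eventually.of_forall hpt))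
    refine ⟨hfm, h1.trans_lt ?_⟩
    have h2 : ∀ n, eLpNorm (F (φ (ψ n))) 2 (volume.restrict I) ≤ ENNReal.ofReal √C := by
      intro n
      have e1 := norm_sq_toLp (hF (φ (ψ n))).1
      have e2 : ‖(hF (φ (ψ n))).1.toLp _‖ ≤ √C := Real.le_sqrt_of_sq_le (e1.trans_le (hC _))
      rw [Lp.norm_toLp] at e2
      rw [← ENNReal.ofReal_toReal (hF (φ (ψ n))).1.2.ne]
      exact ENNReal.ofReal_le_ofReal e2
    refine lt_of_le_of_lt (liminf_le_of_frequently_le' (Frequently.of_forall h2))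
      ENNReal.ofReal_lt_top
  obtain ⟨hf, hd⟩ := IsH1On.of_integral hI hfL hg hfg
  refine ⟨φ ∘ ψ, f, hφ.comp hψ, hf, hpt, fun k hk => ?_⟩
  have h1 := (hlim k hk).comp hψ.tendsto_atTop
  have h2 : ∫ x in I, k x * (starRingEnd ℂ) (g x) = ∫ x in I, k x * (starRingEnd ℂ) (deriv f x) :=
    integral_congr_ae (by filter_upwards [hd] with x hx; rw [hx])
  rw [h2] at h1
  exact h1

/-- Weak lower semicontinuity of the Dirichlet integral, in a form that can be added up. -/
theorem WeaklyTendsto.exists_minorant {I J : Set ℝ} (hJ : MeasurableSet J) (hJI : J ⊆ I)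
    {F : ℕ → ℝ → ℂ} {f : ℝ → ℂ} (hF : ∀ n, IsH1On I (F n)) (hf : IsH1On I f)
    (h : WeaklyTendsto I F f) :
    ∃ a : ℕ → ℝ, Tendsto a atTop (𝓝 (∫ x in J, ‖deriv f x‖ ^ 2)) ∧
      ∀ n, a n ≤ ∫ x in J, ‖deriv (F n) x‖ ^ 2 := by
  have hfJ := hf.2.1.mono_measure (Measure.restrict_mono hJI le_rfl)
  have hFJ := fun n => (hF n).2.1.mono_measure (Measure.restrict_mono hJI le_rfl)
  have h1 := h.2 (J.indicator (deriv f)) (hf.2.1.indicator hJ)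
  have h2 : ∀ k : ℝ → ℂ, ∫ x in I, J.indicator (deriv f) x * (starRingEnd ℂ) (k x) =
      ∫ x in J, deriv f x * (starRingEnd ℂ) (k x) := by
    intro k
    have : (fun x => J.indicator (deriv f) x * (starRingEnd ℂ) (k x)) =
        J.indicator fun x => deriv f x * (starRingEnd ℂ) (k x) := by
      ext x; by_cases hx : x ∈ J <;> simp [hx]
    rw [this, setIntegral_indicator hJ, inter_eq_right.2 hJI]
  simp only [h2] at h1
  have h3 := (Complex.continuous_re.tendsto _).comp h1
  have hself : (∫ x in J, deriv f x * (starRingEnd ℂ) (deriv f x)).re =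
      ∫ x in J, ‖deriv f x‖ ^ 2 := by
    have : ∀ x, deriv f x * (starRingEnd ℂ) (deriv f x) = ((‖deriv f x‖ ^ 2 : ℝ) : ℂ) := by
      intro x; rw [Complex.mul_conj, Complex.normSq_eq_norm_sq]
    simp only [this]
    rw [integral_complex_ofReal, Complex.ofReal_re]
  rw [hself] at h3
  -- Affine in the derivative of `F n`, hence convergent under weak convergence; a minorant because
  -- `‖deriv (F n) - deriv f‖ ^ 2 ≥ 0`.
  refine ⟨fun n => 2 * (∫ x in J, deriv f x * (starRingEnd ℂ) (deriv (F n) x)).re -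
    ∫ x in J, ‖deriv f x‖ ^ 2, ?_, fun n => ?_⟩
  · have := (h3.const_mul 2).sub_const (∫ x in J, ‖deriv f x‖ ^ 2)
    simp only [Function.comp_def] at this
    convert! this using 2
    ring
  · have hprod : Integrable (fun x => deriv f x * (starRingEnd ℂ) (deriv (F n) x))
        (volume.restrict J) := hfJ.integrable_mul (hFJ n).star
    have hre : (∫ x in J, deriv f x * (starRingEnd ℂ) (deriv (F n) x)).re =
        ∫ x in J, (deriv f x * (starRingEnd ℂ) (deriv (F n) x)).re := by
      have := integral_re hprod
      simpa using this.symm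
    beta_reduce
    rw [hre, sub_le_iff_le_add, ← integral_const_mul, ← integral_add (integrableOn_sq_norm (hFJ n))
      (integrableOn_sq_norm hfJ)]
    refine integral_mono (hprod.re.const_mul 2) ((integrableOn_sq_norm (hFJ n)).add
      (integrableOn_sq_norm hfJ)) fun x => ?_
    have e1 : (deriv f x * (starRingEnd ℂ) (deriv (F n) x)).re ≤
        ‖deriv f x‖ * ‖deriv (F n) x‖ := by
      refine (Complex.re_le_norm _).trans (by simp)
    have e2 : 2 * (‖deriv f x‖ * ‖deriv (F n) x‖) ≤ ‖deriv (F n) x‖ ^ 2 + ‖deriv f x‖ ^ 2 := by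
      nlinarith [sq_nonneg (‖deriv f x‖ - ‖deriv (F n) x‖)]
    simpa using (mul_le_mul_of_nonneg_left e1 zero_le_two).trans e2

theorem tendsto_integral_norm_pow {a b M : ℝ} {F : ℕ → ℝ → ℂ} {f : ℝ → ℂ}
    (hF : ∀ n, IsH1On (Icc a b) (F n))
    (hlim : ∀ x ∈ Icc a b, Tendsto (fun n => F n x) atTop (𝓝 (f x)))
    (hM : ∀ n, ∀ x ∈ Icc a b, ‖F n x‖ ≤ M) (k : ℕ) :
    Tendsto (fun n => ∫ x in Icc a b, ‖F n x‖ ^ k) atTop (𝓝 (∫ x in Icc a b, ‖f x‖ ^ k)) := by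
  refine tendsto_integral_of_dominated_convergence (fun _ => M ^ k)
    (fun n => ((hF n).1.1.norm.pow k)) (integrableOn_const (by simp)) (fun n => ?_) ?_
  · filter_upwards [ae_restrict_mem measurableSet_Icc] with x hx
    rw [Real.norm_eq_abs, abs_of_nonneg (by positivity)]
    exact pow_le_pow_left₀ (norm_nonneg _) (hM n x hx) k
  · filter_upwards [ae_restrict_mem measurableSet_Icc] with x hx
    exact (hlim x hx).norm.pow k

/-! ### Existence of ground states below the energy of the soliton -/

theorem edgeQ_split {ω : ℝ} {f : ℝ → ℂ} (hf : IsH1On (Ici 0) f) {R : ℝ} (hR : 0 ≤ R) :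
    edgeQ ω (Ici 0) f = edgeQ ω (Icc 0 R) f + edgeQ ω (Ici R) f := by
  have key : ∀ g : ℝ → ℝ, IntegrableOn g (Ici 0) →
      ∫ x in Ici 0, g x = (∫ x in Icc 0 R, g x) + ∫ x in Ici R, g x := by
    intro g hg
    rw [integral_Icc_eq_integral_Ico, ← setIntegral_union
      (by rw [Set.disjoint_left]; exact fun t ht ht' => absurd ht.2 (not_lt.2 ht'))
      measurableSet_Ici (hg.mono_set fun t ht => ht.1) (hg.mono_set (Ici_subset_Ici.2 hR)),
      Ico_union_Ici_eq_Ici hR]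
  rw [edgeQ, edgeQ, edgeQ, key _ (integrableOn_sq_norm hf.2.1), key _ (integrableOn_sq_norm hf.1)]
  ring

theorem edgeN_split {f : ℝ → ℂ} (hf : IsH1On (Ici 0) f) {R : ℝ} (hR : 0 ≤ R) :
    edgeN (Ici 0) f = edgeN (Icc 0 R) f + edgeN (Ici R) f := by
  have hg := hf.integrableOn_pow_four_Ici
  rw [edgeN, edgeN, edgeN, integral_Icc_eq_integral_Ico, ← setIntegral_union
      (by rw [Set.disjoint_left]; exact fun t ht ht' => absurd ht.2 (not_lt.2 ht'))
      measurableSet_Ici (hg.mono_set fun t ht => ht.1) (hg.mono_set (Ici_subset_Ici.2 hR)),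
      Ico_union_Ici_eq_Ici hR]

theorem tendsto_setIntegral_Icc {g : ℝ → ℝ} (hg : IntegrableOn g (Ici 0)) :
    Tendsto (fun R => ∫ x in Icc 0 R, g x) atTop (𝓝 (∫ x in Ici 0, g x)) := by
  have h1 := intervalIntegral_tendsto_integral_Ioi 0 (hg.mono_set Ioi_subset_Ici_self) tendsto_id
  rw [integral_Ici_eq_integral_Ioi]
  refine h1.congr' ?_
  filter_upwards [eventually_ge_atTop 0] with R hR
  rw [integral_Icc_eq_integral_Ioc, id, intervalIntegral.integral_of_le hR]

section LimitOfMinimizingSequence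

variable {ω γ L : ℝ} {V : ℕ → GraphFun} {v : GraphFun}

/-- Cutting at `R` splits the Nehari identity. On the loop and on `[0, R]` the terms without
derivatives converge, and the Dirichlet terms are lower semicontinuous. Beyond `R` the sequence has
less quartic energy than the soliton, so its share of `fullQ - fullN` is at least `-√ω * ‖(V n).h R‖
^ 2`. -/
theorem truncated_nehari_le (hω : 0 < ω) (hL : 0 < L)
    (hV : ∀ n, V n ∈ nehariManifold ω γ L) {m : ℝ}
    (hm : Tendsto (fun n => fullN L (V n)) atTop (𝓝 m)) (hm' : m < 16 / 3 * (ω * √ω))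
    {M : ℝ} (hMc : ∀ n, ∀ x ∈ Icc (-L) L, ‖(V n).c x‖ ≤ M) (hMh : ∀ n, ∀ x ∈ Ici 0, ‖(V n).h x‖ ≤ M)
    (hvc : IsH1On (Icc (-L) L) v.c) (hvh : IsH1On (Ici 0) v.h)
    (hc : WeaklyTendsto (Icc (-L) L) (fun n => (V n).c) v.c)
    (hh : WeaklyTendsto (Ici 0) (fun n => (V n).h) v.h) {R : ℝ} (hR : 0 ≤ R) :
    edgeQ ω (Icc (-L) L) v.c + edgeQ ω (Icc 0 R) v.h + γ * ‖v.h 0‖ ^ 2 -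
      (edgeN (Icc (-L) L) v.c + edgeN (Icc 0 R) v.h) ≤ √ω * ‖v.h R‖ ^ 2 := by
  have hVd := fun n => (hV n).1
  obtain ⟨a, ha, ha'⟩ := hc.exists_minorant measurableSet_Icc Subset.rfl
    (fun n => (hVd n).1) hvc
  obtain ⟨b, hb, hb'⟩ := hh.exists_minorant (J := Icc 0 R) measurableSet_Icc Icc_subset_Ici_self
    (fun n => (hVd n).2.1) hvh
  have hsub : Icc 0 R ⊆ Ici (0 : ℝ) := Icc_subset_Ici_self
  have c2 := tendsto_integral_norm_pow (fun n => (hVd n).1) hc.1 hMc 2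
  have c4 := tendsto_integral_norm_pow (fun n => (hVd n).1) hc.1 hMc 4
  have h2 := tendsto_integral_norm_pow (fun n => (hVd n).2.1.mono hsub)
    (fun x hx => hh.1 x (hsub hx)) (fun n x hx => hMh n x (hsub hx)) 2
  have h4 := tendsto_integral_norm_pow (fun n => (hVd n).2.1.mono hsub)
    (fun x hx => hh.1 x (hsub hx)) (fun n x hx => hMh n x (hsub hx)) 4
  have hlim := ((((ha.add (c2.const_mul ω)).add (hb.add (h2.const_mul ω))).add
    (((hh.1 0 self_mem_Ici).norm.pow 2).const_mul γ)).sub (c4.add h4))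
  have hlim2 := ((hh.1 R hR).norm.pow 2).const_mul (√ω)
  refine le_of_tendsto_of_tendsto hlim hlim2 ?_
  filter_upwards [hm.eventually_lt_const hm'] with n hn
  have e1 := ha' n
  have e2 := hb' n
  have e3 := ((mem_nehariManifold_iff hL).1 (hV n)).2.2
  have hT := edgeQ_split (ω := ω) (hVd n).2.1 hR
  have hN := edgeN_split (hVd n).2.1 hR
  have hH : IsH1On (Ici R) (V n).h := (hVd n).2.1.mono (Ici_subset_Ici.2 hR)
  have hgn := hH.gagliardo_nirenberg hω.le
  have hM0 := edgeN_nonneg (Ici R) (V n).h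
  have hM1 : edgeN (Ici R) (V n).h ≤ fullN L (V n) := by
    have := edgeN_nonneg (Icc (-L) L) (V n).c
    have := edgeN_nonneg (Icc 0 R) (V n).h
    rw [fullN, hN]; linarith
  have hT0 := edgeQ_nonneg hω.le (Ici R) (V n).h
  -- The tail energy is below `16 / 3 * (ω * √ω)`, so its square is at most that constant times
  -- itself, and Gagliardo–Nirenberg applies.
  have key : edgeN (Ici R) (V n).h ≤ edgeQ ω (Ici R) (V n).h + √ω * ‖(V n).h R‖ ^ 2 := by
    refine (pow_le_pow_iff_left₀ hM0 (by positivity) two_ne_zero).1 (le_trans ?_ hgn)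
    nlinarith
  rw [fullQ, fullN, hT, hN] at e3
  have d1 : edgeQ ω (Icc (-L) L) (V n).c = (∫ x in Icc (-L) L, ‖deriv (V n).c x‖ ^ 2) +
    ω * ∫ x in Icc (-L) L, ‖(V n).c x‖ ^ 2 := rfl
  have d2 : edgeQ ω (Icc 0 R) (V n).h = (∫ x in Icc 0 R, ‖deriv (V n).h x‖ ^ 2) +
    ω * ∫ x in Icc 0 R, ‖(V n).h x‖ ^ 2 := rfl
  have d3 : edgeN (Icc (-L) L) (V n).c = ∫ x in Icc (-L) L, ‖(V n).c x‖ ^ 4 := rfl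
  have d4 : edgeN (Icc 0 R) (V n).h = ∫ x in Icc 0 R, ‖(V n).h x‖ ^ 4 := rfl
  linarith

/-- The boundary term at `R` disappears as `R` grows, because the limit decays. -/
theorem limit_fullQ_le_fullN (hω : 0 < ω) (hL : 0 < L)
    (hV : ∀ n, V n ∈ nehariManifold ω γ L) {m : ℝ}
    (hm : Tendsto (fun n => fullN L (V n)) atTop (𝓝 m)) (hm' : m < 16 / 3 * (ω * √ω))
    {M : ℝ} (hMc : ∀ n, ∀ x ∈ Icc (-L) L, ‖(V n).c x‖ ≤ M) (hMh : ∀ n, ∀ x ∈ Ici 0, ‖(V n).h x‖ ≤ M)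
    (hvc : IsH1On (Icc (-L) L) v.c) (hvh : IsH1On (Ici 0) v.h)
    (hc : WeaklyTendsto (Icc (-L) L) (fun n => (V n).c) v.c)
    (hh : WeaklyTendsto (Ici 0) (fun n => (V n).h) v.h) :
    fullQ ω γ L v ≤ fullN L v := by
  have h1 := tendsto_setIntegral_Icc (integrableOn_sq_norm hvh.2.1)
  have h2 := tendsto_setIntegral_Icc (integrableOn_sq_norm hvh.1)
  have h3 := tendsto_setIntegral_Icc hvh.integrableOn_pow_four_Ici
  have h4 := (((h1.add (h2.const_mul ω)).const_add (edgeQ ω (Icc (-L) L) v.c)).add_const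
    (γ * ‖v.h 0‖ ^ 2)).sub (h3.const_add (edgeN (Icc (-L) L) v.c))
  have h5 := (hvh.tendsto_zero.norm.pow 2).const_mul (√ω)
  simp only [norm_zero, ne_eq, OfNat.ofNat_ne_zero, not_false_eq_true, zero_pow, mul_zero] at h5
  have h6 := le_of_tendsto_of_tendsto h4 h5 (by
    filter_upwards [eventually_ge_atTop 0] with R hR
    exact truncated_nehari_le hω hL hV hm hm' hMc hMh hvc hvh hc hh hR)
  have h7 : fullQ ω γ L v - fullN L v ≤ 0 := h6
  linarith

theorem limit_fullN_le (hV : ∀ n, V n ∈ nehariManifold ω γ L) {m : ℝ}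
    (hm : Tendsto (fun n => fullN L (V n)) atTop (𝓝 m))
    {M : ℝ} (hMc : ∀ n, ∀ x ∈ Icc (-L) L, ‖(V n).c x‖ ≤ M) (hMh : ∀ n, ∀ x ∈ Ici 0, ‖(V n).h x‖ ≤ M)
    (hvh : IsH1On (Ici 0) v.h)
    (hc : WeaklyTendsto (Icc (-L) L) (fun n => (V n).c) v.c)
    (hh : WeaklyTendsto (Ici 0) (fun n => (V n).h) v.h) : fullN L v ≤ m := by
  have hVd := fun n => (hV n).1
  have c4 := tendsto_integral_norm_pow (fun n => (hVd n).1) hc.1 hMc 4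
  have h3 := (tendsto_setIntegral_Icc hvh.integrableOn_pow_four_Ici).const_add
    (edgeN (Icc (-L) L) v.c)
  refine le_of_tendsto h3 ?_
  filter_upwards [eventually_ge_atTop 0] with R hR
  have hsub : Icc 0 R ⊆ Ici (0 : ℝ) := Icc_subset_Ici_self
  have h4 := tendsto_integral_norm_pow (fun n => (hVd n).2.1.mono hsub)
    (fun x hx => hh.1 x (hsub hx)) (fun n x hx => hMh n x (hsub hx)) 4
  refine le_of_tendsto_of_tendsto' (c4.add h4) hm fun n => ?_
  have := edgeN_nonneg (Ici R) (V n).h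
  rw [fullN, edgeN_split (hVd n).2.1 hR]
  simp only [edgeN] at this ⊢
  linarith

/-- If the limit vanished, all quartic energy would sit on the half-line with vertex value tending
to 0. Gagliardo–Nirenberg would then give `16 / 3 * (ω * √ω) * m ≤ m ^ 2`, which `0 < m < 16 / 3 *
(ω * √ω)` excludes. -/
theorem limit_fullN_pos (hω : 0 < ω) (hγ : 0 ≤ γ) (hL : 0 < L)
    (hV : ∀ n, V n ∈ nehariManifold ω γ L) {m : ℝ}
    (hm : Tendsto (fun n => fullN L (V n)) atTop (𝓝 m)) (hm0 : 0 < m)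
    (hm' : m < 16 / 3 * (ω * √ω))
    {M : ℝ} (hMc : ∀ n, ∀ x ∈ Icc (-L) L, ‖(V n).c x‖ ≤ M)
    (hv : v ∈ formDomain L)
    (hc : WeaklyTendsto (Icc (-L) L) (fun n => (V n).c) v.c)
    (hh : WeaklyTendsto (Ici 0) (fun n => (V n).h) v.h) : 0 < fullN L v := by
  by_contra hcon
  rw [fullN_pos_iff hL hv] at hcon
  simp only [GraphFun.Nonzero, not_or, not_exists, not_and, not_not] at hcon
  have hVd := fun n => (hV n).1
  have c4 := tendsto_integral_norm_pow (fun n => (hVd n).1) hc.1 hMc 4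
  have e0 : ∫ x in Icc (-L) L, ‖v.c x‖ ^ 4 = 0 :=
    setIntegral_eq_zero_of_forall_eq_zero fun x hx => by simp [hcon.1 x hx]
  rw [e0] at c4
  have h0 := ((hh.1 0 self_mem_Ici).norm.pow 2).const_mul (√ω)
  rw [hcon.2 0 self_mem_Ici] at h0
  simp only [norm_zero, ne_eq, OfNat.ofNat_ne_zero, not_false_eq_true, zero_pow, mul_zero] at h0
  have hl : Tendsto (fun n => 16 / 3 * (ω * √ω) * (fullN L (V n) -
      ∫ x in Icc (-L) L, ‖(V n).c x‖ ^ 4)) atTop (𝓝 (16 / 3 * (ω * √ω) * (m - 0))) :=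
    (hm.sub c4).const_mul _
  have hr := ((hm.add h0).pow 2)
  have := le_of_tendsto_of_tendsto' hl hr fun n => by
    have hgn := (hVd n).2.1.gagliardo_nirenberg hω.le
    have e3 := ((mem_nehariManifold_iff hL).1 (hV n)).2.2
    have e4 : fullN L (V n) - ∫ x in Icc (-L) L, ‖(V n).c x‖ ^ 4 = edgeN (Ici 0) (V n).h := by
      rw [fullN, edgeN]; ring
    rw [e4]
    refine hgn.trans (pow_le_pow_left₀ ?_ ?_ 2)
    · have := edgeQ_nonneg hω.le (Ici 0) (V n).h
      positivity
    · have k1 := edgeQ_nonneg hω.le (Icc (-L) L) (V n).c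
      have k2 : 0 ≤ γ * ‖(V n).h 0‖ ^ 2 := by positivity
      rw [← e3, fullQ]
      linarith
  nlinarith

end LimitOfMinimizingSequence

theorem exists_pos_le_fullN {ω γ L : ℝ} (hω : 0 < ω) (hγ : 0 ≤ γ) (hL : 0 < L) :
    ∃ δ : ℝ, 0 < δ ∧ ∀ v ∈ nehariManifold ω γ L, δ ≤ fullN L v := by
  have hs : 0 < √ω := Real.sqrt_pos.2 hω
  set K := (6 / √ω + 4 * L) / ω with hK
  have hKpos : 0 < K := by positivity
  refine ⟨1 / K, by positivity, fun v hv => ?_⟩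
  obtain ⟨hvd, hN, hQ⟩ := (mem_nehariManifold_iff hL).1 hv
  have := fullN_le hω hγ hL hvd
  rw [hQ, ← hK] at this
  rw [div_le_iff₀ hKpos]
  nlinarith

/-- If some function has non-positive Nehari functional and less quartic energy than the soliton on
the line, then an action ground state exists. -/
theorem exists_isActionGroundState {ω γ L : ℝ} (hω : 0 < ω) (hγ : 0 ≤ γ) (hL : 0 < L)
    {w : GraphFun} (hw : w ∈ formDomain L) (hwpos : 0 < fullN L w)
    (hwI : fullQ ω γ L w ≤ fullN L w) (hwN : fullN L w < 16 / 3 * (ω * √ω)) :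
    ∃ u, IsActionGroundState ω γ L u := by
  obtain ⟨δ, hδ, hδle⟩ := exists_pos_le_fullN hω hγ hL
  set S : Set ℝ := fullN L '' nehariManifold ω γ L
  have hbdd : BddBelow S := ⟨δ, by rintro _ ⟨v, hv, rfl⟩; exact hδle v hv⟩
  obtain ⟨t, ht, htN⟩ := exists_scale_mem_nehari hω hγ hL hw hwpos
  have hne : S.Nonempty := ⟨_, _, ht, rfl⟩
  set m := sInf S
  have hmle : ∀ v ∈ nehariManifold ω γ L, m ≤ fullN L v := fun v hv => csInf_le hbdd ⟨v, hv, rfl⟩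
  have hm0 : 0 < m := hδ.trans_le (le_csInf hne (by rintro _ ⟨v, hv, rfl⟩; exact hδle v hv))
  -- When `fullQ ≤ fullN`, projecting onto the Nehari manifold does not raise `fullN`.
  have hscale : ∀ v : GraphFun, 0 < fullN L v → fullQ ω γ L v ≤ fullN L v →
      fullQ ω γ L v ^ 2 / fullN L v ≤ fullN L v := fun v h1 h2 => by
    rw [div_le_iff₀ h1]
    have := fullQ_nonneg hω.le hγ L v
    nlinarith
  have hm' : m < 16 / 3 * (ω * √ω) :=
    ((hmle _ ht).trans (htN.trans_le (hscale w hwpos hwI))).trans_lt hwN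
  obtain ⟨s, -, hs, hsS⟩ := exists_seq_tendsto_sInf hne hbdd
  choose V hV hVs using hsS
  have hVlim : Tendsto (fun n => fullN L (V n)) atTop (𝓝 m) := by simpa only [hVs] using hs
  obtain ⟨B, hB⟩ := hVlim.bddAbove_range
  have hB' : ∀ n, fullQ ω γ L (V n) ≤ B := fun n => by
    rw [((mem_nehariManifold_iff hL).1 (hV n)).2.2]; exact hB ⟨n, rfl⟩
  have hVd := fun n => (hV n).1
  have hB0 : 0 ≤ B := (fullQ_nonneg hω.le hγ L (V 0)).trans (hB' 0)
  have hsω : 0 < √ω := Real.sqrt_pos.2 hω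
  set M := √((6 / √ω + 4 * L) * B)
  have hMc : ∀ n, ∀ x ∈ Icc (-L) L, ‖(V n).c x‖ ≤ M := fun n x hx =>
    Real.le_sqrt_of_sq_le (((sup_sq_le_fullQ hω hγ hL (hVd n)).1 x hx).trans
      (mul_le_mul_of_nonneg_left (hB' n) (by positivity)))
  have hMh : ∀ n, ∀ x ∈ Ici (0 : ℝ), ‖(V n).h x‖ ≤ M := fun n x hx =>
    Real.le_sqrt_of_sq_le (((sup_sq_le_fullQ hω hγ hL (hVd n)).2 x hx).trans
      (mul_le_mul_of_nonneg_left (hB' n) (by positivity)))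
  have hparts : ∀ n, edgeQ ω (Icc (-L) L) (V n).c ≤ B ∧ edgeQ ω (Ici 0) (V n).h ≤ B := fun n => by
    have h1 := edgeQ_nonneg hω.le (Icc (-L) L) (V n).c
    have h2 := edgeQ_nonneg hω.le (Ici 0) (V n).h
    have h3 : 0 ≤ γ * ‖(V n).h 0‖ ^ 2 := by positivity
    have h4 := hB' n
    rw [fullQ] at h4
    constructor <;> linarith
  have hsplit : ∀ (I : Set ℝ) (f : ℝ → ℂ), edgeQ ω I f ≤ B →
      (∫ x in I, ‖f x‖ ^ 2) ≤ B / ω + B + M ∧ (∫ x in I, ‖deriv f x‖ ^ 2) ≤ B / ω + B + M := by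
    intro I f hf
    have h1 : 0 ≤ ∫ x in I, ‖f x‖ ^ 2 := integral_nonneg fun _ => sq_nonneg _
    have h2 : 0 ≤ ∫ x in I, ‖deriv f x‖ ^ 2 := integral_nonneg fun _ => sq_nonneg _
    have h3 : 0 ≤ B / ω := by positivity
    have h4 : 0 ≤ M := Real.sqrt_nonneg _
    rw [edgeQ] at hf
    have h5 := mul_nonneg hω.le h1
    have h6 : (∫ x in I, ‖f x‖ ^ 2) ≤ B / ω := by rw [le_div_iff₀ hω]; linarith
    constructor <;> linarith
  have hMB : M ≤ B / ω + B + M := by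
    have : 0 ≤ B / ω := by positivity
    linarith
  -- The subsequence for the half-line is extracted from the one for the loop, so that both edges
  -- converge along `φ ∘ ψ`.
  obtain ⟨φ, fc, hφ, hfc, hc⟩ := exists_weaklyTendsto ordConnected_Icc
    (show -L ∈ Icc (-L) L from left_mem_Icc.2 (by linarith)) (fun n => (hVd n).1)
    (fun n => (hsplit _ _ (hparts n).1).1) (fun n => (hsplit _ _ (hparts n).1).2)
    (fun n => (hMc n _ (left_mem_Icc.2 (by linarith))).trans hMB)
  obtain ⟨ψ, fh, hψ, hfh, hh⟩ := exists_weaklyTendsto ordConnected_Ici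
    (show (0 : ℝ) ∈ Ici 0 from self_mem_Ici) (fun n => (hVd (φ n)).2.1)
    (fun n => (hsplit _ _ (hparts (φ n)).2).1) (fun n => (hsplit _ _ (hparts (φ n)).2).2)
    (fun n => (hMh (φ n) _ self_mem_Ici).trans hMB)
  have hc' := hc.comp hψ
  set v : GraphFun := ⟨fc, fh⟩
  have hlim := (hVlim.comp hφ.tendsto_atTop).comp hψ.tendsto_atTop
  have hL1 : L ∈ Icc (-L) L := right_mem_Icc.2 (by linarith)
  have hL2 : -L ∈ Icc (-L) L := left_mem_Icc.2 (by linarith)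
  have hv : v ∈ formDomain L := by
    refine ⟨hfc, hfh, ?_, ?_⟩
    · refine tendsto_nhds_unique (hc'.1 L hL1) ?_
      simpa only [(hVd _).2.2.1] using hc'.1 (-L) hL2
    · refine tendsto_nhds_unique (hc'.1 (-L) hL2) ?_
      simpa only [(hVd _).2.2.2] using hh.1 0 self_mem_Ici
  have hQN : fullQ ω γ L v ≤ fullN L v :=
    limit_fullQ_le_fullN (V := fun n => V (φ (ψ n))) hω hL (fun n => hV _) hlim hm'
      (fun n => hMc _) (fun n => hMh _) hfc hfh hc' hh
  have hNm : fullN L v ≤ m :=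
    limit_fullN_le (V := fun n => V (φ (ψ n))) (fun n => hV _) hlim (fun n => hMc _)
      (fun n => hMh _) hfh hc' hh
  have hN0 : 0 < fullN L v :=
    limit_fullN_pos (V := fun n => V (φ (ψ n))) hω hγ hL (fun n => hV _) hlim hm0 hm'
      (fun n => hMc _) hv hc' hh
  -- Since `fullQ ≤ fullN ≤ m` for the limit, its rescaling attains the infimum.
  obtain ⟨t, htm, htN⟩ := exists_scale_mem_nehari hω hγ hL hv hN0
  refine ⟨v.scale t, htm, fun z hz => ?_⟩
  change action ω γ L (v.scale t) ≤ action ω γ L z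
  rw [action_eq_of_mem htm, action_eq_of_mem hz, htN]
  have := hscale v hN0 hQN
  have := hmle z hz
  linarith

/-! ### The hyperbolic secant profile -/

theorem one_sub_tanh_sq (x : ℝ) : 1 - tanh x ^ 2 = 1 / cosh x ^ 2 := by
  have h := Real.cosh_sq x
  have hc := (Real.cosh_pos x).ne'
  rw [Real.tanh_eq_sinh_div_cosh]
  field_simp
  linarith

theorem hasDerivAt_tanh (x : ℝ) : HasDerivAt tanh (1 - tanh x ^ 2) x := by
  have h := (Real.hasDerivAt_sinh x).div (Real.hasDerivAt_cosh x) (Real.cosh_pos x).ne'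
  have hfun : tanh = fun x => sinh x / cosh x := funext Real.tanh_eq_sinh_div_cosh
  rw [one_sub_tanh_sq, hfun]
  convert! h using 1
  rw [show cosh x * cosh x - sinh x * sinh x = 1 by nlinarith [Real.cosh_sq x]]

theorem tendsto_tanh_atTop : Tendsto tanh atTop (𝓝 1) := by
  have h1 : ∀ x : ℝ, 1 - tanh x = exp (-x) / cosh x := fun x => by
    rw [Real.tanh_eq_sinh_div_cosh, ← Real.cosh_sub_sinh, sub_div,
      div_self (Real.cosh_pos x).ne']
  have h2 : Tendsto (fun x : ℝ => exp (-x) / cosh x) atTop (𝓝 0) :=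
    squeeze_zero (fun x => div_nonneg (exp_pos _).le (Real.cosh_pos x).le)
      (fun x => div_le_self (exp_pos _).le (Real.one_le_cosh x))
          (Real.tendsto_exp_neg_atTop_nhds_zero)
  have h3 := h2.const_sub 1
  simp only [← h1, sub_sub_cancel, sub_zero] at h3
  exact h3

theorem hasDerivAt_tanh_affine (s b x : ℝ) :
    HasDerivAt (fun x => tanh (s * x + b)) (s * (1 - tanh (s * x + b) ^ 2)) x := by
  have h := (hasDerivAt_tanh (s * x + b)).comp x (((hasDerivAt_id x).const_mul s).add_const b)
  convert! h using 1
  ring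

theorem tendsto_tanh_affine {s : ℝ} (hs : 0 < s) (b : ℝ) :
    Tendsto (fun x => tanh (s * x + b)) atTop (𝓝 1) :=
  tendsto_tanh_atTop.comp (tendsto_atTop_add_const_right _ b (tendsto_id.const_mul_atTop hs))

theorem profileSech_pos {ω : ℝ} (hω : 0 < ω) (b x : ℝ) : 0 < profileSech ω b x :=
  mul_pos (Real.sqrt_pos.2 (by linarith)) (one_div_pos.2 (Real.cosh_pos _))

theorem profileSech_sq {ω : ℝ} (hω : 0 < ω) (b x : ℝ) :
    profileSech ω b x ^ 2 = 2 * ω * (1 - tanh (√ω * x + b) ^ 2) := by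
  rw [profileSech, mul_pow, Real.sq_sqrt (by linarith), one_sub_tanh_sq, div_pow, one_pow]

theorem hasDerivAt_profileSech (ω b x : ℝ) :
    HasDerivAt (profileSech ω b) (-√ω * tanh (√ω * x + b) * profileSech ω b x) x := by
  have h0 : HasDerivAt (fun x : ℝ => √ω * x + b) √ω x := by
    simpa using ((hasDerivAt_id x).const_mul √ω).add_const b
  have h1 := ((Real.hasDerivAt_cosh (√ω * x + b)).comp x h0).inv
    (show (cosh ∘ fun x => √ω * x + b) x ≠ 0 from (Real.cosh_pos _).ne')
  have h2 := h1.const_mul √(2 * ω)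
  have hfun : profileSech ω b = fun x => √(2 * ω) * (cosh (√ω * x + b))⁻¹ := by
    ext y; rw [profileSech, one_div]
  have hc := (Real.cosh_pos (√ω * x + b)).ne'
  rw [profileSech, hfun, Real.tanh_eq_sinh_div_cosh]
  convert! h2 using 1
  simp only [Function.comp_apply]
  field_simp

theorem hasDerivAt_deriv_profileSech {ω : ℝ} (hω : 0 < ω) (b x : ℝ) :
    HasDerivAt (fun x => -√ω * tanh (√ω * x + b) * profileSech ω b x)
      (ω * profileSech ω b x - profileSech ω b x ^ 3) x := by
  have h := ((hasDerivAt_tanh_affine √ω b x).const_mul (-√ω)).mul (hasDerivAt_profileSech ω b x)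
  convert! h using 1
  have h2 := profileSech_sq hω b x
  have h3 : √ω ^ 2 = ω := Real.sq_sqrt hω.le
  calc ω * profileSech ω b x - profileSech ω b x ^ 3
      = profileSech ω b x * (ω - profileSech ω b x ^ 2) := by ring
    _ = profileSech ω b x * (√ω ^ 2 - 2 * √ω ^ 2 * (1 - tanh (√ω * x + b) ^ 2)) := by rw [h2, h3]
    _ = _ := by ring

/-- The hyperbolic secant profile as a complex-valued function. -/
def sechC (ω b : ℝ) (x : ℝ) : ℂ := (profileSech ω b x : ℂ)

theorem hasDerivAt_sechC (ω b x : ℝ) :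
    HasDerivAt (sechC ω b) ((-√ω * tanh (√ω * x + b) * profileSech ω b x : ℝ) : ℂ) x :=
  (hasDerivAt_profileSech ω b x).ofReal_comp

theorem norm_sechC_pow (ω b x : ℝ) (k : ℕ) (hk : Even k) :
    ‖sechC ω b x‖ ^ k = profileSech ω b x ^ k := by
  rw [sechC, Complex.norm_real, Real.norm_eq_abs, hk.pow_abs]

theorem norm_deriv_sechC_sq (ω b x : ℝ) :
    ‖deriv (sechC ω b) x‖ ^ 2 = √ω ^ 2 * tanh (√ω * x + b) ^ 2 * profileSech ω b x ^ 2 := by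
  rw [(hasDerivAt_sechC ω b x).deriv, Complex.norm_real, Real.norm_eq_abs, sq_abs]; ring

/-- The hyperbolic secant has finite mass, Dirichlet energy and quartic energy on half-lines. -/
theorem sech_integrals {ω : ℝ} (hω : 0 < ω) (b a : ℝ) :
    IsH1On (Ici a) (sechC ω b) ∧
    edgeQ ω (Ici a) (sechC ω b) = 2 * ω * √ω *
      (4 / 3 - (tanh (√ω * a + b) + tanh (√ω * a + b) ^ 3 / 3)) ∧
    edgeN (Ici a) (sechC ω b) = 4 * ω * √ω *
      (2 / 3 - (tanh (√ω * a + b) - tanh (√ω * a + b) ^ 3 / 3)) := by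
  have hs : 0 < √ω := Real.sqrt_pos.2 hω
  have hs2 : √ω ^ 2 = ω := Real.sq_sqrt hω.le
  have hT1 : ∀ x, 0 ≤ 1 - tanh (√ω * x + b) ^ 2 := fun x => by
    linarith [Real.tanh_sq_lt_one (√ω * x + b)]
  have hd := fun x => hasDerivAt_tanh_affine √ω b x
  have hT := tendsto_tanh_affine hs b
  -- With `T = tanh (√ω * x + b)`, each of the three densities is a polynomial in `T` times `T'`,
  -- which gives its antiderivative.
  have d1 : ∀ x ∈ Ici a, HasDerivAt (fun x => 2 * √ω * tanh (√ω * x + b))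
      (‖sechC ω b x‖ ^ 2) x := fun x _ => by
    convert! (hd x).const_mul (2 * √ω) using 1
    rw [norm_sechC_pow _ _ _ _ even_two, profileSech_sq hω, ← mul_assoc]
    rw [show 2 * √ω * √ω = 2 * √ω ^ 2 by ring, hs2]
  have d3 := fun x => (hd x).pow 3
  have d2 : ∀ x ∈ Ici a, HasDerivAt (fun x => 2 * ω * √ω * (tanh (√ω * x + b) ^ 3 / 3))
      (‖deriv (sechC ω b) x‖ ^ 2) x := fun x _ => by
    convert! ((d3 x).div_const 3).const_mul (2 * ω * √ω) using 1
    rw [norm_deriv_sechC_sq, profileSech_sq hω]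
    push_cast
    ring
  have d4 : ∀ x ∈ Ici a, HasDerivAt (fun x => 4 * ω * √ω * (tanh (√ω * x + b) -
      tanh (√ω * x + b) ^ 3 / 3)) (‖sechC ω b x‖ ^ 4) x := fun x _ => by
    convert! ((hd x).sub ((d3 x).div_const 3)).const_mul (4 * ω * √ω) using 1
    rw [norm_sechC_pow _ _ _ _ (by decide), show 4 = 2 * 2 from rfl, pow_mul, profileSech_sq hω]
    push_cast
    linear_combination (-4 * ω * (1 - tanh (√ω * x + b) ^ 2) ^ 2) * hs2
  have l1 := hT.const_mul (2 * √ω)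
  have l2 := ((hT.pow 3).div_const 3).const_mul (2 * ω * √ω)
  have l4 := (hT.sub ((hT.pow 3).div_const 3)).const_mul (4 * ω * √ω)
  have i1 := integrableOn_Ioi_deriv_of_nonneg' d1 (fun _ _ => by positivity) l1
  have i2 := integrableOn_Ioi_deriv_of_nonneg' d2 (fun _ _ => by positivity) l2
  have v1 := integral_Ioi_of_hasDerivAt_of_nonneg' d1 (fun _ _ => by positivity) l1
  have v2 := integral_Ioi_of_hasDerivAt_of_nonneg' d2 (fun _ _ => by positivity) l2
  have v4 := integral_Ioi_of_hasDerivAt_of_nonneg' d4 (fun _ _ => by positivity) l4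
  have hcont : Continuous (sechC ω b) :=
    continuous_iff_continuousAt.2 fun x => (hasDerivAt_sechC ω b x).continuousAt
  refine ⟨?_, ?_, ?_⟩
  · refine (IsH1On.of_hasDerivAt (s := ∅) ordConnected_Ici countable_empty hcont.continuousOn
      (fun x _ => ?_) ?_ ?_ (g := deriv (sechC ω b))).1
    · exact (hasDerivAt_sechC ω b x).differentiableAt.hasDerivAt
    · rw [memLp_two_iff_integrable_sq_norm hcont.aestronglyMeasurable]
      exact (integrableOn_Ici_iff_integrableOn_Ioi (by simp)).2 i1
    · rw [memLp_two_iff_integrable_sq_norm (measurable_deriv _).aestronglyMeasurable]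
      exact (integrableOn_Ici_iff_integrableOn_Ioi (by simp)).2 i2
  · rw [edgeQ, integral_Ici_eq_integral_Ioi, integral_Ici_eq_integral_Ioi, v1, v2]; ring
  · rw [edgeN, integral_Ici_eq_integral_Ioi, v4]; ring

/-- The half-line formulas at `-L` and at `L`, subtracted. -/
theorem sech_integrals_Icc {ω : ℝ} (hω : 0 < ω) {L : ℝ} (hL : 0 < L) :
    edgeQ ω (Icc (-L) L) (sechC ω 0) = 4 * ω * √ω * (tanh (√ω * L) + tanh (√ω * L) ^ 3 / 3) ∧
    edgeN (Icc (-L) L) (sechC ω 0) = 8 * ω * √ω * (tanh (√ω * L) - tanh (√ω * L) ^ 3 / 3) := by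
  obtain ⟨h1, q1, n1⟩ := sech_integrals hω 0 (-L)
  obtain ⟨-, q2, n2⟩ := sech_integrals hω 0 L
  have hsplit : ∀ g : ℝ → ℝ, IntegrableOn g (Ici (-L)) →
      ∫ x in Ici (-L), g x = (∫ x in Icc (-L) L, g x) + ∫ x in Ici L, g x := by
    intro g hg
    rw [integral_Icc_eq_integral_Ico, ← setIntegral_union
      (by rw [Set.disjoint_left]; exact fun t ht ht' => absurd ht.2 (not_lt.2 ht'))
      measurableSet_Ici (hg.mono_set fun t ht => ht.1)
      (hg.mono_set (Ici_subset_Ici.2 (by linarith))), Ico_union_Ici_eq_Ici (by linarith)]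
  have e1 := hsplit _ (integrableOn_sq_norm h1.1)
  have e2 := hsplit _ (integrableOn_sq_norm h1.2.1)
  have e3 := hsplit _ h1.integrableOn_pow_four_Ici
  have hneg : tanh (√ω * -L + 0) = -tanh (√ω * L + 0) := by
    rw [← Real.tanh_neg]; congr 1; ring
  rw [hneg] at q1 n1
  rw [add_zero] at q1 q2 n1 n2
  simp only [edgeQ, edgeN] at *
  constructor
  · rw [e1, e2] at q1; linarith
  · rw [e3] at n1; linarith

/-! ### Test functions below the energy of the soliton -/

/-- The test function is the line soliton on `[-L, ∞)`, with `[-L, L]` wrapped around the loop; the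
ends match because sech is even. With `τ = tanh (√ω * L)`, one finds `fullN - fullQ = 2ω (1 - τ²)(√ω
τ - γ)`, and `L ≥ LStarStar ω γ` says precisely `γ ≤ √ω τ`. The missing piece to the left of `-L`
keeps `fullN` below the soliton level. -/
theorem exists_groundState_of_LStarStar_le {ω γ L : ℝ} (hω : 0 < ω) (hγ : 0 < γ) (hγω : γ < √ω)
    (hL : 0 < L) (h : LStarStar ω γ ≤ L) : ∃ u, IsActionGroundState ω γ L u := by
  have hs : 0 < √ω := Real.sqrt_pos.2 hω
  have hs2 : √ω ^ 2 = ω := Real.sq_sqrt hω.le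
  set τ := tanh (√ω * L) with hτ
  have hτ1 : τ < 1 := Real.tanh_lt_one _
  have hg : γ / √ω ∈ Ioo (-1 : ℝ) 1 :=
    ⟨by have : 0 < γ / √ω := by positivity
        linarith, (div_lt_one hs).2 hγω⟩
  have hτγ : γ ≤ √ω * τ := by
    have h1 : artanh (γ / √ω) ≤ artanh τ := by
      rw [hτ, Real.artanh_tanh]
      rw [LStarStar, one_div, inv_mul_le_iff₀ hs] at h
      exact h
    have h2 := (Real.artanh_le_artanh_iff hg ⟨Real.neg_one_lt_tanh _, hτ1⟩).1 h1
    rwa [div_le_iff₀' hs] at h2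
  have hτ0 : 0 < τ := by
    by_contra hcon
    nlinarith
  obtain ⟨hH, qh, nh⟩ := sech_integrals hω (√ω * L) 0
  obtain ⟨hC, -, -⟩ := sech_integrals hω 0 (-L)
  obtain ⟨qc, nc⟩ := sech_integrals_Icc hω hL
  rw [mul_zero, zero_add, ← hτ] at qh nh
  rw [← hτ] at qc nc
  set w : GraphFun := ⟨sechC ω 0, sechC ω (√ω * L)⟩
  have hw : w ∈ formDomain L := by
    refine ⟨hC.mono Icc_subset_Ici_self, hH, ?_, ?_⟩
    · simp only [w, sechC, profileSech, add_zero, mul_neg, Real.cosh_neg]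
    · simp only [w, sechC, profileSech, add_zero, mul_neg, Real.cosh_neg, mul_zero, zero_add]
  have hv : ‖w.h 0‖ ^ 2 = 2 * ω * (1 - τ ^ 2) := by
    simp only [w]
    rw [norm_sechC_pow _ _ _ _ even_two, profileSech_sq hω, mul_zero, zero_add]
  have hQ : fullQ ω γ L w = 2 * ω * √ω * (4 / 3 + τ + τ ^ 3 / 3) + γ * (2 * ω * (1 - τ ^ 2)) := by
    rw [fullQ, hv, qc, qh]; ring
  have hN : fullN L w = 4 * ω * √ω * (2 / 3 + τ - τ ^ 3 / 3) := by
    rw [fullN, nc, nh]; ring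
  have hωs : 0 < ω * √ω := by positivity
  refine exists_isActionGroundState hω hγ.le hL hw ?_ ?_ ?_
  · rw [hN]
    have : 0 < 2 / 3 + τ - τ ^ 3 / 3 := by nlinarith [pow_pos hτ0 2]
    positivity
  · rw [hQ, hN]
    have h1 : 0 ≤ 2 * ω * ((1 - τ ^ 2) * (√ω * τ - γ)) := by
      have : 0 ≤ 1 - τ ^ 2 := by nlinarith
      have : 0 ≤ √ω * τ - γ := by linarith
      positivity
    nlinarith
  · rw [hN]
    -- The gap to the soliton: `4 / 3 - (2 / 3 + τ - τ ^ 3 / 3) = (1 - τ) ^ 2 * (2 + τ) / 3`.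
    have h1 : 0 < ω * √ω * ((1 - τ) ^ 2 * (2 + τ)) := by
      have : 0 < 1 - τ := by linarith
      positivity
    nlinarith

theorem LStarStar_pos {ω γ : ℝ} (hω : 0 < ω) (hγ : 0 < γ) (hγω : γ < √ω) : 0 < LStarStar ω γ := by
  have hs : 0 < √ω := Real.sqrt_pos.2 hω
  exact mul_pos (by positivity) (Real.artanh_pos ⟨by positivity, (div_lt_one hs).2 hγω⟩)

theorem cube_lt_of_lt {ω γ : ℝ} (hω : 0 < ω) (hγ : 0 < γ)
    (h : γ < (1 - √3 / 2) ^ (1 / 3 : ℝ) * √ω) : γ ^ 3 < (1 - √3 / 2) * (ω * √ω) := by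
  have h3 : √3 < 2 := by
    rw [show (2 : ℝ) = √4 by rw [show (4 : ℝ) = 2 ^ 2 by norm_num, Real.sqrt_sq zero_le_two]]
    exact Real.sqrt_lt_sqrt (by norm_num) (by norm_num)
  have h1 := pow_lt_pow_left₀ h hγ.le three_ne_zero
  have h2 : ((1 - √3 / 2) ^ (1 / 3 : ℝ)) ^ 3 = 1 - √3 / 2 := by
    rw [← Real.rpow_natCast, ← Real.rpow_mul (by linarith)]
    norm_num
  rw [mul_pow, h2] at h1
  have : √ω ^ 3 = ω * √ω := by
    rw [pow_succ, Real.sq_sqrt hω.le]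
  rwa [this] at h1

theorem rpow_three_half {ω : ℝ} (hω : 0 < ω) : ω ^ (3 / 2 : ℝ) = ω * √ω := by
  rw [show (3 / 2 : ℝ) = 1 + 1 / 2 by norm_num, Real.rpow_add hω, Real.rpow_one,
    Real.sqrt_eq_rpow]

theorem LStar_pos {ω γ : ℝ} (hω : 0 < ω) (hγ : 0 < γ)
    (h : γ < (1 - √3 / 2) ^ (1 / 3 : ℝ) * √ω) : 0 < LStar ω γ := by
  have h1 := cube_lt_of_lt hω hγ h
  rw [LStar, rpow_three_half hω]
  exact div_pos (by nlinarith) (by positivity)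

/-- The test function is `√ω` on the loop, where mass and quartic terms cancel, and a sech bump
starting at height `√ω` on the half-line. With `σ = √2 / 2`, one has `fullN - fullQ = ω (σ √ω - γ)`
whatever `L` is. Only two consequences of the hypotheses matter: `γ ≤ σ * √ω`, and `L * ω < √ω /
20`, which keeps `fullN` below the soliton level. -/
theorem exists_groundState_of_lt_LStar {ω γ L : ℝ} (hω : 0 < ω) (hγ : 0 < γ)
    (h : γ < (1 - √3 / 2) ^ (1 / 3 : ℝ) * √ω) (hL : 0 < L) (hLS : L < LStar ω γ) :
    ∃ u, IsActionGroundState ω γ L u := by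
  have hs : 0 < √ω := Real.sqrt_pos.2 hω
  have hs2 : √ω ^ 2 = ω := Real.sq_sqrt hω.le
  have h3 : (17 / 10 : ℝ) < √3 := Real.lt_sqrt_of_sq_lt (by norm_num)
  have h2l : (7 / 10 : ℝ) < √2 / 2 := by
    have : (14 / 10 : ℝ) < √2 := Real.lt_sqrt_of_sq_lt (by norm_num)
    linarith
  have h2u : √2 / 2 < 71 / 100 := by
    have : √2 < 142 / 100 := (Real.sqrt_lt' (by norm_num)).2 (by norm_num)
    linarith
  have h22 : (√2 / 2) ^ 2 = 1 / 2 := by rw [div_pow, Real.sq_sqrt zero_le_two]; norm_num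
  set σ := √2 / 2
  have hcube := cube_lt_of_lt hω hγ h
  have hγσ : γ ≤ σ * √ω := by
    have h5 : γ ^ 3 ≤ (σ * √ω) ^ 3 := by
      have e : (σ * √ω) ^ 3 = σ * (1 / 2) * (ω * √ω) := by
        rw [mul_pow, show σ ^ 3 = σ * σ ^ 2 by ring, h22, show √ω ^ 3 = √ω ^ 2 * √ω by ring, hs2]
      rw [e]
      -- Numerically `1 - √3 / 2 < 0.15`, while `σ ^ 3 = σ / 2 > 0.35`.
      refine hcube.le.trans (mul_le_mul_of_nonneg_right ?_ (by positivity))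
      linarith
    exact (pow_le_pow_iff_left₀ hγ.le (by positivity) three_ne_zero).1 h5
  have hLω : L * ω < √ω * (1 / 20) := by
    rw [LStar, rpow_three_half hω, lt_div_iff₀ (by positivity)] at hLS
    have e1 : L * (6 * ω ^ 2) < (2 - √3) * (ω * √ω) := by
      have : 0 < γ ^ 3 := by positivity
      linarith
    have e2 : (2 - √3) * (ω * √ω) ≤ 3 / 10 * (ω * √ω) :=
      mul_le_mul_of_nonneg_right (by linarith) (by positivity)
    have e3 : ω * (L * ω) < ω * (√ω * (1 / 20)) := by nlinarith
    exact lt_of_mul_lt_mul_left e3 hω.le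
  -- This phase gives the starting height `√(2ω (1 - σ²)) = √ω`, with the peak inside the half-line.
  set b := artanh (-σ)
  have hb : tanh b = -σ := Real.tanh_artanh ⟨by linarith, by linarith⟩
  obtain ⟨hH, qh, nh⟩ := sech_integrals hω b 0
  rw [mul_zero, zero_add, hb] at qh nh
  have hv0 : profileSech ω b 0 ^ 2 = ω := by
    rw [profileSech_sq hω, mul_zero, zero_add, hb, neg_sq, h22]; ring
  have hv1 : profileSech ω b 0 = √ω := by
    rw [← Real.sqrt_sq (profileSech_pos hω b 0).le, hv0]
  set w : GraphFun := ⟨fun _ => (√ω : ℂ), sechC ω b⟩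
  have hconst : IsH1On (Icc (-L) L) (fun _ => (√ω : ℂ)) :=
    (IsH1On.of_hasDerivAt (s := ∅) (g := fun _ => 0) ordConnected_Icc countable_empty
      continuousOn_const (fun x _ => hasDerivAt_const x _) (memLp_const _) (memLp_const _)).1
  have hw : w ∈ formDomain L := by
    refine ⟨hconst, hH, rfl, ?_⟩
    simp only [w, sechC, hv1]
  have hn : ‖(√ω : ℂ)‖ ^ 2 = ω := by
    rw [Complex.norm_real, Real.norm_eq_abs, sq_abs, hs2]
  have hv : ‖w.h 0‖ ^ 2 = ω := by
    simp only [w, sechC, hv1, hn]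
  have qc : edgeQ ω (Icc (-L) L) w.c = 2 * L * ω ^ 2 := by
    have : L - -L = 2 * L := by ring
    simp [w, edgeQ, -Complex.norm_real, hn, this, hL.le]
    ring
  have nc : edgeN (Icc (-L) L) w.c = 2 * L * ω ^ 2 := by
    have : L - -L = 2 * L := by ring
    have hn4 : ‖(√ω : ℂ)‖ ^ 4 = ω ^ 2 := by rw [show 4 = 2 * 2 from rfl, pow_mul, hn]
    simp [w, edgeN, -Complex.norm_real, hn4, this, hL.le]
  have hQ : fullQ ω γ L w =
      2 * L * ω ^ 2 + 2 * ω * √ω * (4 / 3 + σ + σ * (1 / 2) / 3) + γ * ω := by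
    rw [fullQ, hv, qc, qh, ← h22]; ring
  have hN : fullN L w = 2 * L * ω ^ 2 + 4 * ω * √ω * (2 / 3 + σ - σ * (1 / 2) / 3) := by
    change edgeN (Icc (-L) L) w.c + edgeN (Ici 0) w.h = _
    rw [nc, nh, ← h22]; ring
  refine exists_isActionGroundState hω hγ.le hL hw ?_ ?_ ?_
  · rw [hN]
    have : 0 < 2 / 3 + σ - σ * (1 / 2) / 3 := by linarith
    positivity
  · rw [hQ, hN]
    nlinarith
  · rw [hN]
    have e1 : ω * (L * ω) < ω * (√ω * (1 / 20)) := mul_lt_mul_of_pos_left hLω hω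
    have e2 : ω * √ω * σ < ω * √ω * (71 / 100) := mul_lt_mul_of_pos_left h2u (by positivity)
    nlinarith

/-! ### The first variation -/

/-- The polarisation of `edgeQ`. -/
def edgeB (ω : ℝ) (I : Set ℝ) (g f : ℝ → ℂ) : ℝ :=
  (∫ x in I, inner ℝ (deriv g x) (deriv f x)) + ω * ∫ x in I, inner ℝ (g x) (f x)

/-- A quarter of the derivative of `edgeN` at `f` in direction `g`. -/
def edgeT (I : Set ℝ) (g f : ℝ → ℂ) : ℝ := ∫ x in I, ‖f x‖ ^ 2 * inner ℝ (g x) (f x)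

theorem integrable_inner_of_memLp {I : Set ℝ} {f g : ℝ → ℂ} (hf : MemLp f 2 (volume.restrict I))
    (hg : MemLp g 2 (volume.restrict I)) :
    Integrable (fun x => inner ℝ (g x) (f x)) (volume.restrict I) := by
  refine Integrable.mono' ((integrableOn_sq_norm hg).add (integrableOn_sq_norm hf))
    (hg.1.inner hf.1) (Eventually.of_forall fun x => ?_)
  refine (norm_inner_le_norm _ _).trans ?_
  simp only [Pi.add_apply]
  nlinarith [sq_nonneg (‖g x‖ - ‖f x‖), norm_nonneg (g x), norm_nonneg (f x)]

theorem norm_add_mul_sq (z w : ℂ) (s : ℝ) :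
    ‖z + s * w‖ ^ 2 = ‖z‖ ^ 2 + 2 * s * inner ℝ w z + s ^ 2 * ‖w‖ ^ 2 := by
  have h : (s : ℂ) * w = s • w := by simp
  rw [h, norm_add_sq_real, norm_smul, real_inner_smul_right, mul_pow, Real.norm_eq_abs, sq_abs,
    real_inner_comm]
  ring

theorem IsH1On.add_mul {I : Set ℝ} (hI : I.OrdConnected) {f g : ℝ → ℂ} (hf : IsH1On I f)
    (hg : IsH1On I g) (s : ℂ) : IsH1On I (fun x => f x + s * g x) ∧
      deriv (fun x => f x + s * g x) =ᵐ[volume.restrict I] fun x => deriv f x + s * deriv g x := by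
  obtain ⟨h1, h2⟩ := hg.const_mul hI s
  obtain ⟨h3, h4⟩ := hf.add hI h1
  refine ⟨h3, ?_⟩
  filter_upwards [h2, h4] with x hx hy
  rw [hy, hx]

theorem integral_norm_add_mul_sq {I : Set ℝ} {f g : ℝ → ℂ} (hf : MemLp f 2 (volume.restrict I))
    (hg : MemLp g 2 (volume.restrict I)) (s : ℝ) :
    ∫ x in I, ‖f x + s * g x‖ ^ 2 = (∫ x in I, ‖f x‖ ^ 2) +
      2 * s * (∫ x in I, inner ℝ (g x) (f x)) + s ^ 2 * ∫ x in I, ‖g x‖ ^ 2 := by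
  simp only [norm_add_mul_sq]
  have i1 := integrableOn_sq_norm hf
  have i2 := (integrable_inner_of_memLp hf hg).const_mul (2 * s)
  have i3 := (integrableOn_sq_norm hg).const_mul (s ^ 2)
  have e1 := integral_add (i1.add i2) i3
  have e2 := integral_add i1 i2
  simp only [Pi.add_apply] at e1
  rw [e1, e2, integral_const_mul, integral_const_mul]

theorem edgeQ_add_mul {ω : ℝ} {I : Set ℝ} (hI : I.OrdConnected) {f g : ℝ → ℂ} (hf : IsH1On I f)
    (hg : IsH1On I g) (s : ℝ) : edgeQ ω I (fun x => f x + s * g x) =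
      edgeQ ω I f + 2 * s * edgeB ω I g f + s ^ 2 * edgeQ ω I g := by
  have h1 : ∫ x in I, ‖deriv (fun x => f x + s * g x) x‖ ^ 2 =
      ∫ x in I, ‖deriv f x + s * deriv g x‖ ^ 2 :=
    integral_congr_ae (by filter_upwards [(hf.add_mul hI hg s).2] with x hx; rw [hx])
  rw [edgeQ, h1, integral_norm_add_mul_sq hf.1 hg.1, integral_norm_add_mul_sq hf.2.1 hg.2.1,
    edgeQ, edgeQ, edgeB]
  ring

theorem integrable_edgeT {I : Set ℝ} {f g : ℝ → ℂ}
    (hfm : AEStronglyMeasurable f (volume.restrict I))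
    (hgm : AEStronglyMeasurable g (volume.restrict I)) (hf : IntegrableOn (fun x => ‖f x‖ ^ 4) I)
    (hg : IntegrableOn (fun x => ‖g x‖ ^ 4) I) :
    IntegrableOn (fun x => ‖f x‖ ^ 2 * inner ℝ (g x) (f x)) I := by
  refine Integrable.mono' (hf.add hg) ((hfm.norm.pow 2).mul (hgm.inner hfm))
    (Eventually.of_forall fun x => ?_)
  have h1 : |inner ℝ (g x) (f x)| ≤ ‖g x‖ * ‖f x‖ := abs_real_inner_le_norm _ _
  simp only [Pi.add_apply, Real.norm_eq_abs, abs_mul, abs_pow, abs_norm]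
  have h2 : ‖f x‖ ^ 2 * |inner ℝ (g x) (f x)| ≤ ‖f x‖ ^ 2 * (‖g x‖ * ‖f x‖) :=
    mul_le_mul_of_nonneg_left h1 (by positivity)
  have h3 : ‖g x‖ * ‖f x‖ ≤ (‖f x‖ ^ 2 + ‖g x‖ ^ 2) / 2 := by
    nlinarith [sq_nonneg (‖g x‖ - ‖f x‖)]
  have h4 : ‖f x‖ ^ 2 * (‖g x‖ * ‖f x‖) ≤ ‖f x‖ ^ 2 * ((‖f x‖ ^ 2 + ‖g x‖ ^ 2) / 2) :=
    mul_le_mul_of_nonneg_left h3 (by positivity)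
  nlinarith [sq_nonneg (‖f x‖ ^ 2 - ‖g x‖ ^ 2), sq_nonneg (‖f x‖ ^ 2), sq_nonneg (‖g x‖ ^ 2)]

/-- Convexity of the fourth power. The tangent at `f` is all that the first variation needs, so the
higher-order terms are dropped. -/
theorem edgeN_add_mul_ge {I : Set ℝ} {f g : ℝ → ℂ}
    (hfm : AEStronglyMeasurable f (volume.restrict I))
    (hgm : AEStronglyMeasurable g (volume.restrict I)) (hf : IntegrableOn (fun x => ‖f x‖ ^ 4) I)
    (hg : IntegrableOn (fun x => ‖g x‖ ^ 4) I) (s : ℝ)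
    (hfg : IntegrableOn (fun x => ‖f x + s * g x‖ ^ 4) I) :
    edgeN I f + 4 * s * edgeT I g f ≤ edgeN I (fun x => f x + s * g x) := by
  have i1 := (integrable_edgeT hfm hgm hf hg).const_mul (4 * s)
  rw [edgeN, edgeN, edgeT, ← integral_const_mul, ← integral_add hf i1]
  refine integral_mono (hf.add i1) hfg fun x => ?_
  have h1 : ‖f x + s * g x‖ ^ 4 = (‖f x + s * g x‖ ^ 2) ^ 2 := by ring
  simp only [h1, norm_add_mul_sq]
  nlinarith [sq_nonneg (2 * s * inner ℝ (g x) (f x) + s ^ 2 * ‖g x‖ ^ 2),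
    mul_nonneg (sq_nonneg ‖f x‖) (mul_nonneg (sq_nonneg s) (sq_nonneg ‖g x‖))]

/-- A minimizer of the scale-invariant quotient `fullQ² / fullN`, normalised to lie on the Nehari
manifold. -/
structure IsNormalizedMinimizer (ω γ L : ℝ) (u : GraphFun) : Prop where
  mem : u ∈ formDomain L
  pos : 0 < fullN L u
  eq : fullQ ω γ L u = fullN L u
  le : ∀ v ∈ formDomain L, fullN L u * fullN L v ≤ fullQ ω γ L v ^ 2

/-- Rescaling trades the constraint for an inequality on the whole linear space, so that no Lagrange
multiplier appears later. -/
theorem IsActionGroundState.isNormalizedMinimizer {ω γ L : ℝ} (hω : 0 < ω) (hγ : 0 ≤ γ)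
    (hL : 0 < L) {u : GraphFun} (hu : IsActionGroundState ω γ L u) :
    IsNormalizedMinimizer ω γ L u := by
  obtain ⟨h1, h2, h3⟩ := (mem_nehariManifold_iff hL).1 hu.1
  refine ⟨h1, h2, h3, fun v hv => ?_⟩
  rcases (fullN_nonneg L v).eq_or_lt with h0 | hpos
  · rw [← h0, mul_zero]; positivity
  · obtain ⟨t, ht, htN⟩ := exists_scale_mem_nehari hω hγ hL hv hpos
    have h4 : action ω γ L u ≤ action ω γ L (v.scale t) := hu.2 ht
    rw [action_eq_of_mem hu.1, action_eq_of_mem ht, htN] at h4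
    have h5 : fullN L u ≤ fullQ ω γ L v ^ 2 / fullN L v := by linarith
    rwa [le_div_iff₀ hpos] at h5

theorem eq_zero_of_polynomial_nonneg {a b c d : ℝ}
    (h : ∀ s : ℝ, 0 ≤ a * s + b * s ^ 2 + c * s ^ 3 + d * s ^ 4) : a = 0 := by
  have hmin : IsLocalMin (fun s : ℝ => a * s + b * s ^ 2 + c * s ^ 3 + d * s ^ 4) 0 :=
    Eventually.of_forall fun s => by simpa using h s
  have hd : HasDerivAt (fun s : ℝ => a * s + b * s ^ 2 + c * s ^ 3 + d * s ^ 4) a 0 := by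
    have := ((((hasDerivAt_id (0 : ℝ)).const_mul a).add
        ((hasDerivAt_pow 2 (0 : ℝ)).const_mul b)).add
      ((hasDerivAt_pow 3 (0 : ℝ)).const_mul c)).add ((hasDerivAt_pow 4 (0 : ℝ)).const_mul d)
    convert! this using 1
    simp
  exact hmin.hasDerivAt_eq_zero hd

/-- The weak form of the Euler–Lagrange equation. -/
theorem IsNormalizedMinimizer.weak_equation {ω γ L : ℝ} {u : GraphFun}
    (hu : IsNormalizedMinimizer ω γ L u) {v : GraphFun} (hv : v ∈ formDomain L) :
    edgeB ω (Icc (-L) L) v.c u.c + edgeB ω (Ici 0) v.h u.h + γ * inner ℝ (v.h 0) (u.h 0) =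
      edgeT (Icc (-L) L) v.c u.c + edgeT (Ici 0) v.h u.h := by
  obtain ⟨hum, hpos, heq, hle⟩ := hu
  set B := edgeB ω (Icc (-L) L) v.c u.c + edgeB ω (Ici 0) v.h u.h + γ * inner ℝ (v.h 0) (u.h 0)
    with hB
  set T := edgeT (Icc (-L) L) v.c u.c + edgeT (Ici 0) v.h u.h with hT
  set m := fullN L u with hm
  set q := fullQ ω γ L v with hq
  -- `fullQ` is exactly quadratic in `s` and `fullN` lies above its tangent, so minimality becomes a
  -- polynomial inequality with equality at `s = 0`.
  have key : ∀ s : ℝ, m * (m + 4 * s * T) ≤ (m + 2 * s * B + s ^ 2 * q) ^ 2 := by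
    intro s
    set w : GraphFun := ⟨fun x => u.c x + s * v.c x, fun x => u.h x + s * v.h x⟩
    have hwc := (hum.1.add_mul ordConnected_Icc hv.1 s).1
    have hwh := (hum.2.1.add_mul ordConnected_Ici hv.2.1 s).1
    have hw : w ∈ formDomain L :=
      ⟨hwc, hwh, by simp only [w, hum.2.2.1, hv.2.2.1], by simp only [w, hum.2.2.2, hv.2.2.2]⟩
    have hQ : fullQ ω γ L w = m + 2 * s * B + s ^ 2 * q := by
      simp only [fullQ, w, edgeQ_add_mul ordConnected_Icc hum.1 hv.1,
        edgeQ_add_mul ordConnected_Ici hum.2.1 hv.2.1, norm_add_mul_sq, hB, hq]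
      rw [← heq, fullQ]; ring
    have hN : m + 4 * s * T ≤ fullN L w := by
      have e1 := edgeN_add_mul_ge hum.1.1.1 hv.1.1.1 hum.1.integrableOn_pow_four_Icc
        hv.1.integrableOn_pow_four_Icc s hwc.integrableOn_pow_four_Icc
      have e2 := edgeN_add_mul_ge hum.2.1.1.1 hv.2.1.1.1 hum.2.1.integrableOn_pow_four_Ici
        hv.2.1.integrableOn_pow_four_Ici s hwh.integrableOn_pow_four_Ici
      simp only [hm, fullN, w, hT]
      linarith
    rw [← hQ]
    exact (mul_le_mul_of_nonneg_left hN hpos.le).trans (hle w hw)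
  have h0 : 4 * m * (B - T) = 0 := by
    refine eq_zero_of_polynomial_nonneg (b := 4 * B ^ 2 + 2 * m * q) (c := 4 * B * q) (d := q ^ 2)
      fun s => ?_
    have := key s
    nlinarith
  have : B - T = 0 := by
    rcases mul_eq_zero.1 h0 with h | h
    · linarith
    · exact h
  linarith

/-! ### From the weak to the classical equation -/

/-- The right-hand side of the stationary equation. -/
def nls (ω : ℝ) (z : ℂ) : ℂ := ω * z - (‖z‖ ^ 2 : ℝ) * z

theorem continuous_nls (ω : ℝ) : Continuous (nls ω) := by unfold nls; fun_prop

theorem edgeB_sub_edgeT {ω : ℝ} {I : Set ℝ} {f g : ℝ → ℂ} (hf : IsH1On I f) (hg : IsH1On I g)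
    (hf4 : IntegrableOn (fun x => ‖f x‖ ^ 4) I) (hg4 : IntegrableOn (fun x => ‖g x‖ ^ 4) I) :
    edgeB ω I g f - edgeT I g f =
      (∫ x in I, inner ℝ (deriv g x) (deriv f x)) + ∫ x in I, inner ℝ (g x) (nls ω (f x)) := by
  have i1 := (integrable_inner_of_memLp hf.1 hg.1).const_mul ω
  have i2 := integrable_edgeT hf.1.1 hg.1.1 hf4 hg4
  have : ∀ x, inner ℝ (g x) (nls ω (f x)) =
      ω * inner ℝ (g x) (f x) - ‖f x‖ ^ 2 * inner ℝ (g x) (f x) := by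
    intro x
    have h : nls ω (f x) = ω • f x - (‖f x‖ ^ 2) • f x := by simp [nls]
    rw [h, inner_sub_right, real_inner_smul_right, real_inner_smul_right]
  simp only [this]
  rw [integral_sub i1 i2, edgeB, edgeT, integral_const_mul]
  ring

/-- The function that is `1` up to `y`, affine on `[y, b]`, and `0` from `b` on. -/
def ramp (y b x : ℝ) : ℝ := max 0 (min 1 ((b - x) / (b - y)))

theorem ramp_of_le {y b x : ℝ} (hyb : y < b) (hx : x ≤ y) : ramp y b x = 1 := by
  have : 1 ≤ (b - x) / (b - y) := by rw [le_div_iff₀ (by linarith)]; linarith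
  rw [ramp, min_eq_left this, max_eq_right zero_le_one]

theorem ramp_of_ge {y b x : ℝ} (hyb : y < b) (hx : b ≤ x) : ramp y b x = 0 := by
  have : (b - x) / (b - y) ≤ 0 := div_nonpos_of_nonpos_of_nonneg (by linarith) (by linarith)
  rw [ramp, min_eq_right (by linarith), max_eq_left this]

theorem ramp_of_mem {y b x : ℝ} (hyb : y < b) (hx : x ∈ Icc y b) :
    ramp y b x = (b - x) / (b - y) := by
  have h1 : (b - x) / (b - y) ≤ 1 := by rw [div_le_one (by linarith)]; linarith [hx.1]
  have h2 : 0 ≤ (b - x) / (b - y) := div_nonneg (by linarith [hx.2]) (by linarith)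
  rw [ramp, min_eq_right h1, max_eq_right h2]

theorem continuous_ramp (y b : ℝ) : Continuous (ramp y b) := by unfold ramp; fun_prop

theorem ramp_mem_Icc (y b x : ℝ) : ramp y b x ∈ Icc (0 : ℝ) 1 :=
  ⟨le_max_left _ _, max_le zero_le_one (min_le_left _ _)⟩

theorem hasDerivAt_ramp {y b x : ℝ} (hyb : y < b) (hx : x ∉ ({y, b} : Set ℝ)) :
    HasDerivAt (ramp y b) ((Ioo y b).indicator (fun _ => -1 / (b - y)) x) x := by
  simp only [mem_insert_iff, mem_singleton_iff, not_or] at hx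
  rcases lt_or_gt_of_ne hx.1 with h1 | h1
  · rw [indicator_of_notMem (fun h => absurd h.1 (not_lt.2 h1.le))]
    refine (hasDerivAt_const x (1 : ℝ)).congr_of_eventuallyEq ?_
    filter_upwards [isOpen_Iio.mem_nhds h1] with t ht using ramp_of_le hyb (le_of_lt ht)
  · rcases lt_or_gt_of_ne hx.2 with h2 | h2
    · rw [indicator_of_mem (show x ∈ Ioo y b from ⟨h1, h2⟩)]
      have h3 : HasDerivAt (fun t => (b - t) / (b - y)) (-1 / (b - y)) x :=
        ((hasDerivAt_id x).const_sub b).div_const (b - y)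
      refine h3.congr_of_eventuallyEq ?_
      filter_upwards [isOpen_Ioo.mem_nhds (show x ∈ Ioo y b from ⟨h1, h2⟩)] with t ht
        using ramp_of_mem hyb (Ioo_subset_Icc_self ht)
    · rw [indicator_of_notMem (fun h => absurd h.2 (not_lt.2 h2.le))]
      refine (hasDerivAt_const x (0 : ℝ)).congr_of_eventuallyEq ?_
      filter_upwards [isOpen_Ioi.mem_nhds h2] with t ht using ramp_of_ge hyb (le_of_lt ht)

/-- Bounded functions that vanish off a compact interval are square integrable. -/
theorem memLp_two_of_bounded {I : Set ℝ} (hI : MeasurableSet I) {a b C : ℝ} {g : ℝ → ℂ}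
    (hg : AEStronglyMeasurable g (volume.restrict I)) (hC : ∀ x, ‖g x‖ ≤ C)
    (h0 : ∀ x ∈ I, x ∉ Icc a b → g x = 0) : MemLp g 2 (volume.restrict I) := by
  have h1 : MemLp ((Icc a b).indicator fun _ => C) 2 (volume.restrict I) :=
    memLp_indicator_const 2 measurableSet_Icc C (Or.inr (by
      rw [Measure.restrict_apply measurableSet_Icc]
      exact ((measure_mono inter_subset_left).trans_lt measure_Icc_lt_top).ne))
  refine h1.of_le hg ((ae_restrict_iff' hI).2 (Eventually.of_forall fun x hx => ?_))
  by_cases h : x ∈ Icc a b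
  · rw [indicator_of_mem h]; exact (hC x).trans (le_abs_self C)
  · rw [h0 x hx h, indicator_of_notMem h, norm_zero, norm_zero]

theorem isH1On_ramp {I : Set ℝ} (hI : I.OrdConnected) {a y b : ℝ} (hyb : y < b)
    (hIa : I ⊆ Ici a) (ζ : ℂ) :
    IsH1On I (fun x => ramp y b x • ζ) ∧ deriv (fun x => ramp y b x • ζ) =ᵐ[volume.restrict I]
      fun x => ((Ioo y b).indicator (fun _ => -1 / (b - y)) x : ℝ) • ζ := by
  have hIm := hI.measurableSet
  have hbd : ∀ x, ‖ramp y b x • ζ‖ ≤ ‖ζ‖ := fun x => by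
    rw [norm_smul, Real.norm_eq_abs, abs_of_nonneg (ramp_mem_Icc y b x).1]
    exact mul_le_of_le_one_left (norm_nonneg _) (ramp_mem_Icc y b x).2
  have hcont : Continuous fun x => ramp y b x • ζ := (continuous_ramp y b).smul continuous_const
  refine IsH1On.of_hasDerivAt (s := {y, b}) hI (by simp) hcont.continuousOn
    (fun x hx => (hasDerivAt_ramp hyb hx.2).smul_const ζ) ?_ ?_
  · refine memLp_two_of_bounded (a := a) (b := b) hIm hcont.aestronglyMeasurable hbd fun x hx h =>
      ?_
    rw [ramp_of_ge hyb, zero_smul]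
    by_contra hcon
    exact h ⟨hIa hx, (not_le.1 hcon).le⟩
  · refine memLp_two_of_bounded (a := y) (b := b) (C := |(-1 / (b - y))| * ‖ζ‖) hIm
      (((measurable_const.indicator measurableSet_Ioo).smul_const ζ).aestronglyMeasurable)
      (fun x => ?_) fun x hx h => ?_
    · by_cases h : x ∈ Ioo y b
      · rw [indicator_of_mem h, norm_smul, Real.norm_eq_abs]
      · rw [indicator_of_notMem h, zero_smul, norm_zero]; positivity
    · rw [indicator_of_notMem (fun h' => h (Ioo_subset_Icc_self h')), zero_smul]

/-- The action of the derivative of a ramp. -/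
theorem integral_inner_deriv_ramp {I : Set ℝ} (hI : I.OrdConnected) {a y b : ℝ} (hyb : y < b)
    (hIa : I ⊆ Ici a) (ζ : ℂ) {f : ℝ → ℂ} (hf : IsH1On I f) (hy : y ∈ I) (hb : b ∈ I) :
    ∫ x in I, inner ℝ (deriv (fun x => ramp y b x • ζ) x) (deriv f x) =
      -1 / (b - y) * inner ℝ ζ (f b - f y) := by
  have hsub : Ioo y b ⊆ I := Ioo_subset_Icc_self.trans (hI.out hy hb)
  have h1 : ∫ x in I, inner ℝ (deriv (fun x => ramp y b x • ζ) x) (deriv f x) =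
      ∫ x in I, (Ioo y b).indicator (fun x => -1 / (b - y) * inner ℝ ζ (deriv f x)) x := by
    refine integral_congr_ae ?_
    filter_upwards [(isH1On_ramp hI hyb hIa ζ).2] with x hx
    rw [hx, real_inner_smul_left]
    by_cases h : x ∈ Ioo y b <;> simp [h]
  have hint : IntervalIntegrable (deriv f) volume y b :=
    intervalIntegrable_of_memLp_two hI hf.2.1 hy hb
  rw [h1, setIntegral_indicator measurableSet_Ioo, inter_eq_right.2 hsub, integral_const_mul,
    integral_inner ((intervalIntegrable_iff_integrableOn_Ioo_of_le hyb.le).1 hint),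
        hf.2.2 y hy b hb,
    intervalIntegral.integral_of_le hyb.le, integral_Ioc_eq_integral_Ioo]

/-- Integration by parts: the ramp is affine on `[y, b]`, so the integral sees only the first and
second primitives of `H`. -/
theorem integral_inner_ramp_nls {H : ℝ → ℂ} (hH : Continuous H) {y b : ℝ} (hyb : y < b) (ζ : ℂ)
    {P Φ : ℝ → ℂ} (hP : ∀ x, HasDerivAt P (H x) x) (hΦ : ∀ x, HasDerivAt Φ (P x) x) :
    ∫ x in y..b, inner ℝ (ramp y b x • ζ) (H x) =
      1 / (b - y) * inner ℝ ζ (Φ b - Φ y - (b - y) • P y) := by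
  have h1 : ∀ x, HasDerivAt (fun x => (b - x) • P x + Φ x) ((b - x) • H x) x := fun x => by
    have := (((hasDerivAt_id x).const_sub b).smul (hP x)).add (hΦ x)
    convert! this using 1
    simp
  have h2 : ∫ x in y..b, (b - x) • H x = Φ b - Φ y - (b - y) • P y := by
    rw [intervalIntegral.integral_eq_sub_of_hasDerivAt (fun x _ => h1 x)
      (Continuous.intervalIntegrable (by fun_prop) _ _)]
    simp only [sub_self, zero_smul]
    ring
  have h3 : ∫ x in y..b, inner ℝ (ramp y b x • ζ) (H x) =
      ∫ x in y..b, 1 / (b - y) * inner ℝ ζ ((b - x) • H x) := by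
    refine intervalIntegral.integral_congr fun x hx => ?_
    rw [uIcc_of_le hyb.le] at hx
    simp only [ramp_of_mem hyb hx]
    rw [real_inner_smul_left, real_inner_smul_right]; ring
  have h4 : IntegrableOn (fun x => (b - x) • H x) (Ioc y b) :=
    (intervalIntegrable_iff_integrableOn_Ioc_of_le hyb.le).1
      (Continuous.intervalIntegrable (by fun_prop) _ _)
  rw [h3, intervalIntegral.integral_const_mul, ← h2, intervalIntegral.integral_of_le hyb.le,
    intervalIntegral.integral_of_le hyb.le, integral_inner h4]

theorem integral_inner_one_sub_ramp {H : ℝ → ℂ} (hH : Continuous H) {a y : ℝ} (hay : a < y) (ζ : ℂ)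
    {P Φ : ℝ → ℂ} (hP : ∀ x, HasDerivAt P (H x) x) (hΦ : ∀ x, HasDerivAt Φ (P x) x) :
    ∫ x in a..y, inner ℝ ((1 - ramp a y x) • ζ) (H x) =
      1 / (y - a) * inner ℝ ζ ((y - a) • P y - (Φ y - Φ a)) := by
  have h1 : ∫ x in a..y, H x = P y - P a :=
    intervalIntegral.integral_eq_sub_of_hasDerivAt (fun x _ => hP x) (hH.intervalIntegrable _ _)
  have h2 : IntegrableOn H (Ioc a y) :=
    (intervalIntegrable_iff_integrableOn_Ioc_of_le hay.le).1 (hH.intervalIntegrable _ _)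
  have h3 : ∫ x in a..y, inner ℝ ζ (H x) = inner ℝ ζ (P y - P a) := by
    rw [← h1, intervalIntegral.integral_of_le hay.le, intervalIntegral.integral_of_le hay.le,
      integral_inner h2]
  have hr := continuous_ramp a y
  have h4 : ∀ x, inner ℝ ((1 - ramp a y x) • ζ) (H x) =
      inner ℝ ζ (H x) - inner ℝ (ramp a y x • ζ) (H x) := fun x => by
    rw [← inner_sub_left, sub_smul, one_smul]
  simp only [h4]
  rw [intervalIntegral.integral_sub (Continuous.intervalIntegrable (by fun_prop) _ _)
    (Continuous.intervalIntegrable (by fun_prop) _ _), h3,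
    integral_inner_ramp_nls hH hay ζ hP hΦ]
  have : (y - a) ≠ 0 := by linarith
  rw [inner_sub_right ζ (P y), inner_sub_right ζ ((y - a) • P y), inner_sub_right ζ (Φ y - Φ a),
    real_inner_smul_right, real_inner_smul_right]
  field_simp
  ring

/-- A tent function, as a test function on an edge. -/
def tent (a y b : ℝ) (ζ : ℂ) (x : ℝ) : ℂ := ramp y b x • ζ + (-1 : ℝ) * ramp a y x • ζ

theorem isH1On_tent {I : Set ℝ} (hI : I.OrdConnected) {a y b : ℝ} (hay : a < y) (hyb : y < b)
    (hIa : I ⊆ Ici a) (ζ : ℂ) : IsH1On I (tent a y b ζ) :=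
  ((isH1On_ramp hI hyb hIa ζ).1.add_mul hI (isH1On_ramp hI hay hIa ζ).1 _).1

theorem tent_of_le {a y b : ℝ} (hay : a < y) (hyb : y < b) (ζ : ℂ) {x : ℝ} (hx : x ≤ a) :
    tent a y b ζ x = 0 := by
  rw [tent, ramp_of_le hyb (by linarith), ramp_of_le hay hx]; simp

theorem tent_of_ge {a y b : ℝ} (hay : a < y) (hyb : y < b) (ζ : ℂ) {x : ℝ} (hx : b ≤ x) :
    tent a y b ζ x = 0 := by
  rw [tent, ramp_of_ge hyb hx, ramp_of_ge hay (by linarith)]; simp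

/-- A function that solves the weak equation against all tents is a classical solution. -/
theorem exists_classical_of_tents {ω : ℝ} {I : Set ℝ} (hI : I.OrdConnected) {a : ℝ} (ha : a ∈ I)
    (hIa : I ⊆ Ici a) {b₀ : ℝ} (hb₀ : b₀ ∈ I) (hab₀ : a < b₀) {r : ℝ → ℝ} (hr : Continuous r)
    (hrI : ∀ x, r x ∈ I) (hrid : ∀ x ∈ I, r x = x) {f : ℝ → ℂ} (hf : IsH1On I f)
    (hf4 : IntegrableOn (fun x => ‖f x‖ ^ 4) I)
    (hweak : ∀ y ∈ I, ∀ b ∈ I, a < y → y < b → ∀ ζ,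
      edgeB ω I (tent a y b ζ) f = edgeT I (tent a y b ζ) f) :
    ∃ f₁ g : ℝ → ℂ, EqOn f f₁ I ∧ (∀ x, HasDerivAt f₁ (g x) x) ∧
      ∀ x, HasDerivAt g (nls ω (f₁ (r x))) x := by
  have hIm := hI.measurableSet
  -- The retraction `r` onto `I` extends the right-hand side continuously to the line, so that the
  -- solution has two-sided derivatives at the end points of `I` as well.
  set H : ℝ → ℂ := fun x => nls ω (f (r x))
  have hH : Continuous H := (continuous_nls ω).comp
    ((hf.continuousOn hI).comp_continuous hr hrI)
  set P : ℝ → ℂ := fun x => ∫ t in a..x, H t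
  have hP : ∀ x, HasDerivAt P (H x) x := fun x => hH.integral_hasStrictDerivAt a x |>.hasDerivAt
  have hPc : Continuous P := continuous_iff_continuousAt.2 fun x => (hP x).continuousAt
  set Φ : ℝ → ℂ := fun x => ∫ t in a..x, P t
  have hΦ : ∀ x, HasDerivAt Φ (P x) x := fun x => hPc.integral_hasStrictDerivAt a x |>.hasDerivAt
  have hΦa : Φ a = 0 := by simp [Φ]
  -- `D` compares `f` with a second primitive of its right-hand side. Tents show that its slopes
  -- over `[a, y]` and `[y, b]` agree, hence that `D` is linear in `x - a`.
  set D : ℝ → ℂ := fun x => f x - f a - Φ x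
  have key : ∀ y ∈ I, ∀ b ∈ I, a < y → y < b → (b - a) • D y = (y - a) • D b := by
    intro y hy b hb hay hyb
    have hz : ∀ ζ, inner ℝ ζ ((1 / (y - a)) • D y - (1 / (b - y)) • (D b - D y)) = 0 := by
      intro ζ
      have hη := isH1On_tent hI hay hyb hIa ζ
      have hηsupp : ∀ x ∈ I, x ∉ Icc a b → tent a y b ζ x = 0 := fun x hx h =>
        tent_of_ge hay hyb ζ (by by_contra hcon; exact h ⟨hIa hx, (not_le.1 hcon).le⟩)
      have hη4 : IntegrableOn (fun x => ‖tent a y b ζ x‖ ^ 4) I := by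
        obtain ⟨C, hC⟩ := isCompact_Icc.exists_bound_of_continuousOn
          ((hη.continuousOn hI).mono (hI.out ha hb))
        refine integrableOn_norm_pow_four hIm hη.1 (C := C) fun x hx => ?_
        by_cases h : x ∈ Icc a b
        · exact hC x h
        · rw [hηsupp x hx h, norm_zero]
          exact (norm_nonneg _).trans (hC a (left_mem_Icc.2 (by linarith)))
      have h0 := edgeB_sub_edgeT (ω := ω) hf hη hf4 hη4
      rw [hweak y hy b hb hay hyb ζ, sub_self] at h0
      have h1 : ∫ x in I, inner ℝ (deriv (tent a y b ζ) x) (deriv f x) =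
          -1 / (b - y) * inner ℝ ζ (f b - f y) + 1 / (y - a) * inner ℝ ζ (f y - f a) := by
        have hr1 := isH1On_ramp hI hyb hIa ζ
        have hr2 := isH1On_ramp hI hay hIa ζ
        have e : ∫ x in I, inner ℝ (deriv (tent a y b ζ) x) (deriv f x) =
            ∫ x in I, (inner ℝ (deriv (fun x => ramp y b x • ζ) x) (deriv f x) -
              inner ℝ (deriv (fun x => ramp a y x • ζ) x) (deriv f x)) := by
          refine integral_congr_ae ?_
          filter_upwards [(hr1.1.add_mul hI hr2.1 (-1 : ℝ)).2] with x hx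
          have hx' : deriv (tent a y b ζ) x = deriv (fun x => ramp y b x • ζ) x -
              deriv (fun x => ramp a y x • ζ) x := by
            refine Eq.trans hx ?_
            push_cast; ring
          rw [hx', inner_sub_left]
        rw [e, integral_sub (integrable_inner_of_memLp hf.2.1 hr1.1.2.1)
          (integrable_inner_of_memLp hf.2.1 hr2.1.2.1),
          integral_inner_deriv_ramp hI hyb hIa ζ hf hy hb,
          integral_inner_deriv_ramp hI hay hIa ζ hf ha hy]
        ring
      have h2 : ∫ x in I, inner ℝ (tent a y b ζ x) (nls ω (f x)) =
          1 / (b - y) * inner ℝ ζ (Φ b - Φ y - (b - y) • P y) +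
            1 / (y - a) * inner ℝ ζ ((y - a) • P y - (Φ y - Φ a)) := by
        have hcont : Continuous fun x => inner ℝ (tent a y b ζ x) (H x) := by
          have h1 := continuous_ramp y b
          have h2 := continuous_ramp a y
          unfold tent; fun_prop
        have e1 : ∫ x in I, inner ℝ (tent a y b ζ x) (nls ω (f x)) =
            ∫ x in I, (Ioc a b).indicator (fun x => inner ℝ (tent a y b ζ x) (H x)) x := by
          refine setIntegral_congr_fun hIm fun x hx => ?_
          by_cases h : x ∈ Ioc a b
          · simp only [indicator_of_mem h, H, hrid x hx]
          · rw [indicator_of_notMem h]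
            have : tent a y b ζ x = 0 := by
              rcases (show a ≤ x from hIa hx).eq_or_lt with h' | h'
              · exact tent_of_le hay hyb ζ h'.ge
              · exact tent_of_ge hay hyb ζ (by
                  by_contra hcon; exact h ⟨h', (not_le.1 hcon).le⟩)
            simp only [this, inner_zero_left]
        have hsub : Ioc a b ⊆ I := Ioc_subset_Icc_self.trans (hI.out ha hb)
        rw [e1, setIntegral_indicator measurableSet_Ioc, inter_eq_right.2 hsub,
          ← intervalIntegral.integral_of_le (by linarith),
          ← intervalIntegral.integral_add_adjacent_intervals (b := y)
            (hcont.intervalIntegrable _ _) (hcont.intervalIntegrable _ _),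
          ← integral_inner_ramp_nls hH hyb ζ hP hΦ, ← integral_inner_one_sub_ramp hH hay ζ hP hΦ,
          add_comm]
        congr 1
        · refine intervalIntegral.integral_congr fun x hx => ?_
          rw [uIcc_of_le hyb.le] at hx
          simp only [tent, ramp_of_ge hay hx.1, zero_smul, mul_zero, add_zero]
        · refine intervalIntegral.integral_congr fun x hx => ?_
          rw [uIcc_of_le hay.le] at hx
          simp only [tent, ramp_of_le hyb hx.2]
          congr 1
          push_cast
          rw [sub_smul]; ring
      rw [h1, h2, hΦa] at h0
      have hy0 : y - a ≠ 0 := by linarith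
      have hb0 : b - y ≠ 0 := by linarith
      simp only [D, inner_sub_right, real_inner_smul_right, inner_zero_right] at h0 ⊢
      rw [h0]
      field_simp
      ring
    have h3 := inner_self_eq_zero.1 (hz _)
    have hy0 : ((y - a : ℝ) : ℂ) ≠ 0 := by
      rw [Complex.ofReal_ne_zero]; linarith
    have hb0 : ((b - y : ℝ) : ℂ) ≠ 0 := by
      rw [Complex.ofReal_ne_zero]; linarith
    simp only [Complex.real_smul] at h3 ⊢
    push_cast at h3 hy0 hb0 ⊢
    field_simp at h3
    linear_combination h3
  set κ : ℂ := (1 / (b₀ - a)) • D b₀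
  have hD : ∀ x ∈ I, D x = (x - a) • κ := by
    intro x hx
    have hb0 : b₀ - a ≠ 0 := by linarith
    have hax : a ≤ x := hIa hx
    rcases hax.eq_or_lt with h | hlt
    · rw [← h]; simp [D, hΦa]
    · have hx0 : x - a ≠ 0 := by linarith
      have h4 : (b₀ - a) • D x = (x - a) • D b₀ := by
        rcases lt_trichotomy x b₀ with h | h | h
        · exact key x hx b₀ hb₀ hlt h
        · rw [h]
        · exact (key b₀ hb₀ x hx hab₀ h).symm
      rw [show κ = (1 / (b₀ - a)) • D b₀ from rfl, smul_comm, ← h4, smul_smul,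
        one_div_mul_cancel hb0, one_smul]
  have hEq : EqOn f (fun x => f a + Φ x + (x - a) • κ) I := fun x hx => by
    simp only [← hD x hx, D]; ring
  refine ⟨fun x => f a + Φ x + (x - a) • κ, fun x => P x + κ, hEq, fun x => ?_, fun x => ?_⟩
  · have h1 : HasDerivAt (fun x : ℝ => (x - a) • κ) ((1 : ℝ) • κ) x :=
      ((hasDerivAt_id x).sub_const a).smul_const κ
    rw [one_smul] at h1
    exact ((hΦ x).const_add _).add h1
  · have h1 := (hP x).add_const κ
    rw [← hEq (hrI x)]
    exact h1

/-- The Euler–Lagrange equations of a minimizer: both edges extend to functions on the line that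
solve the stationary equation on the edge, and the derivatives satisfy the `δ`-condition. -/
theorem IsNormalizedMinimizer.euler_lagrange {ω γ L : ℝ} (hL : 0 < L) {u : GraphFun}
    (hu : IsNormalizedMinimizer ω γ L u) :
    ∃ f g F G : ℝ → ℂ, EqOn u.c f (Icc (-L) L) ∧ EqOn u.h F (Ici 0) ∧
      (∀ x, HasDerivAt f (g x) x) ∧ (∀ x, HasDerivAt F (G x) x) ∧
      (∀ x ∈ Icc (-L) L, HasDerivAt g (nls ω (f x)) x) ∧
      (∀ x ∈ Ici 0, HasDerivAt G (nls ω (F x)) x) ∧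
      g (-L) - g L + G 0 = γ * u.h 0 := by
  have hum := hu.mem
  have hzero : ∀ (I : Set ℝ) (f : ℝ → ℂ), edgeB ω I (fun _ => 0) f = 0 ∧
      edgeT I (fun _ => 0) f = 0 := fun I f => by
    simp [edgeB, edgeT]
  have hzc : ∀ (I : Set ℝ) (hI : I.OrdConnected), IsH1On I (fun _ => (0 : ℂ)) := fun I hI =>
    (IsH1On.of_hasDerivAt (s := ∅) (g := fun _ => 0) hI countable_empty
      continuousOn_const (fun x _ => hasDerivAt_const x _) (MemLp.zero') (MemLp.zero')).1
  have hLL : -L ∈ Icc (-L) L := left_mem_Icc.2 (by linarith)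
  have hLR : L ∈ Icc (-L) L := right_mem_Icc.2 (by linarith)
  obtain ⟨f, g, hf, hfg, hgc⟩ :=
      exists_classical_of_tents (ω := ω) (r := fun x => max (-L) (min x L))
    ordConnected_Icc hLL Icc_subset_Ici_self hLR (by linarith) (by fun_prop)
    (fun x => ⟨le_max_left _ _, max_le (by linarith) (min_le_right _ _)⟩)
    (fun x hx => by rw [min_eq_left hx.2, max_eq_right hx.1]) hum.1 hum.1.integrableOn_pow_four_Icc
    -- A tent vanishes at the vertex, so its extension by 0 to the other edge lies in the form
    -- domain.
    (fun y hy b hb h1 h2 ζ => by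
      have hw := hu.weak_equation (v := ⟨tent (-L) y b ζ, fun _ => 0⟩)
        ⟨isH1On_tent ordConnected_Icc h1 h2 Icc_subset_Ici_self ζ, hzc _ ordConnected_Ici, by
          change tent (-L) y b ζ L = tent (-L) y b ζ (-L)
          rw [tent_of_le h1 h2 ζ le_rfl, tent_of_ge h1 h2 ζ hb.2], by
          change tent (-L) y b ζ (-L) = 0
          exact tent_of_le h1 h2 ζ le_rfl⟩
      simpa [(hzero _ _).1, (hzero _ _).2] using hw)
  obtain ⟨F, G, hF, hFG, hGc⟩ := exists_classical_of_tents (ω := ω) (r := fun x => max 0 x)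
    ordConnected_Ici (show (0 : ℝ) ∈ Ici 0 from self_mem_Ici) Subset.rfl
    (mem_Ici.2 (zero_le_one (α := ℝ))) zero_lt_one (by fun_prop)
    (fun x => mem_Ici.2 (le_max_left _ _)) (fun x hx => max_eq_right hx) hum.2.1
    hum.2.1.integrableOn_pow_four_Ici
    (fun y hy b hb h1 h2 ζ => by
      have hw := hu.weak_equation (v := ⟨fun _ => 0, tent 0 y b ζ⟩)
        ⟨hzc _ ordConnected_Icc, isH1On_tent ordConnected_Ici h1 h2 Subset.rfl ζ, rfl,
          (tent_of_le h1 h2 ζ le_rfl).symm⟩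
      simpa [(hzero _ _).1, (hzero _ _).2, tent_of_le h1 h2 ζ le_rfl] using hw)
  have hgd : ∀ x ∈ Icc (-L) L, HasDerivAt g (nls ω (f x)) x := fun x hx => by
    have := hgc x
    rwa [min_eq_left hx.2, max_eq_right hx.1] at this
  have hGd : ∀ x ∈ Ici (0 : ℝ), HasDerivAt G (nls ω (F x)) x := fun x hx => by
    have := hGc x
    rwa [max_eq_right hx] at this
  refine ⟨f, g, F, G, hf, hF, hfg, hFG, hgd, hGd, ?_⟩
  -- The test function is `ζ` on the loop and falls linearly from `ζ` to 0 over `[0, 1]`. The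
  -- equation already holds on both edges, so only vertex terms survive.
  have hz : ∀ ζ : ℂ, inner ℝ ζ (g (-L) - g L + G 0 - γ * u.h 0) = 0 := by
    intro ζ
    have hone : IsH1On (Icc (-L) L) (fun _ => ζ) :=
      (IsH1On.of_hasDerivAt (s := ∅) (g := fun _ => 0) ordConnected_Icc countable_empty
        continuousOn_const (fun x _ => hasDerivAt_const x _) (memLp_const _) (memLp_const _)).1
    have hrp := isH1On_ramp ordConnected_Ici zero_lt_one (Subset.refl (Ici (0 : ℝ))) ζ
    have hw := hu.weak_equation (v := ⟨fun _ => ζ, fun x => ramp 0 1 x • ζ⟩)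
      ⟨hone, hrp.1, rfl, by
        change ζ = ramp 0 1 0 • ζ
        rw [ramp_of_le zero_lt_one le_rfl, one_smul]⟩
    have e1 := edgeB_sub_edgeT (ω := ω) hum.1 hone hum.1.integrableOn_pow_four_Icc
      hone.integrableOn_pow_four_Icc
    have e2 := edgeB_sub_edgeT (ω := ω) hum.2.1 hrp.1 hum.2.1.integrableOn_pow_four_Ici
      hrp.1.integrableOn_pow_four_Ici
    rw [integral_inner_deriv_ramp ordConnected_Ici zero_lt_one Subset.rfl ζ hum.2.1 self_mem_Ici
      (mem_Ici.2 (zero_le_one (α := ℝ)))] at e2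
    have e3 : ∫ x in Icc (-L) L, inner ℝ ζ (nls ω (u.c x)) = inner ℝ ζ (g L - g (-L)) := by
      have hcont : ContinuousOn (fun x => nls ω (f x)) (Icc (-L) L) :=
        ((continuous_nls ω).comp (continuous_iff_continuousAt.2
          fun x => (hfg x).continuousAt)).continuousOn
      have hi : IntervalIntegrable (fun x => nls ω (f x)) volume (-L) L :=
        ContinuousOn.intervalIntegrable (by rwa [uIcc_of_le (by linarith)])
      rw [← intervalIntegral.integral_eq_sub_of_hasDerivAt (fun x hx => hgd x (by
          rwa [uIcc_of_le (by linarith)] at hx)) hi, intervalIntegral.integral_of_le (by linarith),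
        ← integral_Icc_eq_integral_Ioc, ← integral_inner hcont.integrableOn_Icc]
      exact setIntegral_congr_fun measurableSet_Icc fun x hx => by simp only [hf hx]
    have e4 : ∫ x in Ici 0, inner ℝ (ramp 0 1 x • ζ) (nls ω (u.h x)) =
        1 / (1 - 0) * inner ℝ ζ (F 1 - F 0 - ((1 : ℝ) - 0) • G 0) := by
      have hFc : Continuous F := continuous_iff_continuousAt.2 fun x => (hFG x).continuousAt
      have hHc : Continuous fun x => nls ω (F (max 0 x)) :=
        (continuous_nls ω).comp (hFc.comp (by fun_prop))
      rw [← integral_inner_ramp_nls hHc zero_lt_one ζ hGc hFG,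
        intervalIntegral.integral_of_le zero_le_one]
      have hs : Ioc (0 : ℝ) 1 ⊆ Ici 0 := fun x hx => hx.1.le
      have h5 : ∫ x in Ici 0, inner ℝ (ramp 0 1 x • ζ) (nls ω (u.h x)) =
          ∫ x in Ioi 0, (Ioc 0 1).indicator
            (fun x => inner ℝ (ramp 0 1 x • ζ) (nls ω (F (max 0 x)))) x := by
        rw [integral_Ici_eq_integral_Ioi]
        refine setIntegral_congr_fun measurableSet_Ioi fun x hx => ?_
        by_cases h : x ∈ Ioc (0 : ℝ) 1
        · simp only [indicator_of_mem h, max_eq_right h.1.le, hF (show x ∈ Ici 0 from h.1.le)]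
        · rw [indicator_of_notMem h]
          have : ramp 0 1 x = 0 := ramp_of_ge zero_lt_one (by
            by_contra hcon; exact h ⟨hx, (not_le.1 hcon).le⟩)
          simp only [this, zero_smul, inner_zero_left]
      rw [h5, setIntegral_indicator measurableSet_Ioc, inter_eq_right.2 fun x hx => hx.1]
    rw [e3] at e1
    rw [e4] at e2
    have e5 : (ramp 0 1 0 • ζ) = ζ := by rw [ramp_of_le zero_lt_one le_rfl, one_smul]
    have hd0 : deriv (fun _ : ℝ => ζ) = fun _ => 0 := by ext x; exact deriv_const x ζ
    simp only [e5, hd0, inner_zero_left, integral_zero, zero_add] at hw e1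
    have e6 : (γ : ℂ) * u.h 0 = γ • u.h 0 := by simp
    rw [hF (mem_Ici.2 (zero_le_one (α := ℝ))), hF self_mem_Ici] at e2
    simp only [sub_zero, one_smul, div_one, one_mul, inner_sub_right] at e2
    rw [e6]
    simp only [inner_sub_right, inner_add_right, real_inner_smul_right] at e1 ⊢
    linarith
  have := inner_self_eq_zero.1 (hz _)
  exact sub_eq_zero.1 this

/-! ### Real solutions of the stationary equation -/

/-- `φ`, with derivative `φ'`, solves `-φ'' + ω φ - φ³ = 0` on `I`. -/
structure SolvesNLS (ω : ℝ) (I : Set ℝ) (φ φ' : ℝ → ℝ) : Prop where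
  hasDerivAt : ∀ x, HasDerivAt φ (φ' x) x
  hasDerivAt' : ∀ x ∈ I, HasDerivAt φ' (ω * φ x - φ x ^ 3) x

theorem SolvesNLS.mono {ω : ℝ} {I J : Set ℝ} {φ φ' : ℝ → ℝ} (h : SolvesNLS ω I φ φ')
    (hJ : J ⊆ I) : SolvesNLS ω J φ φ' :=
  ⟨h.1, fun x hx => h.2 x (hJ hx)⟩

theorem SolvesNLS.continuous {ω : ℝ} {I : Set ℝ} {φ φ' : ℝ → ℝ} (h : SolvesNLS ω I φ φ') :
    Continuous φ :=
  continuous_iff_continuousAt.2 fun x => (h.1 x).continuousAt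

theorem SolvesNLS.continuousOn' {ω : ℝ} {I : Set ℝ} {φ φ' : ℝ → ℝ} (h : SolvesNLS ω I φ φ') :
    ContinuousOn φ' I :=
  fun x hx => (h.2 x hx).continuousAt.continuousWithinAt

theorem solvesNLS_zero (ω : ℝ) (I : Set ℝ) : SolvesNLS ω I (fun _ => 0) (fun _ => 0) :=
  ⟨fun x => hasDerivAt_const x 0, fun x _ => by simpa using hasDerivAt_const x (0 : ℝ)⟩

/-- The field is only locally Lipschitz; for uniqueness on a compact interval it suffices to work in
a strip containing both solutions. -/
theorem lipschitzOnWith_nlsField (ω M : ℝ) (hω : 0 ≤ ω) :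
    LipschitzOnWith (Real.toNNReal (1 + ω + 3 * M ^ 2))
      (fun z : ℝ × ℝ => (z.2, ω * z.1 - z.1 ^ 3)) {z | |z.1| ≤ M} := by
  have hK : 0 ≤ 1 + ω + 3 * M ^ 2 := by positivity
  refine LipschitzOnWith.of_dist_le_mul fun z hz w hw => ?_
  rw [Real.coe_toNNReal _ hK, Prod.dist_eq, Prod.dist_eq]
  simp only [Real.dist_eq]
  set d := max |z.1 - w.1| |z.2 - w.2|
  have h1 : |z.1 - w.1| ≤ d := le_max_left _ _
  have h2 : |z.2 - w.2| ≤ d := le_max_right _ _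
  have hd : 0 ≤ d := (abs_nonneg _).trans h1
  refine max_le (h2.trans ?_) ?_
  · nlinarith [sq_nonneg M]
  · have e : ω * z.1 - z.1 ^ 3 - (ω * w.1 - w.1 ^ 3) =
        (z.1 - w.1) * (ω - (z.1 ^ 2 + z.1 * w.1 + w.1 ^ 2)) := by ring
    have hz' := abs_le.1 (show |z.1| ≤ M from hz)
    have hw' := abs_le.1 (show |w.1| ≤ M from hw)
    have h3 : |ω - (z.1 ^ 2 + z.1 * w.1 + w.1 ^ 2)| ≤ ω + 3 * M ^ 2 := by
      have a1 : z.1 ^ 2 ≤ M ^ 2 := sq_le_sq.2 (hz.trans (le_abs_self M))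
      have a2 : w.1 ^ 2 ≤ M ^ 2 := sq_le_sq.2 (hw.trans (le_abs_self M))
      rw [abs_le]
      constructor <;> nlinarith [sq_nonneg (z.1 + w.1), sq_nonneg (z.1 - w.1)]
    rw [e, abs_mul]
    calc _ ≤ d * (ω + 3 * M ^ 2) := mul_le_mul h1 h3 (abs_nonneg _) hd
      _ ≤ _ := by nlinarith

/-- Uniqueness for the initial value problem. -/
theorem SolvesNLS.eqOn {ω a b : ℝ} (hω : 0 ≤ ω) {φ φ' ψ ψ' : ℝ → ℝ}
    (hφ : SolvesNLS ω (Icc a b) φ φ') (hψ : SolvesNLS ω (Icc a b) ψ ψ') {t : ℝ}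
    (ht : t ∈ Icc a b) (h0 : φ t = ψ t) (h1 : φ' t = ψ' t) :
    EqOn φ ψ (Icc a b) ∧ EqOn φ' ψ' (Icc a b) := by
  obtain ⟨M₁, hM₁⟩ :=
      isCompact_Icc.exists_bound_of_continuousOn (hφ.continuous.continuousOn (s := Icc a b))
  obtain ⟨M₂, hM₂⟩ :=
      isCompact_Icc.exists_bound_of_continuousOn (hψ.continuous.continuousOn (s := Icc a b))
  set M := max M₁ M₂
  set v : ℝ → ℝ × ℝ → ℝ × ℝ := fun _ z => (z.2, ω * z.1 - z.1 ^ 3)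
  set s : ℝ → Set (ℝ × ℝ) := fun _ => {z | |z.1| ≤ M}
  have hlip := lipschitzOnWith_nlsField ω M hω
  have hd : ∀ {χ χ' : ℝ → ℝ}, SolvesNLS ω (Icc a b) χ χ' → ∀ x ∈ Icc a b,
      HasDerivAt (fun x => (χ x, χ' x)) (v x (χ x, χ' x)) x := fun h x hx =>
    (h.1 x).prodMk (h.2 x hx)
  have hc : ∀ {χ χ' : ℝ → ℝ}, SolvesNLS ω (Icc a b) χ χ' →
      ContinuousOn (fun x => (χ x, χ' x)) (Icc a b) := fun h =>
    h.continuous.continuousOn.prodMk h.continuousOn'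
  have hs1 : ∀ x ∈ Icc a b, (φ x, φ' x) ∈ s x := fun x hx =>
    (hM₁ x hx).trans (le_max_left _ _)
  have hs2 : ∀ x ∈ Icc a b, (ψ x, ψ' x) ∈ s x := fun x hx =>
    (hM₂ x hx).trans (le_max_right _ _)
  have hR : Icc t b ⊆ Icc a b := Icc_subset_Icc_left ht.1
  have hLf : Icc a t ⊆ Icc a b := Icc_subset_Icc_right ht.2
  have hic : ∀ x ∈ Ico t b, x ∈ Icc a b := fun x hx => hR (Ico_subset_Icc_self hx)
  have hoc : ∀ x ∈ Ioc a t, x ∈ Icc a b := fun x hx => hLf (Ioc_subset_Icc_self hx)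
  have e1 : EqOn (fun x => (φ x, φ' x)) (fun x => (ψ x, ψ' x)) (Icc t b) :=
    ODE_solution_unique_of_mem_Icc_right (v := v) (s := s) (fun _ _ => hlip) ((hc hφ).mono hR)
      (fun x hx => (hd hφ x (hic x hx)).hasDerivWithinAt) (fun x hx => hs1 x (hic x hx))
      ((hc hψ).mono hR) (fun x hx => (hd hψ x (hic x hx)).hasDerivWithinAt)
      (fun x hx => hs2 x (hic x hx)) (by simp only [h0, h1])
  have e2 : EqOn (fun x => (φ x, φ' x)) (fun x => (ψ x, ψ' x)) (Icc a t) :=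
    ODE_solution_unique_of_mem_Icc_left (v := v) (s := s) (fun _ _ => hlip) ((hc hφ).mono hLf)
      (fun x hx => (hd hφ x (hoc x hx)).hasDerivWithinAt) (fun x hx => hs1 x (hoc x hx))
      ((hc hψ).mono hLf) (fun x hx => (hd hψ x (hoc x hx)).hasDerivWithinAt)
      (fun x hx => hs2 x (hoc x hx)) (by simp only [h0, h1])
  have e : ∀ x ∈ Icc a b, (φ x, φ' x) = (ψ x, ψ' x) := fun x hx => by
    rcases le_total x t with h | h
    · exact e2 ⟨hx.1, h⟩
    · exact e1 ⟨h, hx.2⟩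
  exact ⟨fun x hx => (Prod.mk.inj (e x hx)).1, fun x hx => (Prod.mk.inj (e x hx)).2⟩

theorem SolvesNLS.eqOn_Ici {ω : ℝ} (hω : 0 ≤ ω) {φ φ' ψ ψ' : ℝ → ℝ}
    (hφ : SolvesNLS ω (Ici 0) φ φ') (hψ : SolvesNLS ω (Ici 0) ψ ψ') {t : ℝ}
    (ht : t ∈ Ici (0 : ℝ)) (h0 : φ t = ψ t) (h1 : φ' t = ψ' t) :
    EqOn φ ψ (Ici 0) ∧ EqOn φ' ψ' (Ici 0) := by
  have key : ∀ x ∈ Ici (0 : ℝ), φ x = ψ x ∧ φ' x = ψ' x := fun x hx => by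
    have h := (hφ.mono (J := Icc 0 (max x t)) Icc_subset_Ici_self).eqOn hω
      (hψ.mono Icc_subset_Ici_self) ⟨ht, le_max_right _ _⟩ h0 h1
    exact ⟨h.1 ⟨hx, le_max_left _ _⟩, h.2 ⟨hx, le_max_left _ _⟩⟩
  exact ⟨fun x hx => (key x hx).1, fun x hx => (key x hx).2⟩

theorem deriv_nonneg_of_right {f : ℝ → ℝ} {d x b : ℝ} (h : HasDerivAt f d x) (h0 : f x = 0)
    (hb : x < b) (hpos : ∀ y ∈ Icc x b, 0 ≤ f y) : 0 ≤ d := by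
  have h1 := hasDerivWithinAt_iff_tendsto_slope' (self_notMem_Ioi) |>.1
    (h.hasDerivWithinAt (s := Ioi x))
  refine ge_of_tendsto h1 ?_
  filter_upwards [Ioo_mem_nhdsGT hb] with y hy
  rw [slope_def_field, h0, sub_zero]
  exact div_nonneg (hpos y (Ioo_subset_Icc_self hy)) (by linarith [hy.1])

theorem deriv_nonpos_of_left {f : ℝ → ℝ} {d x b : ℝ} (h : HasDerivAt f d x) (h0 : f x = 0)
    (hb : b < x) (hpos : ∀ y ∈ Icc b x, 0 ≤ f y) : d ≤ 0 := by
  have h1 : HasDerivAt (fun y => f (-y)) (-d) (-x) := by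
    have := HasDerivAt.comp (-x) (h₂ := f) (h₂' := d) (by rwa [neg_neg]) (hasDerivAt_neg (-x))
    simpa [Function.comp_def] using this
  have := deriv_nonneg_of_right h1 (by rwa [neg_neg]) (show -x < -b by linarith)
    fun y hy => hpos (-y) ⟨by linarith [hy.2], by linarith [hy.1]⟩
  linarith

/-! ### The modulus of a minimizer -/

/-- The pointwise modulus. -/
def GraphFun.modulus (u : GraphFun) : GraphFun := ⟨fun x => (‖u.c x‖ : ℂ), fun x => (‖u.h x‖ : ℂ)⟩

theorem modulus_mem_formDomain {L : ℝ} {u : GraphFun} (hu : u ∈ formDomain L) :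
    u.modulus ∈ formDomain L :=
  ⟨(hu.1.norm ordConnected_Icc).1, (hu.2.1.norm ordConnected_Ici).1,
    by simp [GraphFun.modulus, hu.2.2.1], by simp [GraphFun.modulus, hu.2.2.2]⟩

theorem integral_deriv_norm_le {I : Set ℝ} (hI : I.OrdConnected) {f : ℝ → ℂ} (hf : IsH1On I f) :
    ∫ x in I, ‖deriv (fun x => (‖f x‖ : ℂ)) x‖ ^ 2 ≤ ∫ x in I, ‖deriv f x‖ ^ 2 := by
  obtain ⟨h1, h2⟩ := hf.norm hI
  refine integral_mono_ae (integrableOn_sq_norm h1.2.1) (integrableOn_sq_norm hf.2.1) ?_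
  filter_upwards [h2] with x hx
  exact pow_le_pow_left₀ (norm_nonneg _) hx 2

/-- Passing to the modulus preserves `fullN` and lowers no term of `fullQ` except possibly the two
Dirichlet integrals. Minimality tested with the modulus forbids a decrease of their sum, so neither
of them decreases. -/
theorem IsNormalizedMinimizer.modulus {ω γ L : ℝ} (hω : 0 ≤ ω) (hγ : 0 ≤ γ) {u : GraphFun}
    (hu : IsNormalizedMinimizer ω γ L u) :
    IsNormalizedMinimizer ω γ L u.modulus ∧
      (∫ x in Icc (-L) L, ‖deriv u.modulus.c x‖ ^ 2) = (∫ x in Icc (-L) L, ‖deriv u.c x‖ ^ 2) ∧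
      (∫ x in Ici 0, ‖deriv u.modulus.h x‖ ^ 2) = ∫ x in Ici 0, ‖deriv u.h x‖ ^ 2 := by
  have hd := modulus_mem_formDomain hu.mem
  have hN : fullN L u.modulus = fullN L u := by simp [fullN, edgeN, GraphFun.modulus]
  have e1 := integral_deriv_norm_le ordConnected_Icc hu.mem.1
  have e2 := integral_deriv_norm_le ordConnected_Ici hu.mem.2.1
  have hdiff : fullQ ω γ L u - fullQ ω γ L u.modulus =
      ((∫ x in Icc (-L) L, ‖deriv u.c x‖ ^ 2) - ∫ x in Icc (-L) L, ‖deriv u.modulus.c x‖ ^ 2) +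
      ((∫ x in Ici 0, ‖deriv u.h x‖ ^ 2) - ∫ x in Ici 0, ‖deriv u.modulus.h x‖ ^ 2) := by
    simp only [fullQ, edgeQ, GraphFun.modulus, Complex.norm_real, norm_norm]
    ring
  have hQ0 := fullQ_nonneg hω hγ L u.modulus
  have hge : fullN L u ≤ fullQ ω γ L u.modulus := by
    have := hu.le _ hd
    rw [hN] at this
    exact (pow_le_pow_iff_left₀ hu.pos.le hQ0 two_ne_zero).1 (by rwa [sq])
  have heq := hu.eq
  change _ ≤ _ at e1 e2
  simp only [GraphFun.modulus] at hdiff hge ⊢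
  have hQ : fullQ ω γ L u.modulus = fullQ ω γ L u := by
    simp only [GraphFun.modulus]; linarith
  refine ⟨⟨hd, hN.symm ▸ hu.pos, ?_, ?_⟩, by linarith, by linarith⟩
  · exact hQ.trans (heq.trans hN.symm)
  · intro v hv
    have := hu.le v hv
    rwa [← hN] at this

theorem re_nls_ofReal (ω r : ℝ) : (nls ω (r : ℂ)).re = ω * r - r ^ 3 := by
  have : nls ω (r : ℂ) = ((ω * r - r ^ 3 : ℝ) : ℂ) := by
    rw [nls, Complex.norm_real, Real.norm_eq_abs, sq_abs]
    push_cast; ring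
  rw [this, Complex.ofReal_re]

theorem solvesNLS_re {ω : ℝ} {I : Set ℝ} {f g : ℝ → ℂ} {ρ : ℝ → ℝ} (hρ : ∀ x ∈ I, f x = (ρ x : ℂ))
    (hf : ∀ x, HasDerivAt f (g x) x) (hg : ∀ x ∈ I, HasDerivAt g (nls ω (f x)) x) :
    SolvesNLS ω I (fun x => (f x).re) (fun x => (g x).re) := by
  refine ⟨fun x => ?_, fun x hx => ?_⟩
  · have := Complex.reCLM.hasFDerivAt.comp_hasDerivAt x (hf x)
    simpa [Function.comp_def] using this
  · have := Complex.reCLM.hasFDerivAt.comp_hasDerivAt x (hg x hx)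
    have h2 : (nls ω (f x)).re = ω * (f x).re - (f x).re ^ 3 := by
      rw [hρ x hx, re_nls_ofReal, Complex.ofReal_re]
    rw [← h2]
    simpa [Function.comp_def] using this

/-- The real Euler–Lagrange system for the modulus of a minimizer. -/
theorem IsNormalizedMinimizer.exists_modulus {ω γ L : ℝ} (hω : 0 ≤ ω) (hγ : 0 ≤ γ) (hL : 0 < L)
    {u : GraphFun} (hu : IsNormalizedMinimizer ω γ L u) :
    ∃ φ φ' ψ ψ' : ℝ → ℝ, (∀ x ∈ Icc (-L) L, ‖u.c x‖ = φ x) ∧ (∀ x ∈ Ici (0 : ℝ), ‖u.h x‖ = ψ x) ∧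
      SolvesNLS ω (Icc (-L) L) φ φ' ∧ SolvesNLS ω (Ici 0) ψ ψ' ∧
      φ' (-L) - φ' L + ψ' 0 = γ * ψ 0 := by
  obtain ⟨f, g, F, G, hf, hF, hfg, hFG, hgd, hGd, hk⟩ := (hu.modulus hω hγ).1.euler_lagrange hL
  have h1 : ∀ x ∈ Icc (-L) L, f x = (‖u.c x‖ : ℂ) := fun x hx => (hf hx).symm
  have h2 : ∀ x ∈ Ici (0 : ℝ), F x = (‖u.h x‖ : ℂ) := fun x hx => (hF hx).symm
  refine ⟨_, _, _, _, fun x hx => ?_, fun x hx => ?_, solvesNLS_re h1 hfg hgd,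
    solvesNLS_re h2 hFG hGd, ?_⟩
  · rw [h1 x hx, Complex.ofReal_re]
  · rw [h2 x hx, Complex.ofReal_re]
  · have := congrArg Complex.re hk
    rw [hF self_mem_Ici] at this
    simpa using this

/-- An interior zero of a nonnegative solution is a minimum, so the derivative vanishes there too
and uniqueness gives the zero solution. -/
theorem SolvesNLS.pos_or_zero {ω : ℝ} (hω : 0 ≤ ω) {I : Set ℝ} (hI : I.OrdConnected)
    {φ φ' : ℝ → ℝ} (h : SolvesNLS ω I φ φ') (hnn : ∀ x ∈ I, 0 ≤ φ x) {x : ℝ} (hx : x ∈ interior I)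
    (h0 : φ x = 0) : ∀ y ∈ I, φ y = 0 := by
  have hd : φ' x = 0 := by
    refine IsLocalMin.hasDerivAt_eq_zero (f := φ) ?_ (h.1 x)
    filter_upwards [mem_interior_iff_mem_nhds.1 hx] with y hy
    rw [h0]; exact hnn y hy
  intro y hy
  have hxI := interior_subset hx
  have hsub : Icc (min x y) (max x y) ⊆ I := hI.uIcc_subset hxI hy
  exact ((h.mono hsub).eqOn hω (solvesNLS_zero ω _) ⟨min_le_left _ _, le_max_left _ _⟩ h0 hd).1
    ⟨min_le_right _ _, le_max_right _ _⟩

/-- The strong maximum principle on the graph. -/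
theorem modulus_pos {ω γ L : ℝ} (hω : 0 ≤ ω) (hL : 0 < L) {φ φ' ψ ψ' : ℝ → ℝ}
    (hφ : SolvesNLS ω (Icc (-L) L) φ φ') (hψ : SolvesNLS ω (Ici 0) ψ ψ')
    (hφ0 : ∀ x ∈ Icc (-L) L, 0 ≤ φ x) (hψ0 : ∀ x ∈ Ici (0 : ℝ), 0 ≤ ψ x)
    (hv : φ L = φ (-L)) (hv' : φ (-L) = ψ 0) (hk : φ' (-L) - φ' L + ψ' 0 = γ * ψ 0)
    (hne : (∃ x ∈ Icc (-L) L, φ x ≠ 0) ∨ ∃ x ∈ Ici (0 : ℝ), ψ x ≠ 0) :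
    (∀ x ∈ Icc (-L) L, 0 < φ x) ∧ ∀ x ∈ Ici (0 : ℝ), 0 < ψ x := by
  have hLL : -L ∈ Icc (-L) L := left_mem_Icc.2 (by linarith)
  have hLR : L ∈ Icc (-L) L := right_mem_Icc.2 (by linarith)
  -- At a vanishing vertex value the three derivatives pointing into the edges are nonnegative, and
  -- the δ-condition makes their sum 0. Each is then 0, and uniqueness kills both edges.
  have hp : φ (-L) ≠ 0 := by
    intro h0
    have hL0 : φ L = 0 := hv.trans h0
    have hψ00 : ψ 0 = 0 := hv'.symm.trans h0
    have d1 : 0 ≤ φ' (-L) := deriv_nonneg_of_right (hφ.1 _) h0 (show -L < L by linarith) hφ0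
    have d2 : φ' L ≤ 0 := deriv_nonpos_of_left (hφ.1 _) hL0 (show -L < L by linarith) hφ0
    have d3 : 0 ≤ ψ' 0 := deriv_nonneg_of_right (hψ.1 _) hψ00 zero_lt_one
      fun y hy => hψ0 y hy.1
    rw [hψ00, mul_zero] at hk
    rcases hne with ⟨x, hx, hxne⟩ | ⟨x, hx, hxne⟩
    · exact hxne ((hφ.eqOn hω (solvesNLS_zero ω _) hLL h0 (by linarith)).1 hx)
    · exact hxne ((hψ.eqOn_Ici hω (solvesNLS_zero ω _) self_mem_Ici hψ00 (by linarith)).1 hx)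
  constructor
  · intro x hx
    refine lt_of_le_of_ne (hφ0 x hx) fun h => hp ?_
    rcases hx.1.eq_or_lt with h1 | h1
    · rw [h1]; exact h.symm
    rcases hx.2.eq_or_lt with h2 | h2
    · rw [← hv, ← h2]; exact h.symm
    · exact hφ.pos_or_zero hω ordConnected_Icc hφ0 (by rw [interior_Icc]; exact ⟨h1, h2⟩) h.symm
        _ hLL
  · intro x hx
    refine lt_of_le_of_ne (hψ0 x hx) fun h => hp ?_
    rw [hv']
    rcases (mem_Ici.1 hx).eq_or_lt with h1 | h1
    · have h2 := h.symm
      rwa [← h1] at h2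
    · exact hψ.pos_or_zero hω ordConnected_Ici hψ0 (by rw [interior_Ici]; exact h1) h.symm
        _ self_mem_Ici

/-- If taking the modulus does not lower the Dirichlet energy, then the phase is constant. -/
theorem exists_constant_phase {I : Set ℝ} (hI : I.OrdConnected) (hIc : I ⊆ closure (interior I))
    (hIne : I.Nonempty) {u f g : ℝ → ℂ} {φ φ' : ℝ → ℝ} (hu : IsH1On I u) (huf : EqOn u f I)
    (hfg : ∀ x, HasDerivAt f (g x) x) (hgc : ContinuousOn g I) (hφ : ∀ x, HasDerivAt φ (φ' x) x)
    (hφc : ContinuousOn φ' I) (huφ : ∀ x ∈ I, ‖u x‖ = φ x) (hpos : ∀ x ∈ I, 0 < φ x)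
    (hint : ∫ x in I, ‖deriv (fun x => (‖u x‖ : ℂ)) x‖ ^ 2 = ∫ x in I, ‖deriv u x‖ ^ 2) :
    ∃ w : ℂ, ∀ x ∈ I, u x = w * φ x := by
  have hIm := hI.measurableSet
  have hsub : interior I ⊆ I := interior_subset
  have hfI : ∀ x ∈ I, ‖f x‖ = φ x := fun x hx => by rw [← huf hx, huφ x hx]
  have hdu : ∀ x ∈ interior I, deriv u x = g x := fun x hx => by
    refine ((hfg x).congr_of_eventuallyEq ?_).deriv
    filter_upwards [mem_interior_iff_mem_nhds.1 hx] with y hy using huf hy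
  have hdn : ∀ x ∈ interior I, deriv (fun x => (‖u x‖ : ℂ)) x = (φ' x : ℂ) := fun x hx => by
    refine ((hφ x).ofReal_comp.congr_of_eventuallyEq ?_).deriv
    filter_upwards [mem_interior_iff_mem_nhds.1 hx] with y hy
    rw [huφ y hy]
  -- Differentiating `‖f‖ ^ 2 = φ ^ 2` identifies the radial part of `g`; equality of the Dirichlet
  -- integrals then leaves no angular part, which is the vanishing of `φ g - φ' f`.
  have hre : ∀ x ∈ interior I, inner ℝ (f x) (g x) = φ x * φ' x := fun x hx => by
    have h1 : HasDerivAt (fun x => ‖f x‖ ^ 2) (2 * inner ℝ (f x) (g x)) x := (hfg x).norm_sq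
    have h2 : HasDerivAt (fun x => ‖f x‖ ^ 2) (2 * φ x * φ' x) x := by
      have := (hφ x).pow 2
      refine HasDerivAt.congr_of_eventuallyEq (f₁ := fun x => ‖f x‖ ^ 2) (by simpa using this) ?_
      filter_upwards [mem_interior_iff_mem_nhds.1 hx] with y hy
      simp [hfI y hy]
    have := h1.unique h2
    linarith
  have hsq : ∀ x ∈ interior I, ‖g x‖ ^ 2 = φ' x ^ 2 := by
    obtain ⟨h1, h2⟩ := hu.norm hI
    have h3 : (∫ x in I, (‖deriv u x‖ ^ 2 - ‖deriv (fun x => (‖u x‖ : ℂ)) x‖ ^ 2)) = 0 := by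
      rw [integral_sub (integrableOn_sq_norm hu.2.1) (integrableOn_sq_norm h1.2.1), hint, sub_self]
    have h4 := (integral_eq_zero_iff_of_nonneg_ae (by
      filter_upwards [h2] with x hx
      simpa using pow_le_pow_left₀ (norm_nonneg _) hx 2)
      ((integrableOn_sq_norm hu.2.1).sub (integrableOn_sq_norm h1.2.1))).1 h3
    have h5 : (fun x => ‖g x‖ ^ 2) =ᵐ[volume.restrict (interior I)] fun x => φ' x ^ 2 := by
      filter_upwards [ae_restrict_of_ae_restrict_of_subset hsub h4,
        ae_restrict_mem isOpen_interior.measurableSet] with x hx hxI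
      simp only [Pi.sub_apply, Pi.zero_apply] at hx
      rw [hdu x hxI, hdn x hxI, Complex.norm_real, Real.norm_eq_abs, sq_abs] at hx
      linarith
    exact Measure.eqOn_of_ae_eq h5 ((hgc.mono hsub).norm.pow 2) ((hφc.mono hsub).pow 2)
      (by rw [interior_interior]; exact subset_closure)
  have hw : ∀ x ∈ interior I, HasDerivAt (fun x => f x / φ x) 0 x := by
    intro x hx
    have hp : (φ x : ℂ) ≠ 0 := Complex.ofReal_ne_zero.2 (hpos x (hsub hx)).ne'
    have h1 := (hfg x).div (hφ x).ofReal_comp hp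
    have h2 : g x * φ x - f x * φ' x = 0 := by
      have e1 : g x * φ x - f x * φ' x = φ x • g x - φ' x • f x := by
        simp only [Complex.real_smul]; ring
      have e2 : ‖φ x • g x - φ' x • f x‖ ^ 2 = 0 := by
        rw [norm_sub_sq_real, norm_smul, norm_smul, mul_pow, mul_pow, hsq x hx, hfI x (hsub hx),
          real_inner_smul_left, real_inner_smul_right, real_inner_comm, hre x hx, Real.norm_eq_abs,
          Real.norm_eq_abs, sq_abs, sq_abs]
        ring
      rw [e1]
      exact norm_eq_zero.1 (pow_eq_zero_iff two_ne_zero |>.1 e2)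
    rw [h2, zero_div] at h1
    exact h1
  have hint_ne : (interior I).Nonempty := by
    rw [← closure_nonempty_iff]; exact hIne.mono hIc
  obtain ⟨x₀, hx₀⟩ := hint_ne
  have hpre : IsPreconnected (interior I) := hI.convex.interior.isPreconnected
  set w := f x₀ / φ x₀
  have hconst : ∀ x ∈ interior I, f x / φ x = w := fun x hx =>
    isOpen_interior.is_const_of_deriv_eq_zero hpre
      (fun y hy => (hw y hy).differentiableAt.differentiableWithinAt)
      (fun y hy => (hw y hy).deriv) hx hx₀
  refine ⟨w, ?_⟩
  have hE : EqOn f (fun x => w * φ x) (interior I) := fun x hx => by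
    have hp : (φ x : ℂ) ≠ 0 := Complex.ofReal_ne_zero.2 (hpos x (hsub hx)).ne'
    simp only [← hconst x hx]
    field_simp
  have hcf : Continuous f := continuous_iff_continuousAt.2 fun x => (hfg x).continuousAt
  have hcφ : Continuous φ := continuous_iff_continuousAt.2 fun x => (hφ x).continuousAt
  have hE2 := hE.closure hcf (by fun_prop)
  intro x hx
  rw [huf hx]
  exact hE2 (hIc hx)

/-- A ground state is a constant phase times a positive solution of the real problem. -/
theorem IsActionGroundState.exists_positive {ω γ L : ℝ} (hω : 0 < ω) (hγ : 0 ≤ γ) (hL : 0 < L)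
    {u : GraphFun} (hu : IsActionGroundState ω γ L u) :
    ∃ (θ : ℝ) (φ φ' ψ ψ' : ℝ → ℝ),
      (∀ x ∈ Icc (-L) L, 0 < φ x ∧ u.c x = Complex.exp (θ * Complex.I) * φ x) ∧
      (∀ x ∈ Ici (0 : ℝ), 0 < ψ x ∧ u.h x = Complex.exp (θ * Complex.I) * ψ x) ∧
      SolvesNLS ω (Icc (-L) L) φ φ' ∧ SolvesNLS ω (Ici 0) ψ ψ' ∧
      φ L = φ (-L) ∧ φ (-L) = ψ 0 ∧ φ' (-L) - φ' L + ψ' 0 = γ * ψ 0 := by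
  have hm := hu.isNormalizedMinimizer hω hγ hL
  obtain ⟨-, hi1, hi2⟩ := hm.modulus hω.le hγ
  obtain ⟨φ, φ', ψ, ψ', hφ, hψ, hφs, hψs, hk⟩ := hm.exists_modulus hω.le hγ hL
  obtain ⟨f, g, F, G, hf, hF, hfg, hFG, hgd, hGd, -⟩ := hm.euler_lagrange hL
  have hum := hm.mem
  have hLL : -L ∈ Icc (-L) L := left_mem_Icc.2 (by linarith)
  have hLR : L ∈ Icc (-L) L := right_mem_Icc.2 (by linarith)
  have hv : φ L = φ (-L) := by rw [← hφ L hLR, ← hφ (-L) hLL, hum.2.2.1]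
  have hv' : φ (-L) = ψ 0 := by rw [← hψ 0 self_mem_Ici, ← hφ (-L) hLL, hum.2.2.2]
  have hne : (∃ x ∈ Icc (-L) L, φ x ≠ 0) ∨ ∃ x ∈ Ici (0 : ℝ), ψ x ≠ 0 := by
    rcases hu.1.2.1 with ⟨x, hx, h⟩ | ⟨x, hx, h⟩
    · exact Or.inl ⟨x, hx, by rw [← hφ x hx]; exact norm_ne_zero_iff.2 h⟩
    · exact Or.inr ⟨x, hx, by rw [← hψ x hx]; exact norm_ne_zero_iff.2 h⟩
  obtain ⟨hp1, hp2⟩ := modulus_pos hω.le hL hφs hψs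
    (fun x hx => by rw [← hφ x hx]; exact norm_nonneg _)
    (fun x hx => by rw [← hψ x hx]; exact norm_nonneg _) hv hv' hk hne
  obtain ⟨w, hw⟩ := exists_constant_phase ordConnected_Icc (Icc_subset_closure_interior hL)
    ⟨_, hLL⟩ hum.1 hf hfg (fun x hx => (hgd x hx).continuousAt.continuousWithinAt) hφs.1
    hφs.continuousOn' hφ hp1 hi1
  obtain ⟨w', hw'⟩ := exists_constant_phase ordConnected_Ici (Ici_subset_closure_interior 0)
    ⟨0, self_mem_Ici⟩ hum.2.1 hF hFG (fun x hx => (hGd x hx).continuousAt.continuousWithinAt) hψs.1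
    hψs.continuousOn' hψ hp2 hi2
  have hpne : (φ (-L) : ℂ) ≠ 0 := Complex.ofReal_ne_zero.2 (hp1 _ hLL).ne'
  -- The two edges share a nonzero vertex value, so their phases coincide.
  have hww : w' = w := by
    have h1 := hw (-L) hLL
    have h2 := hw' 0 self_mem_Ici
    rw [← hum.2.2.2, ← hv', h1] at h2
    exact (mul_right_cancel₀ hpne h2).symm
  have hwn : ‖w‖ = 1 := by
    have h1 := congrArg norm (hw (-L) hLL)
    rw [hφ _ hLL, norm_mul, Complex.norm_real, Real.norm_eq_abs, abs_of_pos (hp1 _ hLL)] at h1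
    exact (mul_eq_right₀ (hp1 _ hLL).ne').1 h1.symm
  have hwe : w = Complex.exp (Complex.arg w * Complex.I) := by
    have := Complex.norm_mul_exp_arg_mul_I w
    rw [hwn, Complex.ofReal_one, one_mul] at this
    exact this.symm
  refine ⟨Complex.arg w, φ, φ', ψ, ψ', fun x hx => ⟨hp1 x hx, ?_⟩, fun x hx => ⟨hp2 x hx, ?_⟩,
    hφs, hψs, hv, hv', hk⟩
  · rw [← hwe]; exact hw x hx
  · rw [← hwe, ← hww]; exact hw' x hx

/-! ### Jacobi elliptic functions -/

theorem one_sub_sq_mul_sin_sq_pos {k : ℝ} (hk : 0 ≤ k) (hk1 : k < 1) (θ : ℝ) :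
    0 < 1 - k ^ 2 * sin θ ^ 2 := by
  have := sin_sq_le_one θ
  have h2 : k ^ 2 < 1 := by nlinarith
  nlinarith [sq_nonneg k, sq_nonneg (sin θ)]

theorem continuous_ellipticIntegrand {k : ℝ} (hk : 0 ≤ k) (hk1 : k < 1) :
    Continuous fun θ : ℝ => 1 / √(1 - k ^ 2 * sin θ ^ 2) :=
  continuous_const.div (by fun_prop) fun θ =>
    (Real.sqrt_pos.2 (one_sub_sq_mul_sin_sq_pos hk hk1 θ)).ne'

theorem hasDerivAt_ellipticF {k : ℝ} (hk : 0 ≤ k) (hk1 : k < 1) (θ : ℝ) :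
    HasDerivAt (ellipticF k) (1 / √(1 - k ^ 2 * sin θ ^ 2)) θ :=
  (continuous_ellipticIntegrand hk hk1).integral_hasStrictDerivAt 0 θ |>.hasDerivAt

theorem strictMono_ellipticF {k : ℝ} (hk : 0 ≤ k) (hk1 : k < 1) : StrictMono (ellipticF k) :=
  strictMono_of_deriv_pos fun θ => by
    rw [(hasDerivAt_ellipticF hk hk1 θ).deriv]
    exact one_div_pos.2 (Real.sqrt_pos.2 (one_sub_sq_mul_sin_sq_pos hk hk1 θ))

theorem ellipticF_jacobiAm {k : ℝ} (hk : 0 ≤ k) (hk1 : k < 1) (x : ℝ) :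
    ellipticF k (jacobiAm k x) = x :=
  Function.rightInverse_invFun (ellipticF_bijective hk hk1).2 x

theorem jacobiAm_ellipticF {k : ℝ} (hk : 0 ≤ k) (hk1 : k < 1) (θ : ℝ) :
    jacobiAm k (ellipticF k θ) = θ :=
  Function.leftInverse_invFun (ellipticF_bijective hk hk1).1 θ

theorem strictMono_jacobiAm {k : ℝ} (hk : 0 ≤ k) (hk1 : k < 1) :
    StrictMono (jacobiAm k) := fun x y hxy => by
  rw [← (strictMono_ellipticF hk hk1).lt_iff_lt, ellipticF_jacobiAm hk hk1,
    ellipticF_jacobiAm hk hk1]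
  exact hxy

theorem jacobiDn_pos {k : ℝ} (hk : 0 ≤ k) (hk1 : k < 1) (x : ℝ) : 0 < jacobiDn x k :=
  Real.sqrt_pos.2 (one_sub_sq_mul_sin_sq_pos hk hk1 _)

theorem jacobiDn_sq {k : ℝ} (hk : 0 ≤ k) (hk1 : k < 1) (x : ℝ) :
    jacobiDn x k ^ 2 = 1 - k ^ 2 * sin (jacobiAm k x) ^ 2 :=
  Real.sq_sqrt (one_sub_sq_mul_sin_sq_pos hk hk1 _).le

theorem hasDerivAt_jacobiAm {k : ℝ} (hk : 0 ≤ k) (hk1 : k < 1) (x : ℝ) :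
    HasDerivAt (jacobiAm k) (jacobiDn x k) x := by
  have hc : Continuous (jacobiAm k) :=
      (strictMono_jacobiAm hk hk1).monotone.continuous_of_surjective
    fun θ => ⟨_, jacobiAm_ellipticF hk hk1 θ⟩
  have h := HasDerivAt.of_local_left_inverse hc.continuousAt
    (hasDerivAt_ellipticF hk hk1 (jacobiAm k x))
    (one_div_pos.2 (Real.sqrt_pos.2 (one_sub_sq_mul_sin_sq_pos hk hk1 _))).ne'
    (Eventually.of_forall (ellipticF_jacobiAm hk hk1))
  rwa [one_div, inv_inv] at h

theorem hasDerivAt_sin_jacobiAm {k : ℝ} (hk : 0 ≤ k) (hk1 : k < 1) (x : ℝ) :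
    HasDerivAt (fun x => sin (jacobiAm k x)) (jacobiCn x k * jacobiDn x k) x :=
  (hasDerivAt_jacobiAm hk hk1 x).sin

theorem hasDerivAt_jacobiCn {k : ℝ} (hk : 0 ≤ k) (hk1 : k < 1) (x : ℝ) :
    HasDerivAt (fun x => jacobiCn x k) (-sin (jacobiAm k x) * jacobiDn x k) x :=
  (hasDerivAt_jacobiAm hk hk1 x).cos

theorem hasDerivAt_jacobiDn {k : ℝ} (hk : 0 ≤ k) (hk1 : k < 1) (x : ℝ) :
    HasDerivAt (fun x => jacobiDn x k) (-k ^ 2 * (sin (jacobiAm k x) * jacobiCn x k)) x := by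
  have h1 := (((hasDerivAt_sin_jacobiAm hk hk1 x).pow 2).const_mul (k ^ 2)).const_sub 1
  have h2 := h1.sqrt (one_sub_sq_mul_sin_sq_pos hk hk1 _).ne'
  convert! h2 using 1
  have hd : √(1 - k ^ 2 * sin (jacobiAm k x) ^ 2) = jacobiDn x k := rfl
  have hne := (jacobiDn_pos hk hk1 x).ne'
  simp only [Pi.pow_apply]
  rw [hd]
  field_simp
  norm_num
  ring

theorem ellipticF_zero (k : ℝ) : ellipticF k 0 = 0 := by simp [ellipticF]

theorem jacobiAm_zero {k : ℝ} (hk : 0 ≤ k) (hk1 : k < 1) : jacobiAm k 0 = 0 := by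
  have := jacobiAm_ellipticF hk hk1 0
  rwa [ellipticF_zero k] at this

theorem jacobiAm_ellipticK {k : ℝ} (hk : 0 ≤ k) (hk1 : k < 1) : jacobiAm k (ellipticK k) = π / 2 :=
  jacobiAm_ellipticF hk hk1 (π / 2)

theorem ellipticK_pos {k : ℝ} (hk : 0 ≤ k) (hk1 : k < 1) : 0 < ellipticK k := by
  rw [← ellipticF_zero k]
  exact strictMono_ellipticF hk hk1 (by positivity)

theorem ellipticF_add_pi {k : ℝ} (hk : 0 ≤ k) (hk1 : k < 1) (θ : ℝ) :
    ellipticF k (θ + π) = ellipticF k θ + 2 * ellipticK k := by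
  set w : ℝ → ℝ := fun θ => 1 / √(1 - k ^ 2 * sin θ ^ 2) with hw
  have hwc : Continuous w := continuous_ellipticIntegrand hk hk1
  have hper : Function.Periodic w π := fun θ => by simp [hw, sin_add_pi]
  have h1 : ellipticF k (θ + π) - ellipticF k θ = ∫ t in θ..θ + π, w t :=
    intervalIntegral.integral_interval_sub_left (hwc.intervalIntegrable (μ := volume) _ _)
      (hwc.intervalIntegrable (μ := volume) _ _)
  have h2 : ∫ t in θ..θ + π, w t = ∫ t in (0 : ℝ)..0 + π, w t := hper.intervalIntegral_add_eq θ 0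
  have h3 : ∫ t in (π / 2)..π, w t = ellipticK k := by
    have h4 : ∀ t, w (π - t) = w t := fun t => by simp [hw, sin_pi_sub]
    have h5 := intervalIntegral.integral_comp_sub_left (a := 0) (b := π / 2) w π
    simp only [h4] at h5
    rw [sub_zero, show π - π / 2 = π / 2 by ring] at h5
    exact h5.symm
  have h6 := intervalIntegral.integral_add_adjacent_intervals
    (hwc.intervalIntegrable (μ := volume) 0 (π / 2))
        (hwc.intervalIntegrable (μ := volume) (π / 2) π)
  have h7 : ∫ t in (0 : ℝ)..(π / 2), w t = ellipticK k := rfl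
  rw [zero_add] at h2
  linarith

theorem ellipticF_add_int_mul_pi {k : ℝ} (hk : 0 ≤ k) (hk1 : k < 1) (θ : ℝ) (n : ℤ) :
    ellipticF k (θ + n * π) = ellipticF k θ + 2 * n * ellipticK k := by
  induction n with
  | zero => simp
  | succ i ih =>
    have := ellipticF_add_pi hk hk1 (θ + (i : ℤ) * π)
    push_cast at this ih ⊢
    rw [show θ + ((i : ℝ) + 1) * π = θ + i * π + π by ring, this, ih]
    ring
  | pred i ih =>
    have := ellipticF_add_pi hk hk1 (θ + ((-(i : ℤ) - 1 : ℤ) : ℝ) * π)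
    push_cast at this ih ⊢
    rw [show θ + (-(i : ℝ) - 1) * π + π = θ + -(i : ℝ) * π by ring, ih] at this
    linarith

theorem ellipticF_int_mul_pi_div_two {k : ℝ} (hk : 0 ≤ k) (hk1 : k < 1) (n : ℤ) :
    ellipticF k (n * (π / 2)) = n * ellipticK k := by
  obtain ⟨m, rfl | rfl⟩ := Int.even_or_odd' n
  · have := ellipticF_add_int_mul_pi hk hk1 0 m
    rw [ellipticF_zero k, zero_add, zero_add] at this
    push_cast
    rw [← this]; congr 1; ring
  · have := ellipticF_add_int_mul_pi hk hk1 (π / 2) m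
    have hK : ellipticF k (π / 2) = ellipticK k := rfl
    rw [hK] at this
    push_cast
    rw [show (2 * (m : ℝ) + 1) * (π / 2) = π / 2 + m * π by ring, this]; ring

/-- The zeros of `sn · cn`. -/
theorem eq_int_mul_ellipticK {k : ℝ} (hk : 0 ≤ k) (hk1 : k < 1) {x : ℝ}
    (h : sin (jacobiAm k x) * jacobiCn x k = 0) :
    ∃ n : ℤ, x = n * ellipticK k := by
  have h1 : sin (2 * jacobiAm k x) = 0 := by
    rw [sin_two_mul]; rw [jacobiCn] at h; linarith
  obtain ⟨n, hn⟩ := Real.sin_eq_zero_iff.1 h1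
  refine ⟨n, ?_⟩
  rw [← ellipticF_int_mul_pi_div_two hk hk1, ← ellipticF_jacobiAm hk hk1 x]
  congr 1; linarith

/-- Equal values of dn fix the square of the sine of the amplitude, and the second hypothesis fixes
the sine of twice the amplitude. The amplitudes therefore differ by a multiple of `π`, to which `2 *
ellipticK k` corresponds. -/
theorem sub_eq_int_mul_two_ellipticK {k : ℝ} (hk : 0 ≤ k) (hk1 : k < 1) {x y : ℝ} (hk0 : k ≠ 0)
    (h : jacobiDn x k = jacobiDn y k)
    (h' : sin (jacobiAm k x) * jacobiCn x k = sin (jacobiAm k y) * jacobiCn y k) :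
    ∃ n : ℤ, x - y = 2 * n * ellipticK k := by
  have e1 : sin (jacobiAm k x) ^ 2 = sin (jacobiAm k y) ^ 2 := by
    have h1 := jacobiDn_sq hk hk1 x
    rw [h, jacobiDn_sq hk hk1 y] at h1
    have : k ^ 2 ≠ 0 := pow_ne_zero 2 hk0
    exact mul_left_cancel₀ this (by linarith)
  have e2 : cos (2 * jacobiAm k x - 2 * jacobiAm k y) = 1 := by
    rw [cos_sub, sin_two_mul, sin_two_mul, cos_two_mul, cos_two_mul]
    have c1 := sin_sq_add_cos_sq (jacobiAm k x)
    have c2 := sin_sq_add_cos_sq (jacobiAm k y)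
    rw [jacobiCn, jacobiCn] at h'
    have e3 : cos (jacobiAm k y) ^ 2 = cos (jacobiAm k x) ^ 2 := by linarith
    linear_combination (2 * cos (jacobiAm k x) ^ 2 - 1) * 2 * e3 -
      4 * sin (jacobiAm k x) * cos (jacobiAm k x) * h' + 4 * cos (jacobiAm k x) ^ 2 * c1
  obtain ⟨n, hn⟩ := (Real.cos_eq_one_iff _).1 e2
  refine ⟨n, ?_⟩
  have h3 : jacobiAm k x = jacobiAm k y + n * π := by linarith
  have h4 := ellipticF_add_int_mul_pi hk hk1 (jacobiAm k y) n
  rw [← h3, ellipticF_jacobiAm hk hk1, ellipticF_jacobiAm hk hk1] at h4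
  linarith

/-! ### The elliptic profiles solve the stationary equation -/

/-- The derivative of the dnoidal profile. -/
def profileDn' (ω k a x : ℝ) : ℝ :=
  -(√(2 * ω / (2 - k ^ 2)) * √(ω / (2 - k ^ 2)) * k ^ 2 *
    (sin (jacobiAm k (√(ω / (2 - k ^ 2)) * x + a)) * jacobiCn (√(ω / (2 - k ^ 2)) * x + a) k))

/-- The derivative of the cnoidal profile. -/
def profileCn' (ω k a x : ℝ) : ℝ :=
  -(√(2 * ω * k ^ 2 / (2 * k ^ 2 - 1)) * √(ω / (2 * k ^ 2 - 1)) *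
    (sin (jacobiAm k (√(ω / (2 * k ^ 2 - 1)) * x + a)) *
      jacobiDn (√(ω / (2 * k ^ 2 - 1)) * x + a) k))

/-- With amplitude `A` and frequency `B`, the relations `A² = 2B²` and `B² (2 - k²) = ω` rescale
`dn'' = (2 - k²) dn - 2 dn³` to the stationary equation. -/
theorem solvesNLS_profileDn {ω k : ℝ} (hω : 0 < ω) (hk : 0 ≤ k) (hk1 : k < 1) (a : ℝ) (I : Set ℝ) :
    SolvesNLS ω I (profileDn ω k a) (profileDn' ω k a) := by
  have hk2 : 0 < 2 - k ^ 2 := by nlinarith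
  set B := √(ω / (2 - k ^ 2)) with hB
  set A := √(2 * ω / (2 - k ^ 2)) with hA
  have hB2 : B ^ 2 * (2 - k ^ 2) = ω := by
    rw [hB, Real.sq_sqrt (by positivity), div_mul_cancel₀ _ hk2.ne']
  have hA2 : A ^ 2 = 2 * B ^ 2 := by
    rw [hB, hA, Real.sq_sqrt (by positivity), Real.sq_sqrt (by positivity)]; ring
  have hlin : ∀ x, HasDerivAt (fun x => B * x + a) B x := fun x => by
    simpa using ((hasDerivAt_id x).const_mul B).add_const a
  refine ⟨fun x => ?_, fun x _ => ?_⟩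
  · have h := ((hasDerivAt_jacobiDn hk hk1 (B * x + a)).comp x (hlin x)).const_mul A
    have e : profileDn' ω k a x =
        A * (-k ^ 2 * (sin (jacobiAm k (B * x + a)) * jacobiCn (B * x + a) k) * B) := by
      rw [profileDn', ← hB, ← hA]; ring
    rw [e]; exact h
  · have h1 := (hasDerivAt_sin_jacobiAm hk hk1 (B * x + a)).mul
      (hasDerivAt_jacobiCn hk hk1 (B * x + a))
    have h := ((h1.comp x (hlin x)).const_mul (A * B * k ^ 2)).neg
    set s := sin (jacobiAm k (B * x + a))
    set c := jacobiCn (B * x + a) k with hc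
    set d := jacobiDn (B * x + a) k with hd
    have hd2 : d ^ 2 = 1 - k ^ 2 * s ^ 2 := jacobiDn_sq hk hk1 _
    have hsc : s ^ 2 + c ^ 2 = 1 := sin_sq_add_cos_sq _
    have e : ω * profileDn ω k a x - profileDn ω k a x ^ 3 =
        -(A * B * k ^ 2 * ((c * d * c + s * (-s * d)) * B)) := by
      rw [profileDn, ← hB, ← hA, ← hd]
      have e2 : (A * d) ^ 3 = A * (2 * B ^ 2) * d * d ^ 2 := by rw [← hA2]; ring
      rw [e2, ← hB2, hd2]
      linear_combination (A * B ^ 2 * d * k ^ 2) * hsc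
    rw [e]
    exact h

/-- As for dn, now from `cn'' = (2k² - 1) cn - 2k² cn³` with `A² = 2k²B²` and `B² (2k² - 1) = ω`. -/
theorem solvesNLS_profileCn {ω k : ℝ} (hω : 0 < ω) (hk : 1 / √2 < k) (hk1 : k < 1) (a : ℝ)
    (I : Set ℝ) : SolvesNLS ω I (profileCn ω k a) (profileCn' ω k a) := by
  have hk0 : 0 < k := lt_trans (by positivity) hk
  have hk2 : 0 < 2 * k ^ 2 - 1 := by
    have h1 := pow_lt_pow_left₀ hk (by positivity) two_ne_zero
    rw [div_pow, Real.sq_sqrt zero_le_two] at h1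
    linarith
  set B := √(ω / (2 * k ^ 2 - 1)) with hB
  set A := √(2 * ω * k ^ 2 / (2 * k ^ 2 - 1)) with hA
  have hB2 : B ^ 2 * (2 * k ^ 2 - 1) = ω := by
    rw [hB, Real.sq_sqrt (by positivity), div_mul_cancel₀ _ hk2.ne']
  have hA2 : A ^ 2 = 2 * k ^ 2 * B ^ 2 := by
    rw [hB, hA, Real.sq_sqrt (by positivity), Real.sq_sqrt (by positivity)]; ring
  have hlin : ∀ x, HasDerivAt (fun x => B * x + a) B x := fun x => by
    simpa using ((hasDerivAt_id x).const_mul B).add_const a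
  refine ⟨fun x => ?_, fun x _ => ?_⟩
  · have h := ((hasDerivAt_jacobiCn hk0.le hk1 (B * x + a)).comp x (hlin x)).const_mul A
    have e : profileCn' ω k a x =
        A * (-sin (jacobiAm k (B * x + a)) * jacobiDn (B * x + a) k * B) := by
      rw [profileCn', ← hB, ← hA]; ring
    rw [e]; exact h
  · have h1 := (hasDerivAt_sin_jacobiAm hk0.le hk1 (B * x + a)).mul
      (hasDerivAt_jacobiDn hk0.le hk1 (B * x + a))
    have h := ((h1.comp x (hlin x)).const_mul (A * B)).neg
    set s := sin (jacobiAm k (B * x + a))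
    set c := jacobiCn (B * x + a) k with hc
    set d := jacobiDn (B * x + a) k with hd
    have hd2 : d ^ 2 = 1 - k ^ 2 * s ^ 2 := jacobiDn_sq hk0.le hk1 _
    have hsc : s ^ 2 + c ^ 2 = 1 := sin_sq_add_cos_sq _
    have e : ω * profileCn ω k a x - profileCn ω k a x ^ 3 =
        -(A * B * ((c * d * d + s * (-k ^ 2 * (s * c))) * B)) := by
      rw [profileCn, ← hB, ← hA, ← hc]
      have e2 : (A * c) ^ 3 = A * (2 * k ^ 2 * B ^ 2) * c * c ^ 2 := by rw [← hA2]; ring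
      rw [e2, ← hB2]
      linear_combination (A * B ^ 2 * c) * hd2 - (2 * A * B ^ 2 * c * k ^ 2) * hsc
    rw [e]
    exact h

theorem solvesNLS_profileSech {ω : ℝ} (hω : 0 < ω) (b : ℝ) (I : Set ℝ) :
    SolvesNLS ω I (profileSech ω b) (fun x => -√ω * tanh (√ω * x + b) * profileSech ω b x) :=
  ⟨hasDerivAt_profileSech ω b, fun x _ => hasDerivAt_deriv_profileSech hω b x⟩

/-! ### Conservation of energy and symmetry -/

theorem SolvesNLS.motionIntegral_eq {ω : ℝ} {I : Set ℝ} (hI : I.OrdConnected) {φ φ' : ℝ → ℝ}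
    (h : SolvesNLS ω I φ φ') {x y : ℝ} (hx : x ∈ I) (hy : y ∈ I) :
    motionIntegral ω (φ x) (φ' x) = motionIntegral ω (φ y) (φ' y) := by
  wlog hxy : x ≤ y generalizing x y
  · exact (this hy hx (le_of_not_ge hxy)).symm
  have hd : ∀ t ∈ Icc x y, HasDerivAt (fun t => motionIntegral ω (φ t) (φ' t)) 0 t := fun t ht => by
    have h1 := h.1 t
    have h2 := h.2 t (hI.out hx hy ht)
    have h3 := (h2.pow 2).sub ((h1.pow 2).mul (((h1.pow 2).div_const 2).const_sub ω))
    unfold motionIntegral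
    convert! h3 using 1
    simp only [Pi.pow_apply]
    norm_num
    ring
  exact (constant_of_has_deriv_right_zero
    (fun t ht => (hd t ht).continuousAt.continuousWithinAt)
    (fun t ht => (hd t (Ico_subset_Icc_self ht)).hasDerivWithinAt) y (right_mem_Icc.2 hxy)).symm

theorem SolvesNLS.comp_neg {ω L : ℝ} {φ φ' : ℝ → ℝ} (h : SolvesNLS ω (Icc (-L) L) φ φ') :
    SolvesNLS ω (Icc (-L) L) (fun x => φ (-x)) (fun x => -φ' (-x)) := by
  refine ⟨fun x => ?_, fun x hx => ?_⟩
  · have := (h.1 (-x)).comp x (hasDerivAt_neg x)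
    rwa [mul_neg_one] at this
  · have hx' : -x ∈ Icc (-L) L := ⟨by linarith [hx.2], by linarith [hx.1]⟩
    have := ((h.2 (-x) hx').comp x (hasDerivAt_neg x)).neg
    rwa [mul_neg_one, neg_neg] at this

/-- The solution and its reflection have the same data at `L`. -/
theorem SolvesNLS.even {ω L : ℝ} (hω : 0 ≤ ω) (hL : 0 < L) {φ φ' : ℝ → ℝ}
    (h : SolvesNLS ω (Icc (-L) L) φ φ') (h0 : φ L = φ (-L)) (h1 : φ' L = -φ' (-L)) :
    (∀ x ∈ Icc (-L) L, φ (-x) = φ x) ∧ φ' 0 = 0 := by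
  have := h.comp_neg.eqOn hω h (t := L) ⟨by linarith, le_rfl⟩ h0.symm (by rw [h1])
  have h2 : -φ' (-0) = φ' 0 := this.2 (x := 0) ⟨by linarith, hL.le⟩
  rw [neg_zero] at h2
  exact ⟨this.1, by linarith⟩

/-! ### The half-line -/

theorem artanh_neg_eq {x : ℝ} (hx : x ∈ Ioo (-1 : ℝ) 1) : artanh (-x) = -artanh x := by
  rw [← artanh_tanh (-artanh x), Real.tanh_neg, tanh_artanh hx]

/-- On the zero energy level `s` determines both height and logarithmic slope `-s`. The sech with
phase `b` has logarithmic slope `-√ω tanh b` at 0, hence `b = artanh (s / √ω)`. -/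
theorem SolvesNLS.eqOn_profileSech {ω s : ℝ} (hω : 0 < ω) {ψ ψ' : ℝ → ℝ}
    (h : SolvesNLS ω (Ici 0) ψ ψ') (hpos : 0 < ψ 0) (hs : s ^ 2 = ω - ψ 0 ^ 2 / 2)
    (h1 : ψ' 0 = -(ψ 0 * s)) :
    s / √ω ∈ Ioo (-1 : ℝ) 1 ∧ EqOn ψ (profileSech ω (artanh (s / √ω))) (Ici 0) := by
  have hr : 0 < √ω := Real.sqrt_pos.2 hω
  have hr2 : √ω ^ 2 = ω := Real.sq_sqrt hω.le
  have hlt : |s| < √ω := by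
    rw [← Real.sqrt_sq_eq_abs]
    exact Real.sqrt_lt_sqrt (sq_nonneg s) (by nlinarith)
  have hmem : s / √ω ∈ Ioo (-1 : ℝ) 1 := by
    rw [mem_Ioo, ← abs_lt, abs_div, abs_of_pos hr]
    exact (div_lt_one hr).2 hlt
  refine ⟨hmem, ?_⟩
  have ht : tanh (√ω * 0 + artanh (s / √ω)) = s / √ω := by
    rw [mul_zero, zero_add, tanh_artanh hmem]
  have h0 : ψ 0 = profileSech ω (artanh (s / √ω)) 0 := by
    refine (pow_left_inj₀ hpos.le (profileSech_pos hω _ _).le two_ne_zero).1 ?_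
    rw [profileSech_sq hω, ht, div_pow, hr2, hs]
    field_simp
    ring
  refine (h.eqOn_Ici hω.le (solvesNLS_profileSech hω _ _) self_mem_Ici h0 ?_).1
  simp only [ht, ← h0, h1]
  field_simp

/-- As `ψ` decays, `ψ' ^ 2` tends to the conserved energy, and an integrable function can only have
the limit 0 at infinity. -/
theorem SolvesNLS.motionIntegral_eq_zero {ω : ℝ} {ψ ψ' : ℝ → ℝ} (h : SolvesNLS ω (Ici 0) ψ ψ')
    (hlim : Tendsto ψ atTop (𝓝 0)) (hint : IntegrableOn (fun x => ψ' x ^ 2) (Ici 0)) :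
    motionIntegral ω (ψ 0) (ψ' 0) = 0 := by
  have h1 : Tendsto (fun x => motionIntegral ω (ψ 0) (ψ' 0) + ψ x ^ 2 * (ω - ψ x ^ 2 / 2)) atTop
      (𝓝 (motionIntegral ω (ψ 0) (ψ' 0) + 0 ^ 2 * (ω - 0 ^ 2 / 2))) :=
    ((hlim.pow 2).mul (((hlim.pow 2).div_const 2).const_sub ω)).const_add _
  have h2 : (fun x => motionIntegral ω (ψ 0) (ψ' 0) + ψ x ^ 2 * (ω - ψ x ^ 2 / 2)) =ᶠ[atTop]
      fun x => ψ' x ^ 2 := by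
    filter_upwards [eventually_ge_atTop 0] with x hx
    rw [h.motionIntegral_eq ordConnected_Ici self_mem_Ici hx, motionIntegral]
    ring
  have h3 := (h1.congr' h2)
  have h4 : IntegrableAtFilter (fun x => ψ' x ^ 2) atTop := ⟨Ici 0, Ici_mem_atTop 0, hint⟩
  have h5 := h4.eq_zero_of_tendsto (fun s hs => by
    obtain ⟨a, ha⟩ := mem_atTop_sets.1 hs
    exact top_unique ((Real.volume_Ici (a := a)).ge.trans (measure_mono fun x hx => ha x hx))) h3
  simpa using h5

/-- A profile that is up to a phase the half-line part of a function of finite energy has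
vanishing energy. -/
theorem motionIntegral_eq_zero_of_isH1On {ω : ℝ} {ψ ψ' : ℝ → ℝ} {f : ℝ → ℂ} {z : ℂ} (hz : ‖z‖ = 1)
    (h : SolvesNLS ω (Ici 0) ψ ψ') (hf : IsH1On (Ici 0) f)
    (hfψ : ∀ x ∈ Ici (0 : ℝ), f x = z * ψ x) :
    motionIntegral ω (ψ 0) (ψ' 0) = 0 := by
  refine h.motionIntegral_eq_zero ?_ ?_
  · have h1 := hf.tendsto_zero.norm
    rw [norm_zero] at h1
    refine squeeze_zero_norm' ?_ h1
    filter_upwards [eventually_ge_atTop 0] with x hx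
    rw [hfψ x hx, norm_mul, hz, one_mul, Complex.norm_real]
  · have h1 := (integrableOn_sq_norm hf.2.1).mono_set Ioi_subset_Ici_self
    rw [integrableOn_Ici_iff_integrableOn_Ioi]
    refine h1.congr_fun (fun x hx => ?_) measurableSet_Ioi
    have h2 : HasDerivAt f (z * ψ' x) x := by
      refine ((h.1 x).ofReal_comp.const_mul z).congr_of_eventuallyEq ?_
      filter_upwards [Ioi_mem_nhds hx] with y hy
      exact hfψ y (mem_Ici.2 (le_of_lt hy))
    simp only [h2.deriv, norm_mul, hz, one_mul, Complex.norm_real, Real.norm_eq_abs, sq_abs]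

/-! ### The loop -/

theorem SolvesNLS.exists_eqOn_profileDn_of_le {ω L x₀ : ℝ} (hω : 0 < ω) {φ φ' : ℝ → ℝ}
    (h : SolvesNLS ω (Icc (-L) L) φ φ') (hx₀ : x₀ ∈ Icc (-L) L) (hpos : 0 < φ x₀) (h0 : φ' x₀ = 0)
    (h1 : ω ≤ φ x₀ ^ 2) (h2 : φ x₀ ^ 2 < 2 * ω) :
    ∃ k : ℝ, 0 ≤ k ∧ k < 1 ∧ (φ x₀ ^ 2 ≠ ω → 0 < k) ∧
      EqOn φ (profileDn ω k (-(√(ω / (2 - k ^ 2)) * x₀))) (Icc (-L) L) ∧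
      EqOn φ' (profileDn' ω k (-(√(ω / (2 - k ^ 2)) * x₀))) (Icc (-L) L) := by
  set M := φ x₀
  have hM : 0 < M ^ 2 := by positivity
  have hnn : 0 ≤ 2 - 2 * ω / M ^ 2 := by
    rw [sub_nonneg, div_le_iff₀ hM]; linarith
  have hlt : 2 - 2 * ω / M ^ 2 < 1 := by
    have : 1 < 2 * ω / M ^ 2 := (one_lt_div hM).2 h2
    linarith
  -- At the maximum dn equals 1, so the amplitude must be `M`, that is `2ω / (2 - k²) = M²`. The
  -- constant solution `M² = ω` gives `k = 0`.
  set k := √(2 - 2 * ω / M ^ 2) with hk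
  have hk2 : k ^ 2 = 2 - 2 * ω / M ^ 2 := Real.sq_sqrt hnn
  have hk1 : k < 1 := by
    rw [hk, Real.sqrt_lt' one_pos]; simpa using hlt
  have hA : √(2 * ω / (2 - k ^ 2)) = M := by
    rw [hk2, sub_sub_cancel, div_div_cancel₀ (by positivity), Real.sqrt_sq hpos.le]
  refine ⟨k, Real.sqrt_nonneg _, hk1, fun hne => ?_, ?_⟩
  · refine Real.sqrt_pos.2 ?_
    rw [sub_pos, div_lt_iff₀ hM]
    have := lt_of_le_of_ne h1 hne.symm
    linarith
  · have ha := jacobiAm_zero (Real.sqrt_nonneg _) hk1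
    refine h.eqOn hω.le (solvesNLS_profileDn hω (Real.sqrt_nonneg _) hk1 _ _) hx₀ ?_ ?_
    · rw [profileDn, hA, add_neg_cancel, jacobiDn, ha]; simp [M]
    · rw [profileDn', add_neg_cancel, ha, h0]; simp

theorem SolvesNLS.exists_eqOn_profileDn_of_lt {ω L : ℝ} (hω : 0 < ω) (hL : 0 < L) {φ φ' : ℝ → ℝ}
    (h : SolvesNLS ω (Icc (-L) L) φ φ') (hpos : 0 < φ 0) (h0 : φ' 0 = 0) (h1 : φ 0 ^ 2 < ω) :
    ∃ k : ℝ, 0 < k ∧ k < 1 ∧ EqOn φ (profileDn ω k (ellipticK k)) (Icc (-L) L) ∧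
      EqOn φ' (profileDn' ω k (ellipticK k)) (Icc (-L) L) := by
  set m := φ 0
  have hm : 0 < m ^ 2 := by positivity
  have hd : 0 < 2 * ω - m ^ 2 := by linarith
  have hp : 0 < (2 * ω - 2 * m ^ 2) / (2 * ω - m ^ 2) := div_pos (by linarith) hd
  -- At `ellipticK k` the minimum `√(1 - k²)` of dn is reached, so `k` solves `2ω (1 - k²) / (2 -
  -- k²) = m²`.
  set k := √((2 * ω - 2 * m ^ 2) / (2 * ω - m ^ 2)) with hk
  have hk2 : k ^ 2 = (2 * ω - 2 * m ^ 2) / (2 * ω - m ^ 2) := Real.sq_sqrt hp.le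
  have hk0 : 0 < k := Real.sqrt_pos.2 hp
  have hk1 : k < 1 := by
    rw [hk, Real.sqrt_lt' one_pos, one_pow, div_lt_one hd]; linarith
  have hA : √(2 * ω / (2 - k ^ 2)) ^ 2 = 2 * ω - m ^ 2 := by
    have e : 2 - k ^ 2 = 2 * ω / (2 * ω - m ^ 2) := by rw [hk2]; field_simp; ring
    rw [e, div_div_cancel₀ (by positivity), Real.sq_sqrt hd.le]
  have ha := jacobiAm_ellipticK hk0.le hk1
  refine ⟨k, hk0, hk1, h.eqOn hω.le (solvesNLS_profileDn hω hk0.le hk1 _ _)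
    (t := 0) ⟨by linarith, hL.le⟩ ?_ ?_⟩
  · refine (pow_left_inj₀ hpos.le (mul_nonneg (Real.sqrt_nonneg _)
      (jacobiDn_pos hk0.le hk1 _).le) two_ne_zero).1 ?_
    rw [mul_pow, hA, jacobiDn_sq hk0.le hk1, mul_zero, zero_add, ha, sin_pi_div_two, hk2]
    field_simp
    simp [m]
    ring
  · rw [profileDn', mul_zero, zero_add, jacobiCn, ha, h0]; simp

theorem SolvesNLS.exists_eqOn_profileDn {ω L : ℝ} (hω : 0 < ω) (hL : 0 < L) {φ φ' : ℝ → ℝ}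
    (h : SolvesNLS ω (Icc (-L) L) φ φ') (hpos : 0 < φ 0) (h0 : φ' 0 = 0) (h1 : φ 0 ^ 2 < 2 * ω) :
    ∃ k a : ℝ, 0 ≤ k ∧ k < 1 ∧ (a = 0 ∨ a = ellipticK k) ∧ (φ 0 ^ 2 ≠ ω → 0 < k) ∧
      EqOn φ (profileDn ω k a) (Icc (-L) L) ∧ EqOn φ' (profileDn' ω k a) (Icc (-L) L) := by
  rcases le_or_gt ω (φ 0 ^ 2) with h2 | h2
  · obtain ⟨k, hk, hk1, hk0, e⟩ := h.exists_eqOn_profileDn_of_le hω (x₀ := 0)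
      ⟨by linarith, hL.le⟩ hpos h0 h2 h1
    rw [mul_zero, neg_zero] at e
    exact ⟨k, 0, hk, hk1, Or.inl rfl, hk0, e⟩
  · obtain ⟨k, hk, hk1, e⟩ := h.exists_eqOn_profileDn_of_lt hω hL hpos h0 h2
    exact ⟨k, _, hk.le, hk1, Or.inr rfl, fun _ => hk, e⟩

theorem SolvesNLS.isEvenDnoidal {ω L : ℝ} (hω : 0 < ω) (hL : 0 < L) {φ φ' : ℝ → ℝ}
    (h : SolvesNLS ω (Icc (-L) L) φ φ') (hpos : 0 < φ 0) (h0 : φ' 0 = 0) (h1 : φ 0 ^ 2 < 2 * ω) :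
    IsEvenDnoidal ω L φ := by
  obtain ⟨k, a, hk, hk1, ha, -, e, -⟩ := h.exists_eqOn_profileDn hω hL hpos h0 h1
  exact ⟨k, a, hk, hk1, ha, e⟩

theorem SolvesNLS.isCenteredSech {ω L : ℝ} (hω : 0 < ω) (hL : 0 < L) {φ φ' : ℝ → ℝ}
    (h : SolvesNLS ω (Icc (-L) L) φ φ') (hpos : 0 < φ 0) (h0 : φ' 0 = 0) (h1 : φ 0 ^ 2 = 2 * ω) :
    IsCenteredSech ω L φ := by
  refine (h.eqOn hω.le (solvesNLS_profileSech hω 0 _) (t := 0) ⟨by linarith, hL.le⟩ ?_ ?_).1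
  · simp [profileSech, ← h1, Real.sqrt_sq hpos.le]
  · simp [h0]

theorem SolvesNLS.isCenteredCnoidal {ω L : ℝ} (hω : 0 < ω) (hL : 0 < L) {φ φ' : ℝ → ℝ}
    (h : SolvesNLS ω (Icc (-L) L) φ φ') (hpos : ∀ x ∈ Icc (-L) L, 0 < φ x) (h0 : φ' 0 = 0)
    (h1 : 2 * ω < φ 0 ^ 2) : IsCenteredCnoidal ω L φ := by
  have hm0 : 0 < φ 0 := hpos 0 ⟨by linarith, hL.le⟩
  set m := φ 0
  have hd : 0 < m ^ 2 - ω := by linarith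
  have hp : 0 < m ^ 2 / (2 * (m ^ 2 - ω)) := by positivity
  -- At 0 cn equals 1, so `k` solves `2ωk² / (2k² - 1) = m²`.
  set k := √(m ^ 2 / (2 * (m ^ 2 - ω))) with hk
  have hk2 : k ^ 2 = m ^ 2 / (2 * (m ^ 2 - ω)) := Real.sq_sqrt hp.le
  have hk1 : k < 1 := by
    rw [hk, Real.sqrt_lt' one_pos, one_pow, div_lt_one (by positivity)]; linarith
  have hkl : 1 / √2 < k := by
    rw [← Real.sqrt_one, ← Real.sqrt_div zero_le_one]
    refine Real.sqrt_lt_sqrt (by norm_num) ?_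
    rw [div_lt_div_iff₀ two_pos (by positivity)]; linarith
  have hk0 : 0 ≤ k := Real.sqrt_nonneg _
  have e : 2 * k ^ 2 - 1 = ω / (m ^ 2 - ω) := by rw [hk2]; field_simp; ring
  have hA : √(2 * ω * k ^ 2 / (2 * k ^ 2 - 1)) = m := by
    have e' : 2 * ω * k ^ 2 / (2 * k ^ 2 - 1) = m ^ 2 := by rw [e, hk2]; field_simp
    rw [e', Real.sqrt_sq hm0.le]
  have ha := jacobiAm_zero hk0 hk1
  have heq := (h.eqOn hω.le (solvesNLS_profileCn hω hkl hk1 0 _)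
    (t := 0) ⟨by linarith, hL.le⟩ (by
      rw [profileCn, hA, mul_zero, zero_add, jacobiCn, ha]; simp [m]) (by
      rw [profileCn', mul_zero, zero_add, ha, h0]; simp)).1
  refine ⟨k, hkl, hk1, ?_, heq⟩
  -- A longer loop would contain the first positive zero of the cnoidal profile.
  by_contra! hle
  have hmem : √((2 * k ^ 2 - 1) / ω) * ellipticK k ∈ Icc (-L) L :=
    ⟨by linarith [mul_nonneg (Real.sqrt_nonneg ((2 * k ^ 2 - 1) / ω)) (ellipticK_pos hk0 hk1).le],
      hle⟩
  have h3 := hpos _ hmem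
  have hB : √(ω / (2 * k ^ 2 - 1)) * √((2 * k ^ 2 - 1) / ω) = 1 := by
    have : 0 < 2 * k ^ 2 - 1 := by rw [e]; positivity
    rw [← Real.sqrt_mul (by positivity), div_mul_div_cancel₀ this.ne', div_self hω.ne',
        Real.sqrt_one]
  rw [heq hmem, profileCn, ← mul_assoc (√(ω / _)), hB, one_mul, add_zero, jacobiCn,
    jacobiAm_ellipticK hk0 hk1, cos_pi_div_two, mul_zero] at h3
  exact h3.false

theorem exists_nat_of_int_mul_ellipticK {ω k L : ℝ} (hω : 0 < ω) (hL : 0 < L) (hk : 0 ≤ k)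
    (hk1 : k < 1) {j : ℤ} (h : √(ω / (2 - k ^ 2)) * L = j * ellipticK k) :
    ∃ n : ℕ, 1 ≤ n ∧ L = n * √((2 - k ^ 2) / ω) * ellipticK k := by
  have hk2 : 0 < 2 - k ^ 2 := by nlinarith
  have hB0 : 0 < √(ω / (2 - k ^ 2)) := Real.sqrt_pos.2 (by positivity)
  have hB : √((2 - k ^ 2) / ω) * √(ω / (2 - k ^ 2)) = 1 := by
    rw [← Real.sqrt_mul (by positivity), div_mul_div_cancel₀ hω.ne', div_self hk2.ne',
      Real.sqrt_one]
  have hj : 0 < j := by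
    have : 0 < (j : ℝ) * ellipticK k := h ▸ mul_pos hB0 hL
    exact_mod_cast pos_of_mul_pos_left this (ellipticK_pos hk hk1).le
  lift j to ℕ using hj.le
  refine ⟨j, by exact_mod_cast hj, ?_⟩
  push_cast at h
  calc L = √((2 - k ^ 2) / ω) * (√(ω / (2 - k ^ 2)) * L) := by rw [← mul_assoc, hB, one_mul]
    _ = _ := by rw [h]; ring

theorem exists_interior_max {L : ℝ} (hL : 0 < L) {f f' : ℝ → ℝ} (hd : ∀ x, HasDerivAt f (f' x) x)
    (h0 : f L = f (-L)) (h1 : f' L = f' (-L)) (hne : f' (-L) ≠ 0) :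
    ∃ x ∈ Ioo (-L) L, (∀ y ∈ Icc (-L) L, f y ≤ f x) ∧ f' x = 0 := by
  have hLL : -L < L := by linarith
  obtain ⟨x, hx, hmax⟩ := isCompact_Icc.exists_isMaxOn (nonempty_Icc.2 hLL.le)
    (fun x _ => (hd x).continuousAt.continuousWithinAt)
  have hmax' : ∀ y ∈ Icc (-L) L, f y ≤ f x := fun y hy => hmax hy
  -- A maximum at `-L` is also attained at `L`, so one-sided differentiation gives `f' (-L) ≤ 0 ≤ f'
  -- L`; equal slopes would then vanish.
  have hend : ¬ ∀ y ∈ Icc (-L) L, f y ≤ f (-L) := fun hle => by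
    have g1 := deriv_nonneg_of_right ((hd (-L)).const_sub (f (-L))) (by simp) hLL
      fun y hy => sub_nonneg.2 (hle y hy)
    have g2 := deriv_nonneg_of_right (x := -L) (f := fun y => f (-L) - f (-y)) (d := f' L)
      (by simpa using ((hd (-(-L))).comp (-L) (hasDerivAt_neg (-L))).const_sub (f (-L)))
      (by simp [h0]) hLL fun y hy =>
          sub_nonneg.2 (hle (-y) ⟨by linarith [hy.2], by linarith [hy.1]⟩)
    rw [h1] at g2
    exact hne (le_antisymm (by linarith) g2)
  have hx1 : -L ≠ x := by rintro rfl; exact hend hmax'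
  have hx2 : x ≠ L := by rintro rfl; rw [h0] at hmax'; exact hend hmax'
  have hxI : x ∈ Ioo (-L) L := ⟨lt_of_le_of_ne hx.1 hx1, lt_of_le_of_ne hx.2 hx2⟩
  refine ⟨x, hxI, hmax', IsLocalMax.hasDerivAt_eq_zero (f := f) ?_ (hd x)⟩
  filter_upwards [Icc_mem_nhds hxI.1 hxI.2] with y hy using hmax' y hy

theorem SolvesNLS.exists_eqOn_profileDn_of_periodic {ω L : ℝ} (hω : 0 < ω) (hL : 0 < L)
    {φ φ' : ℝ → ℝ} (h : SolvesNLS ω (Icc (-L) L) φ φ') (hpos : ∀ x ∈ Icc (-L) L, 0 < φ x)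
    (h0 : φ L = φ (-L)) (h1 : φ' L = φ' (-L)) (hne : φ' (-L) ≠ 0) :
    motionIntegral ω (φ (-L)) (φ' (-L)) < 0 ∧
    ∃ (k a : ℝ) (n : ℕ), 0 < k ∧ k < 1 ∧ 1 ≤ n ∧ L = n * √((2 - k ^ 2) / ω) * ellipticK k ∧
      EqOn φ (profileDn ω k a) (Icc (-L) L) := by
  have hl : -L ∈ Icc (-L) L := left_mem_Icc.2 (by linarith)
  have hr : L ∈ Icc (-L) L := right_mem_Icc.2 (by linarith)
  obtain ⟨x, hx, hmax, hdx⟩ := exists_interior_max hL h.1 h0 h1 hne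
  -- Applied to `-φ`, this yields an interior minimum of `φ`.
  obtain ⟨y, hy, hmin, hdy⟩ := exists_interior_max hL (fun t => (h.1 t).neg)
    (by simp [h0]) (by simp [h1]) (by simpa using hne)
  have hx' := Ioo_subset_Icc_self hx
  have hy' := Ioo_subset_Icc_self hy
  have hmin' : ∀ t ∈ Icc (-L) L, φ y ≤ φ t := fun t ht => by simpa using hmin t ht
  have hdy' : φ' y = 0 := by simpa using hdy
  have e1 := h.motionIntegral_eq ordConnected_Icc hl hx'
  have e2 := h.motionIntegral_eq ordConnected_Icc hx' hy'
  rw [hdx] at e1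
  rw [hdx, hdy'] at e2
  have py := hpos y hy'
  have px := hpos x hx'
  have hlt : φ y < φ x := by
    refine lt_of_le_of_ne (hmax y hy') fun heq => hne ?_
    have : φ (-L) = φ x := le_antisymm (hmax _ hl) (heq ▸ hmin' _ hl)
    rw [this, motionIntegral, motionIntegral] at e1
    exact pow_eq_zero_iff two_ne_zero |>.1 (by linarith)
  have hsq : φ y ^ 2 < φ x ^ 2 := pow_lt_pow_left₀ hlt py.le two_ne_zero
  -- Both extrema are critical points on one energy level, so their squares are the two distinct
  -- roots of a quadratic with root sum `2 * ω`. This places the maximum strictly between `√ω` and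
  -- `√(2 * ω)`.
  have hsum : φ x ^ 2 + φ y ^ 2 = 2 * ω := by
    have : (φ x ^ 2 - φ y ^ 2) * (φ x ^ 2 + φ y ^ 2 - 2 * ω) = 0 := by
      rw [motionIntegral, motionIntegral] at e2; linear_combination 2 * e2
    rcases mul_eq_zero.1 this with h3 | h3 <;> linarith
  have hy2 : 0 < φ y ^ 2 := by positivity
  obtain ⟨k, -, hk1, hk, f1, f2⟩ := h.exists_eqOn_profileDn_of_le hω hx' px hdx
    (by linarith) (by linarith)
  have hk0 : 0 < k := hk (by linarith)
  have hk2 : 0 < 2 - k ^ 2 := by nlinarith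
  refine ⟨?_, ?_⟩
  · rw [e1, motionIntegral]
    nlinarith
  · rw [f1 hr, f1 hl, profileDn, profileDn] at h0
    rw [f2 hr, f2 hl, profileDn', profileDn'] at h1
    set a := -(√(ω / (2 - k ^ 2)) * x)
    have hA : √(2 * ω / (2 - k ^ 2)) ≠ 0 := (Real.sqrt_pos.2 (by positivity)).ne'
    have hB : √(ω / (2 - k ^ 2)) ≠ 0 := (Real.sqrt_pos.2 (by positivity)).ne'
    -- Equal values and slopes at `-L` and `L` make `2 * L` a whole number of periods.
    obtain ⟨j, hj⟩ := sub_eq_int_mul_two_ellipticK hk0.le hk1 hk0.ne' (mul_left_cancel₀ hA h0)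
      (mul_left_cancel₀ (mul_ne_zero (mul_ne_zero hA hB) (pow_ne_zero 2 hk0.ne')) (neg_inj.1 h1))
    obtain ⟨n, hn, e⟩ := exists_nat_of_int_mul_ellipticK hω hL hk0.le hk1 (j := j) (by linarith)
    exact ⟨k, a, n, hk0, hk1, hn, e, f1⟩

/-! ### The list of shapes -/

theorem vertexData_eq {L d : ℝ} (hL : 0 < L) {φ : ℝ → ℝ} (h : HasDerivAt φ d (-L)) :
    vertexData L φ = (φ (-L), d) := by
  rw [vertexData, h.hasDerivWithinAt.derivWithin
    (uniqueDiffOn_Icc (by linarith) _ (left_mem_Icc.2 (by linarith)))]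

theorem neg_div_sqrt_artanh {ω γ : ℝ} (h : -γ / √ω ∈ Ioo (-1 : ℝ) 1) :
    artanh (-γ / √ω) = -artanh (γ / √ω) := by
  rw [neg_div] at h ⊢
  exact artanh_neg_eq ⟨by linarith [h.2], by linarith [h.1]⟩

theorem SolvesNLS.nonEvenShape {ω γ L s : ℝ} (hω : 0 < ω) (hL : 0 < L)
    {φ φ' ψ ψ' : ℝ → ℝ} (hφ : ∀ x ∈ Icc (-L) L, 0 < φ x) (hφs : SolvesNLS ω (Icc (-L) L) φ φ')
    (hψs : SolvesNLS ω (Ici 0) ψ ψ') (h0 : φ L = φ (-L)) (h0' : φ (-L) = ψ 0)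
    (hk : φ' (-L) - φ' L + ψ' 0 = γ * ψ 0) (hs : s ^ 2 = ω - φ (-L) ^ 2 / 2)
    (hψ' : ψ' 0 = -(φ (-L) * s)) (hq : φ' L = φ' (-L)) (hq0 : φ' (-L) ≠ 0) :
    NonEvenShape ω γ L φ ψ := by
  have hl : -L ∈ Icc (-L) L := left_mem_Icc.2 (by linarith)
  have hr : L ∈ Icc (-L) L := right_mem_Icc.2 (by linarith)
  have hp := hφ _ hl
  -- Equal slopes at the two ends of the loop cancel in the δ-condition, which leaves `ψ' 0 = γ * ψ
  -- 0`.
  have hsγ : s = -γ := by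
    have : φ (-L) * (s + γ) = 0 := by rw [hq, hψ', ← h0'] at hk; linarith
    linarith [(mul_eq_zero.1 this).resolve_left hp.ne']
  obtain ⟨hmem, hsech⟩ := hψs.eqOn_profileSech hω (h0' ▸ hp) (h0' ▸ hs) (h0' ▸ hψ')
  obtain ⟨hE, hdn⟩ := hφs.exists_eqOn_profileDn_of_periodic hω hL hφ h0 hq hq0
  refine ⟨fun hev => ?_, ?_, h0.symm, h0.trans h0', ?_, hdn⟩
  · have h1 : HasDerivWithinAt (fun x => φ (-x)) (-φ' (-L)) (Icc (-L) L) L := by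
      have := (hφs.1 (-L)).comp L (hasDerivAt_neg L)
      rw [mul_neg_one] at this
      exact this.hasDerivWithinAt
    have h2 : φ' L = -φ' (-L) := (uniqueDiffOn_Icc (by linarith) _ hr).eq_deriv _
      (hφs.1 L).hasDerivWithinAt (h1.congr (fun x hx => (hev x hx).symm) (hev L hr).symm)
    exact hq0 (by linarith)
  · rw [vertexData_eq hL (hφs.1 (-L))]
    refine ⟨?_, hq0, hE⟩
    change φ (-L) = _
    rw [← Real.sqrt_sq hp.le]
    congr 1
    rw [hsγ, neg_sq] at hs
    linarith
  · rw [← neg_div_sqrt_artanh (hsγ ▸ hmem), ← hsγ]; exact hsech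

theorem SolvesNLS.const_or_exists_eqOn_profileDn {ω γ L : ℝ} (hω : 0 < ω) (hγ : 0 < γ)
    (hL : 0 < L) {φ φ' : ℝ → ℝ} (h : SolvesNLS ω (Icc (-L) L) φ φ')
    (hpos : ∀ x ∈ Icc (-L) L, 0 < φ x) (h0 : φ' 0 = 0) (hl0 : φ' (-L) = 0) (hr0 : φ' L = 0)
    (hp : φ (-L) ^ 2 = 2 * (ω - γ ^ 2)) :
    (γ = √(ω / 2) ∧ ∀ x ∈ Icc (-L) L, φ x = √ω) ∨
     (γ ≠ √(ω / 2) ∧ ∃ (k a : ℝ) (n : ℕ), 0 < k ∧ k < 1 ∧ (a = 0 ∨ a = ellipticK k) ∧ 1 ≤ n ∧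
        L = n * √((2 - k ^ 2) / ω) * ellipticK k ∧ EqOn φ (profileDn ω k a) (Icc (-L) L)) := by
  have hl : -L ∈ Icc (-L) L := left_mem_Icc.2 (by linarith)
  have hr : L ∈ Icc (-L) L := right_mem_Icc.2 (by linarith)
  have hz : (0 : ℝ) ∈ Icc (-L) L := ⟨by linarith, hL.le⟩
  have hpl := hpos _ hl
  have hm := hpos 0 hz
  have hE := h.motionIntegral_eq ordConnected_Icc hl hz
  rw [h0, hl0, motionIntegral, motionIntegral] at hE
  set p := φ (-L)
  set m := φ 0
  have hγ2 : γ = √(ω / 2) ↔ p ^ 2 = ω := by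
    rw [eq_comm, Real.sqrt_eq_iff_mul_self_eq (by positivity) hγ.le, hp]
    constructor <;> intro h <;> linarith
  by_cases hc : γ = √(ω / 2)
  · refine Or.inl ⟨hc, ?_⟩
    have hpω : p = √ω := by rw [← hγ2.1 hc, Real.sqrt_sq hpl.le]
    have hcs : SolvesNLS ω (Icc (-L) L) (fun _ => √ω) (fun _ => 0) := by
      refine ⟨fun x => hasDerivAt_const x _, fun x _ => ?_⟩
      have e : ω * √ω - √ω ^ 3 = 0 := by rw [pow_succ, Real.sq_sqrt hω.le, sub_self]
      rw [e]; exact hasDerivAt_const x _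
    exact fun x hx => (h.eqOn hω.le hcs hl hpω hl0).1 hx
  · refine Or.inr ⟨hc, ?_⟩
    have hpω : p ^ 2 ≠ ω := fun h => hc (hγ2.2 h)
    have hp2 : 0 < p ^ 2 := by positivity
    have hm2 : 0 < m ^ 2 := by positivity
    have hlt : m ^ 2 < 2 * ω := by
      by_contra! hle
      linarith [mul_nonneg hm2.le (sub_nonneg.2 hle),
        mul_pos hp2 (show 0 < 2 * ω - p ^ 2 by linarith [sq_pos_of_pos hγ])]
    obtain ⟨k, a, -, hk1, ha, hk0, f1, f2⟩ := h.exists_eqOn_profileDn hω hL hm h0 hlt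
    -- Among critical values the energy is smallest at `√ω`, so `m ^ 2 = ω` would force `p ^ 2 = ω`.
    have hk0 : 0 < k := hk0 fun (h : m ^ 2 = ω) => hpω <| by
      have h2 : (p ^ 2 - ω) ^ 2 = 0 := by
        rw [h] at hE
        linear_combination 2 * hE
      exact sub_eq_zero.1 (pow_eq_zero_iff two_ne_zero |>.1 h2)
    have hk2 : 0 < 2 - k ^ 2 := by nlinarith
    have hqr := f2 hr
    rw [hr0, profileDn', zero_eq_neg] at hqr
    have hA : √(2 * ω / (2 - k ^ 2)) ≠ 0 := (Real.sqrt_pos.2 (by positivity)).ne'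
    have hB : √(ω / (2 - k ^ 2)) ≠ 0 := (Real.sqrt_pos.2 (by positivity)).ne'
    obtain ⟨j, hj⟩ := eq_int_mul_ellipticK hk0.le hk1 ((mul_eq_zero.1 hqr).resolve_left
      (mul_ne_zero (mul_ne_zero hA hB) (pow_ne_zero 2 hk0.ne')))
    -- The shift `a` is 0 or one `ellipticK k` and is absorbed into the integer.
    obtain ⟨i, hi⟩ : ∃ i : ℤ, √(ω / (2 - k ^ 2)) * L = i * ellipticK k := by
      rcases ha with rfl | rfl
      · exact ⟨j, by linarith⟩
      · exact ⟨j - 1, by push_cast; linarith⟩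
    obtain ⟨n, hn, e⟩ := exists_nat_of_int_mul_ellipticK hω hL hk0.le hk1 hi
    exact ⟨k, a, n, hk0, hk1, ha, hn, e, f1⟩

/-- With `p = φ (-L)`, the δ-condition gives `φ' (-L) = p / 2 * (γ + s)`, and the energy of the loop
becomes `p² / 4 * (γ - s) * (γ + 3s)`. Its sign selects cn, sech or dn, while the sign of `s`
selects tail, half soliton or bump. Through `p² = 2 (ω - s²)` the values `s = γ, 0, -γ / 3, -γ`
become the thresholds for `p`. -/
theorem SolvesNLS.evenShape {ω γ L s : ℝ} (hω : 0 < ω) (hγ : 0 < γ) (hL : 0 < L)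
    {φ φ' ψ ψ' : ℝ → ℝ} (hφ : ∀ x ∈ Icc (-L) L, 0 < φ x) (hφs : SolvesNLS ω (Icc (-L) L) φ φ')
    (hψs : SolvesNLS ω (Ici 0) ψ ψ') (h0 : φ L = φ (-L)) (h0' : φ (-L) = ψ 0)
    (hk : φ' (-L) - φ' L + ψ' 0 = γ * ψ 0) (hs : s ^ 2 = ω - φ (-L) ^ 2 / 2)
    (hψ' : ψ' 0 = -(φ (-L) * s)) (hne : φ' L = -φ' (-L)) : EvenShape ω γ L φ ψ := by
  have hl : -L ∈ Icc (-L) L := left_mem_Icc.2 (by linarith)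
  have hz : (0 : ℝ) ∈ Icc (-L) L := ⟨by linarith, hL.le⟩
  have hv := vertexData_eq hL (hφs.1 (-L))
  obtain ⟨hmem, hsech⟩ := hψs.eqOn_profileSech hω (h0' ▸ hφ _ hl) (h0' ▸ hs) (h0' ▸ hψ')
  rw [← h0'] at hk
  have hp := hφ _ hl
  have hm := hφ 0 hz
  have h0E := hφs.motionIntegral_eq ordConnected_Icc hl hz
  obtain ⟨hev, hd0⟩ := hφs.even hω.le hL h0 hne
  have hq : φ' (-L) = φ (-L) / 2 * (γ + s) := by rw [hne, hψ'] at hk; linarith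
  have hE : φ (-L) ^ 2 / 4 * ((γ - s) * (γ + 3 * s)) = φ 0 ^ 2 / 2 * (φ 0 ^ 2 - 2 * ω) := by
    rw [hd0, motionIntegral, motionIntegral, hq, ← hs] at h0E
    linear_combination h0E
  have hp4 : 0 < φ (-L) ^ 2 / 4 := by positivity
  have hm2 : 0 < φ 0 ^ 2 / 2 := by positivity
  have hdn : (γ - s) * (γ + 3 * s) < 0 → IsEvenDnoidal ω L φ := fun h =>
    hφs.isEvenDnoidal hω hL hm hd0 (by
      by_contra! hle
      linarith [mul_neg_of_pos_of_neg hp4 h, mul_nonneg hm2.le (sub_nonneg.2 hle)])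
  have hse : (γ - s) * (γ + 3 * s) = 0 → IsCenteredSech ω L φ := fun h =>
    hφs.isCenteredSech hω hL hm hd0 (by
      rw [h, mul_zero] at hE
      linarith [(mul_eq_zero.1 hE.symm).resolve_left hm2.ne'])
  have hcn : 0 < (γ - s) * (γ + 3 * s) → IsCenteredCnoidal ω L φ := fun h =>
    hφs.isCenteredCnoidal hω hL hφ hd0 (by
      by_contra! hle
      linarith [mul_pos hp4 h, mul_nonneg hm2.le (sub_nonneg.2 hle)])
  have hst := fun hs : s = -γ => hφs.const_or_exists_eqOn_profileDn hω hγ hL hφ hd0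
    (by rw [hq, hs]; ring) (by rw [hne, hq, hs]; ring)
  have hp2 : φ (-L) ^ 2 = 2 * (ω - s ^ 2) := by linarith
  have hrt : √(ω - φ (-L) ^ 2 / 2) = |s| := by rw [← hs, Real.sqrt_sq_eq_abs]
  have lt_of : ∀ {c : ℝ}, 2 * (ω - s ^ 2) < c → φ (-L) < √c := fun h =>
    (Real.lt_sqrt hp.le).2 (hp2 ▸ h)
  have eq_of : ∀ {c : ℝ}, 2 * (ω - s ^ 2) = c → φ (-L) = √c := fun h => by
    rw [← h, ← hp2, Real.sqrt_sq hp.le]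
  have gt_of : ∀ {c : ℝ}, c < 2 * (ω - s ^ 2) → √c < φ (-L) := fun h =>
    (Real.sqrt_lt' hp).2 (hp2 ▸ h)
  refine ⟨hev, ?_⟩
  rcases lt_trichotomy s 0 with hs0 | hs0 | hs0
  · have hs2 : 0 < s ^ 2 := sq_pos_of_neg hs0
    have hqm : φ' (-L) = qMinus ω γ (φ (-L)) := by rw [qMinus, hrt, abs_of_neg hs0, hq]; ring
    have hb : IsBump ω ψ :=
      ⟨_, artanh_neg ⟨hmem.1, div_neg_of_neg_of_pos hs0 (Real.sqrt_pos.2 hω)⟩, hsech⟩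
    have hp2ω : φ (-L) < √(2 * ω) := lt_of (by linarith)
    rcases lt_trichotomy s (-γ) with hsγ | hsγ | hsγ
    · have hpl : φ (-L) < √(2 * (ω - γ ^ 2)) := lt_of (by nlinarith only [hsγ, hγ])
      refine Or.inr (Or.inr (Or.inr (Or.inr ⟨?_, hpl, hb, hdn ?_⟩)))
      · rw [hv, hqm]
        exact ⟨_, ⟨hp, hpl.le⟩, rfl⟩
      · exact mul_neg_of_pos_of_neg (by linarith) (by linarith)
    · have hsq : 2 * (ω - s ^ 2) = 2 * (ω - γ ^ 2) := by rw [hsγ, neg_sq]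
      refine Or.inr (Or.inr (Or.inr (Or.inl ⟨?_, ?_, hst hsγ (hp2.trans hsq)⟩)))
      · rw [hv, hq, hsγ, ← eq_of hsq, add_neg_cancel, mul_zero]
      · rw [← neg_div_sqrt_artanh (hsγ ▸ hmem), ← hsγ]; exact hsech
    · have hpg : √(2 * (ω - γ ^ 2)) < φ (-L) := gt_of (by nlinarith only [hsγ, hs0, hγ])
      refine Or.inr (Or.inr (Or.inl ⟨?_, hp2ω, hb, ?_⟩))
      · rw [hv, hqm]
        exact ⟨_, ⟨hpg.le, hp2ω.le⟩, rfl⟩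
      · have hγs : 0 < γ - s := by linarith
        rcases lt_trichotomy (γ + 3 * s) 0 with h3 | h3 | h3
        · exact Or.inr (Or.inr ⟨hpg, lt_of (by nlinarith only [h3, hγ]),
            hdn (mul_neg_of_pos_of_neg hγs h3)⟩)
        · refine Or.inr (Or.inl ⟨eq_of ?_, hse (by rw [h3, mul_zero])⟩)
          rw [show s = -γ / 3 by linarith]; ring
        · exact Or.inl ⟨gt_of (by nlinarith only [h3, hs0, hγ]), hcn (mul_pos hγs h3)⟩
  · have hpe : φ (-L) = √(2 * ω) := eq_of (by rw [hs0]; ring)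
    refine Or.inr (Or.inl ⟨?_, ?_, hcn (by rw [hs0]; nlinarith only [hγ])⟩)
    · rw [hv, ← hpe, qPlus, hrt, hs0, abs_zero, hq, hs0]
    · rwa [hs0, zero_div, artanh_zero] at hsech
  · have hs2 : 0 < s ^ 2 := sq_pos_of_pos hs0
    have hp2ω : φ (-L) < √(2 * ω) := lt_of (by linarith)
    have hγs : 0 < γ + 3 * s := by linarith
    have hqp : φ' (-L) = qPlus ω γ (φ (-L)) := by rw [qPlus, hrt, abs_of_pos hs0, hq]
    refine Or.inl ⟨?_, hp2ω,
      ⟨_, artanh_pos ⟨div_pos hs0 (Real.sqrt_pos.2 hω), hmem.2⟩, hsech⟩, ?_⟩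
    · rw [hv, hqp]
      exact ⟨_, ⟨hp, hp2ω.le⟩, rfl⟩
    · rcases lt_trichotomy s γ with h3 | h3 | h3
      · exact Or.inr (Or.inr ⟨gt_of (by nlinarith only [h3, hs0, hγ]),
          hcn (mul_pos (by linarith) hγs)⟩)
      · exact Or.inr (Or.inl ⟨eq_of (by rw [h3]), hse (by rw [h3]; ring)⟩)
      · exact Or.inl ⟨lt_of (by nlinarith only [h3, hs0, hγ]),
          hdn (mul_neg_of_neg_of_pos (by linarith) hγs)⟩

/-- Conservation of energy on the loop makes the end slopes equal up to sign: opposite slopes lead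
to the even list, equal nonzero slopes to the other case. The parameter `s` is minus the logarithmic
derivative of `ψ` at the vertex. -/
theorem IsActionGroundState.hasListedShape {ω γ L : ℝ} (hω : 0 < ω) (hγ : 0 < γ) (hL : 0 < L)
    {u : GraphFun} (hu : IsActionGroundState ω γ L u) : HasListedShape ω γ L u := by
  obtain ⟨θ, φ, φ', ψ, ψ', hφ, hψ, hφs, hψs, h0, h0', hk⟩ := hu.exists_positive hω hγ.le hL
  have hE := motionIntegral_eq_zero_of_isH1On (Complex.norm_exp_ofReal_mul_I θ) hψs hu.1.1.2.1
    fun x hx => (hψ x hx).2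
  have hp := (hψ 0 self_mem_Ici).1
  refine ⟨θ, φ, ψ, fun x hx => ⟨(hφ x hx).1.le, (hφ x hx).2⟩,
    fun x hx => ⟨(hψ x hx).1.le, (hψ x hx).2⟩, ?_⟩
  have hL' : -L ≤ L := by linarith
  have hs : (-(ψ' 0 / ψ 0)) ^ 2 = ω - φ (-L) ^ 2 / 2 := by
    rw [h0', neg_sq, div_pow, div_eq_iff (by positivity)]
    rw [motionIntegral] at hE
    linarith
  have hψ' : ψ' 0 = -(φ (-L) * -(ψ' 0 / ψ 0)) := by
    rw [h0', mul_neg, neg_neg, mul_div_cancel₀ _ hp.ne']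
  have hφ0 : ∀ x ∈ Icc (-L) L, 0 < φ x := fun x hx => (hφ x hx).1
  by_cases hne : φ' L = -φ' (-L)
  · exact Or.inl (hφs.evenShape hω hγ hL hφ0 hψs h0 h0' hk hs hψ' hne)
  · have hlr := hφs.motionIntegral_eq ordConnected_Icc (left_mem_Icc.2 hL') (right_mem_Icc.2 hL')
    rw [motionIntegral, motionIntegral, h0] at hlr
    have hq := (sq_eq_sq_iff_eq_or_eq_neg.1 (show φ' L ^ 2 = φ' (-L) ^ 2 by linarith)).resolve_right
      hne
    exact Or.inr (hφs.nonEvenShape hω hL hφ0 hψs h0 h0' hk hs hψ' hq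
      fun h => hne (by rw [hq, h, neg_zero]))

end Tadpole
end

theorem theorem1p1 (ω γ : ℝ) (hω : 0 < ω) (hγ : 0 < γ) :
    (γ < (1 - √3 / 2) ^ (1 / 3 : ℝ) * √ω →
      0 < Tadpole.LStar ω γ ∧
      ∀ L : ℝ, 0 < L → L < Tadpole.LStar ω γ →
        ∃ u : Tadpole.GraphFun, Tadpole.IsActionGroundState ω γ L u) ∧
    (γ < √ω →
      0 < Tadpole.LStarStar ω γ ∧
      ∀ L : ℝ, Tadpole.LStarStar ω γ ≤ L →
        ∃ u : Tadpole.GraphFun, Tadpole.IsActionGroundState ω γ L u) ∧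
    (γ < √ω → ∀ L : ℝ, 0 < L → ∀ u : Tadpole.GraphFun,
      Tadpole.IsActionGroundState ω γ L u → Tadpole.HasListedShape ω γ L u) :=
  ⟨fun h => ⟨Tadpole.LStar_pos hω hγ h, fun _ hL hLS =>
      Tadpole.exists_groundState_of_lt_LStar hω hγ h hL hLS⟩,
    fun h => ⟨Tadpole.LStarStar_pos hω hγ h, fun _ hL =>
      Tadpole.exists_groundState_of_LStarStar_le hω hγ h
        ((Tadpole.LStarStar_pos hω hγ h).trans_le hL) hL⟩,
    fun _ _ hL _ hu => hu.hasListedShape hω hγ hL⟩
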